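/- **Theorem (Berry–Esseen bound for the single-split semi-supervised U-statistic).** Let $P_{XY}$ be a probability distribution on a product $\mathcal X\times\mathcal Y$ of measurable spaces, $(X,Y)\sim P_{XY}$, and let $P_X$ and $P_Y$ be its marginals. Let $r\ge 1$, let $\ell:\mathcal Y^r\to\mathbb R$ be measurable and symmetric in its arguments, and let $Y_1,\dots,Y_r$ be i.i.d. from $P_Y$. Put $$\psi=\mathbb E\{\ell(Y_1,\dots,Y_r)\},\quad \sigma_\ell^2=\mathrm{Var}\{\ell(Y_1,\dots,Y_r)\},\quad \ell_1(y)=\mathbb E\{\ell(Y_1,\dots,Y_r)\mid Y_1=y\},$$ $$\psi_1(x)=\mathbb E\{\ell_1(Y)\mid X=x\},\quad \sigma_1^2=\mathbb E[\mathrm{Var}\{\ell_1(Y)\mid X\}],\quad M_{p,\ell_1}=\mathbb E\{|\ell_1(Y)-\mathbb E[\ell_1(Y)]|^p\}.$$ Assume $\sigma_\ell^2<\infty$ and $\sigma_1^2>0$. Let $n>r$ and $m\ge 0$ be integers, and let $\mathcal D_{XY}=\{(X_i,Y_i)\}_{i=1}^n$ be i.i.d. from $P_{XY}$ and $\mathcal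 D_X=\{X_i\}_{i=n+1}^{n+m}$ i.i.d. from $P_X$, with $\mathcal D_{XY}$ and $\mathcal D_X$ independent. Let $\widehat f:\mathcal X\to\mathbb R$ be a (random) function trained on auxiliary data independent of $\mathcal D_{XY}\cup\mathcal D_X$ (with $\widehat f(x)$ jointly measurable in the auxiliary data and $x$), and define the single-split estimator $$U_{\mathrm{single}}=\binom nr^{-1}\sum_{1\le i_1<\dots<i_r\le n}\ell(Y_{i_1},\dots,Y_{i_r})-\frac rn\sum_{i=1}^n\widehat f(X_i)+\frac r{n+m}\sum_{i=1}^{n+m}\widehat f(X_i).$$ With $X\sim P_X$ independent of $\widehat f$, let $M_{p,\widehat f}=\mathbb E[|\widehat f(X)-\mathbb E\{\widehat f(X)\mid\widehat f\}|^p]\in[0,\infty]$ and $$\Lambda_{n,m,\widehat f}=r^2\,\mathrm{Var}\{\ell_1(Y)\}+\frac{r^2m}{n+m}\Bigl[\mathrm{Var}\{\widehat f(X)\mid\widehat f\}-2\,\mathrm{Cov}\{\widehat f(X),\psi_1(X)\mid\widehat f\}\Bigr].$$ Then there exists a constant $C_r>0$ depending only on $r$ such that $$\sup_{t\in\mathbb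 R}\left|\mathbb P\left\{\frac{\sqrt n\,(U_{\mathrm{single}}-\psi)}{\sqrt{\Lambda_{n,m,\widehat f}}}\le t\right\}-\Phi(t)\right|\le C_r\left\{\frac{M_{3,\ell_1}+M_{3,\widehat f}}{\sqrt n\,\sigma_1^3}+\frac{(M_{2,\ell_1}^{1/2}+M_{2,\widehat f}^{1/2}+\sigma_1)\,\sigma_\ell}{\sqrt{n-r}\,\sigma_1^2}\right\},$$ where $\Phi$ is the standard normal distribution function (the bound being trivial if a moment on the right-hand side is infinite). -/

import Mathlib

open MeasureTheory ProbabilityTheory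
open scoped ENNReal NNReal

universe u v w z

namespace SemiSup

noncomputable section

variable {𝒳 : Type u} {𝒴 : Type v} [MeasurableSpace 𝒳] [MeasurableSpace 𝒴] {r : ℕ}

/-- The kernel is symmetric in its arguments. -/
def SymmetricKernel (ℓ : (Fin r → 𝒴) → ℝ) : Prop :=
  ∀ (π : Equiv.Perm (Fin r)) (y : Fin r → 𝒴), ℓ (fun k => y (π k)) = ℓ y

/-! Below, `P` is the joint law of `(X, Y)`; `P.fst` is the law of `X`, `P.snd` the law of `Y`. -/

/-- The law of `(Y₁, …, Y_r)`, i.i.d. with the law of `Y`. -/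
def lawYs (r : ℕ) (P : Measure (𝒳 × 𝒴)) : Measure (Fin r → 𝒴) :=
  Measure.pi fun _ => P.snd

/-- `ψ = E ℓ(Y₁, …, Y_r)`. -/
def psi (ℓ : (Fin r → 𝒴) → ℝ) (P : Measure (𝒳 × 𝒴)) : ℝ :=
  ∫ y, ℓ y ∂(lawYs r P)

/-- `σ_ℓ = √Var ℓ(Y₁, …, Y_r)`. -/
def sigmaL (ℓ : (Fin r → 𝒴) → ℝ) (P : Measure (𝒳 × 𝒴)) : ℝ :=
  √(Var[ℓ; lawYs r P])

/-- `ℓ₁(y) = E{ℓ(Y₁, Y₂, …, Y_r) | Y₁ = y} = E ℓ(y, Y₂, …, Y_r)`: the first argument is set to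
`y`, the others are integrated out. -/
def ell1 [NeZero r] (ℓ : (Fin r → 𝒴) → ℝ) (P : Measure (𝒳 × 𝒴)) (y : 𝒴) : ℝ :=
  ∫ v, ℓ (Function.update v 0 y) ∂(lawYs r P)

/-- The σ-algebra generated by `X` on the space of the pairs `(X, Y)`. -/
abbrev sigmaX (𝒳 : Type u) (𝒴 : Type v) [MeasurableSpace 𝒳] : MeasurableSpace (𝒳 × 𝒴) :=
  MeasurableSpace.comap Prod.fst inferInstance

/-- The random variable `ψ₁(X) = E{ℓ₁(Y) | X}`. -/
def psi1X [NeZero r] (ℓ : (Fin r → 𝒴) → ℝ) (P : Measure (𝒳 × 𝒴)) : 𝒳 × 𝒴 → ℝ :=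
  P[fun p => ell1 ℓ P p.2 | sigmaX 𝒳 𝒴]

/-- `σ₁² = E[Var{ℓ₁(Y) | X}]`. -/
def sigma1Sq [NeZero r] (ℓ : (Fin r → 𝒴) → ℝ) (P : Measure (𝒳 × 𝒴)) : ℝ :=
  ∫ p, (Var[fun p : 𝒳 × 𝒴 => ell1 ℓ P p.2; P | sigmaX 𝒳 𝒴]) p ∂P

/-- `σ₁`, the nonnegative square root of `σ₁²`. -/
def sigma1 [NeZero r] (ℓ : (Fin r → 𝒴) → ℝ) (P : Measure (𝒳 × 𝒴)) : ℝ :=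
  √(sigma1Sq ℓ P)

/-- `M_{p,ℓ₁} = E|ℓ₁(Y) - E ℓ₁(Y)|^p`, in `[0, ∞]`. -/
def momentEll1 [NeZero r] (p : ℕ) (ℓ : (Fin r → 𝒴) → ℝ) (P : Measure (𝒳 × 𝒴)) : ℝ≥0∞ :=
  ∫⁻ y, ‖ell1 ℓ P y - ∫ y', ell1 ℓ P y' ∂P.snd‖ₑ ^ p ∂P.snd

/-- `Λ_{n,m,f} = r² Var ℓ₁(Y) + (r² m / (n + m)) [Var f(X) - 2 Cov{f(X), ψ₁(X)}]`
for a fixed function `f`. -/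
def Lam [NeZero r] (n m : ℕ) (ℓ : (Fin r → 𝒴) → ℝ) (P : Measure (𝒳 × 𝒴)) (f : 𝒳 → ℝ) : ℝ :=
  (r : ℝ) ^ 2 * Var[fun p : 𝒳 × 𝒴 => ell1 ℓ P p.2; P]
    + (r : ℝ) ^ 2 * m / (n + m) *
      (Var[fun p : 𝒳 × 𝒴 => f p.1; P]
        - 2 * cov[fun p : 𝒳 × 𝒴 => f p.1, psi1X ℓ P; P])

/-- `M_{p,f̂} = E|f̂(X) - E{f̂(X) | f̂}|^p`, in `[0, ∞]`, for a random function `f̂` on a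
probability space `(Ω, μ)` and `X` independent of it: as `X` is independent of `f̂`, conditioning
on `f̂` is integrating over the law of `X` with the function held fixed. -/
def momentF {Ω : Type w} [MeasurableSpace Ω] (p : ℕ) (μ : Measure Ω)
    (fhat : Ω → 𝒳 → ℝ) (P : Measure (𝒳 × 𝒴)) : ℝ≥0∞ :=
  ∫⁻ ω, ∫⁻ x, ‖fhat ω x - ∫ x', fhat ω x' ∂P.fst‖ₑ ^ p ∂P.fst ∂μ

open Classical in
/-- The U-statistic: the average of `ℓ(y_{i₁}, …, y_{i_r})` over all `i₁ < … < i_r`. -/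
def uStat {n : ℕ} (ℓ : (Fin r → 𝒴) → ℝ) (y : Fin n → 𝒴) : ℝ :=
  ((n.choose r : ℕ) : ℝ)⁻¹ *
    ∑ i : Fin r → Fin n with StrictMono i, ℓ (fun k => y (i k))

/-- The semi-supervised U-statistic with assistant function `f`, on the labeled sample
`(x₁, y₁), …, (x_n, y_n)` and the unlabeled sample `x_{n+1}, …, x_{n+m}`:
`U - (r/n) ∑_{i ≤ n} f(x_i) + (r/(n+m)) ∑_{i ≤ n+m} f(x_i)`. -/
def uSemi {n m : ℕ} (ℓ : (Fin r → 𝒴) → ℝ) (f : 𝒳 → ℝ)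
    (xy : Fin n → 𝒳 × 𝒴) (x' : Fin m → 𝒳) : ℝ :=
  uStat ℓ (fun i => (xy i).2)
    - (r : ℝ) / n * ∑ i, f (xy i).1
    + (r : ℝ) / (n + m) * (∑ i, f (xy i).1 + ∑ j, f (x' j))

end

end SemiSup

/-!
Hoeffding's decomposition, applied after the assistant terms are collected, writes the standardized
estimator as `W + Δ`. Here `W` is a sum of independent centered summands, `ℓ₁(Y) - ψ - a (f - E f)`
for the labeled and a multiple of `f - E f` for the unlabeled observations, with `a = m / (n + m)`,
and `Δ` is the degenerate remainder of the U-statistic. Its variance is of smaller order by one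
factor `1 / n`, because two index sets contribute to it only if they share at least two indices.

For `W` the Berry–Esseen bound comes from Stein's method. To absorb `Δ`, the randomized
concentration inequality of Chen and Shao bounds the probability that `W` falls into an interval of
random length `|Δ|`; it requires, for every observation, a version of `Δ` that does not involve it.

Since `Λ / r² = Var(ℓ₁ - a f) + a (1 - a) Var f ≥ σ₁²`, the moments of `ℓ₁`, of `f` and of `ℓ` are
all controlled after division by `√Λ`. Finally one conditions on the auxiliary data and averages the
bound, moving the square root of the second moment outside by Jensen's inequality.
-/

namespace SemiSup

noncomputable section

open Set Filter Topology

local notation "φ" => gaussianPDFReal 0 1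
local notation "Φ" => cdf (gaussianReal 0 1)

/-! ### The normal density and distribution function -/

section Gaussian

lemma hasDerivAt_gaussianPDFReal (m : ℝ) (v : ℝ≥0) (x : ℝ) :
    HasDerivAt (gaussianPDFReal m v) (-(x - m) / v * gaussianPDFReal m v x) x := by
  have h := (((((hasDerivAt_id x).sub_const m).fun_pow 2).fun_neg.div_const
    (2 * (v : ℝ))).exp).const_mul (√(2 * Real.pi * v))⁻¹
  refine h.congr_deriv ?_
  simp only [gaussianPDFReal, id_eq, Nat.cast_ofNat, Nat.add_one_sub_one, pow_one, mul_one,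
    neg_div, mul_div_mul_left _ _ (two_ne_zero' ℝ)]
  ring

lemma continuous_gaussianPDFReal (m : ℝ) (v : ℝ≥0) : Continuous (gaussianPDFReal m v) :=
  continuous_iff_continuousAt.2 fun x => (hasDerivAt_gaussianPDFReal m v x).continuousAt

lemma gaussianPDFReal_neg (m : ℝ) (v : ℝ≥0) (x : ℝ) :
    gaussianPDFReal m v (-x) = gaussianPDFReal (-m) v x := by
  simp only [gaussianPDFReal]
  congr 3
  ring

variable (m : ℝ) {v : ℝ≥0}

lemma tendsto_gaussianPDFReal_atTop (hv : v ≠ 0) :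
    Tendsto (gaussianPDFReal m v) atTop (𝓝 0) := by
  have hv' : (0 : ℝ) < 2 * v := by positivity
  have hsq : Tendsto (fun x : ℝ => (x - m) ^ 2 / (2 * v)) atTop atTop :=
    ((tendsto_pow_atTop two_ne_zero).comp
      (tendsto_atTop_add_const_right atTop (-m) tendsto_id)).atTop_div_const hv'
  have h := (Real.tendsto_exp_atBot.comp (tendsto_neg_atTop_atBot.comp hsq)).const_mul
    (√(2 * Real.pi * v))⁻¹
  rw [mul_zero] at h
  exact h.congr fun x => by simp only [gaussianPDFReal, Function.comp_apply, neg_div]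

lemma integrable_sub_mul_gaussianPDFReal (hv : v ≠ 0) :
    Integrable fun x => (x - m) * gaussianPDFReal m v x := by
  have hb : (0 : ℝ) < 1 / (2 * v) := by positivity
  refine ((integrable_mul_exp_neg_mul_sq hb).const_mul
    (√(2 * Real.pi * v))⁻¹).comp_sub_right m |>.congr (ae_of_all _ fun x => ?_)
  have : -(1 / (2 * (v : ℝ))) * (x - m) ^ 2 = -(x - m) ^ 2 / (2 * v) := by ring
  simp only [gaussianPDFReal, this]
  ring

lemma integral_Ioi_sub_mul_gaussianPDFReal (hv : v ≠ 0) (x : ℝ) :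
    ∫ t in Ioi x, (t - m) * gaussianPDFReal m v t = v * gaussianPDFReal m v x := by
  have hderiv (t : ℝ) (_ : t ∈ Ici x) :
      HasDerivAt (fun t => -(v * gaussianPDFReal m v t)) ((t - m) * gaussianPDFReal m v t) t := by
    refine ((hasDerivAt_gaussianPDFReal m v t).const_mul (v : ℝ)).fun_neg.congr_deriv ?_
    field_simp
  have hlim : Tendsto (fun t => -(v * gaussianPDFReal m v t)) atTop (𝓝 0) := by
    simpa using ((tendsto_gaussianPDFReal_atTop m hv).const_mul (v : ℝ)).neg
  rw [integral_Ioi_of_hasDerivAt_of_tendsto' hderiv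
    (integrable_sub_mul_gaussianPDFReal m hv).integrableOn hlim, zero_sub, neg_neg]

lemma cdf_gaussianReal_eq_integral (hv : v ≠ 0) (x : ℝ) :
    cdf (gaussianReal m v) x = ∫ t in Iic x, gaussianPDFReal m v t := by
  rw [cdf_eq_real, measureReal_def, gaussianReal_apply_eq_integral _ hv,
    ENNReal.toReal_ofReal (integral_nonneg fun t => gaussianPDFReal_nonneg m v t)]

lemma one_sub_cdf_gaussianReal_eq_integral (hv : v ≠ 0) (x : ℝ) :
    1 - cdf (gaussianReal m v) x = ∫ t in Ioi x, gaussianPDFReal m v t := by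
  have hint := integrable_gaussianPDFReal m v
  rw [cdf_gaussianReal_eq_integral m hv, ← integral_gaussianPDFReal_eq_one m hv,
    ← intervalIntegral.integral_Iic_add_Ioi hint.integrableOn hint.integrableOn (b := x),
    add_sub_cancel_left]

lemma cdf_gaussianReal_neg (hv : v ≠ 0) (x : ℝ) :
    cdf (gaussianReal m v) (-x) = 1 - cdf (gaussianReal (-m) v) x := by
  rw [cdf_gaussianReal_eq_integral m hv, one_sub_cdf_gaussianReal_eq_integral (-m) hv]
  simpa only [gaussianPDFReal_neg, neg_neg] using
    integral_comp_neg_Iic (-x) (gaussianPDFReal (-m) v)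

lemma hasDerivAt_cdf_gaussianReal (hv : v ≠ 0) (x : ℝ) :
    HasDerivAt (cdf (gaussianReal m v)) (gaussianPDFReal m v x) x := by
  have hint := integrable_gaussianPDFReal m v
  have hcont := continuous_gaussianPDFReal m v
  have h : (cdf (gaussianReal m v) : ℝ → ℝ) = fun x =>
      (∫ t in Iic 0, gaussianPDFReal m v t) + ∫ t in (0 : ℝ)..x, gaussianPDFReal m v t := by
    ext x
    rw [cdf_gaussianReal_eq_integral m hv,
      ← intervalIntegral.integral_Iic_sub_Iic hint.integrableOn hint.integrableOn,
      add_sub_cancel]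
  rw [h]
  exact (intervalIntegral.integral_hasDerivAt_right hint.intervalIntegrable
    (hcont.stronglyMeasurableAtFilter _ _) hcont.continuousAt).const_add _

lemma sub_mul_one_sub_cdf_gaussianReal_le (hv : v ≠ 0) (x : ℝ) :
    (x - m) * (1 - cdf (gaussianReal m v) x) ≤ v * gaussianPDFReal m v x := by
  rw [one_sub_cdf_gaussianReal_eq_integral m hv, ← integral_Ioi_sub_mul_gaussianPDFReal m hv,
    ← integral_const_mul]
  refine setIntegral_mono_on ((integrable_gaussianPDFReal m v).const_mul _).integrableOn
    (integrable_sub_mul_gaussianPDFReal m hv).integrableOn measurableSet_Ioi fun t ht => ?_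
  exact mul_le_mul_of_nonneg_right (sub_le_sub_right (le_of_lt ht) m) (gaussianPDFReal_nonneg m v t)

lemma sub_mul_cdf_gaussianReal_le (hv : v ≠ 0) (x : ℝ) :
    (m - x) * cdf (gaussianReal m v) x ≤ v * gaussianPDFReal m v x := by
  have h := sub_mul_one_sub_cdf_gaussianReal_le (-m) hv (-x)
  rwa [← cdf_gaussianReal_neg m hv, ← gaussianPDFReal_neg, neg_neg, neg_sub_neg] at h

end Gaussian

/-! ### Stein's equation -/

/-- The bounded solution `f` of Stein's equation `f' w - w * f w = 1_{w ≤ z} - Φ z`. -/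
def steinSol (z w : ℝ) : ℝ :=
  (Φ (min w z) - Φ w * Φ z) / φ w

/-- The derivative of `steinSol z`, with the value at the kink `z` fixed by Stein's equation. -/
def steinDer (z w : ℝ) : ℝ :=
  w * steinSol z w + (Iic z).indicator 1 w - Φ z

/-- The oscillation bound for `steinDer z` on the closed ball of radius `s` around `w`: a Lipschitz
term, and a unit jump if the ball reaches the kink. -/
def steinOsc (z w s : ℝ) : ℝ :=
  (2 * |w| + 6) * s + (Icc (z - s) (z + s)).indicator 1 w

lemma continuous_steinSol (z : ℝ) : Continuous (steinSol z) := by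
  have h : Continuous Φ := continuous_iff_continuousAt.2 fun w =>
    (hasDerivAt_cdf_gaussianReal 0 one_ne_zero w).continuousAt
  exact ((h.comp (continuous_id.min continuous_const)).sub (h.mul continuous_const)).div
    (continuous_gaussianPDFReal 0 1) fun w => (gaussianPDFReal_pos 0 1 w one_ne_zero).ne'

lemma measurable_steinDer (z : ℝ) : Measurable (steinDer z) :=
  ((measurable_id.mul (continuous_steinSol z).measurable).add
    (measurable_one.indicator measurableSet_Iic)).sub_const _

lemma measurable_steinOsc (z : ℝ) : Measurable fun p : ℝ × ℝ => steinOsc z p.1 p.2 := by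
  have hset : MeasurableSet {p : ℝ × ℝ | p.1 ∈ Icc (z - p.2) (z + p.2)} :=
    (measurableSet_le (measurable_const.sub measurable_snd) measurable_fst).inter
      (measurableSet_le measurable_fst (measurable_const.add measurable_snd))
  exact Measurable.add (by fun_prop) (measurable_one.indicator hset)

lemma steinOsc_nonneg (z w : ℝ) {s : ℝ} (hs : 0 ≤ s) : 0 ≤ steinOsc z w s :=
  add_nonneg (by positivity) (indicator_nonneg (fun _ _ => zero_le_one) _)

lemma hasDerivAt_steinSol {z w : ℝ} (h : w ≠ z) :
    HasDerivAt (steinSol z) (steinDer z w) w := by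
  have hφ := (gaussianPDFReal_pos 0 1 w one_ne_zero).ne'
  have hdΦ := hasDerivAt_cdf_gaussianReal 0 one_ne_zero w
  have hdφ := hasDerivAt_gaussianPDFReal 0 1 w
  rcases lt_or_gt_of_ne h with h | h
  · refine (((hdΦ.fun_sub (hdΦ.mul_const (Φ z))).fun_div hdφ hφ).congr_of_eventuallyEq
      ?_).congr_deriv ?_
    · filter_upwards [Iio_mem_nhds h] with x hx
      rw [steinSol, min_eq_left (le_of_lt hx)]
    · rw [steinDer, steinSol, min_eq_left h.le, indicator_of_mem (mem_Iic.2 h.le), Pi.one_apply,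
        NNReal.coe_one]
      field_simp
      ring
  · refine ((((hdΦ.mul_const (Φ z)).const_sub (Φ z)).fun_div hdφ hφ).congr_of_eventuallyEq
      ?_).congr_deriv ?_
    · filter_upwards [Ioi_mem_nhds h] with x hx
      rw [steinSol, min_eq_right (le_of_lt hx)]
    · rw [steinDer, steinSol, min_eq_right h.le, indicator_of_notMem (notMem_Iic.2 h),
        NNReal.coe_one]
      field_simp
      ring

lemma cdf_min_sub_mul_mem_Icc (z w : ℝ) :
    Φ (min w z) - Φ w * Φ z ∈ Icc 0 (min (Φ w) (1 - Φ w)) := by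
  have hw := cdf_nonneg (gaussianReal 0 1) w
  have hz := cdf_nonneg (gaussianReal 0 1) z
  have hw' := cdf_le_one (gaussianReal 0 1) w
  have hz' := cdf_le_one (gaussianReal 0 1) z
  rcases le_total w z with h | h
  · have hwz := monotone_cdf (gaussianReal 0 1) h
    rw [min_eq_left h]
    exact ⟨by nlinarith, le_min (by nlinarith) (by nlinarith)⟩
  · have hzw := monotone_cdf (gaussianReal 0 1) h
    rw [min_eq_right h]
    exact ⟨by nlinarith, le_min (by nlinarith) (by nlinarith)⟩

lemma steinSol_nonneg (z w : ℝ) : 0 ≤ steinSol z w :=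
  div_nonneg (cdf_min_sub_mul_mem_Icc z w).1 (gaussianPDFReal_nonneg 0 1 w)

lemma abs_mul_steinSol_le_one (z w : ℝ) : |w * steinSol z w| ≤ 1 := by
  obtain ⟨h0, h1⟩ := cdf_min_sub_mul_mem_Icc z w
  obtain ⟨hle, hle'⟩ := le_min_iff.1 h1
  have hφ := gaussianPDFReal_pos 0 1 w one_ne_zero
  have hright := sub_mul_one_sub_cdf_gaussianReal_le 0 one_ne_zero w
  have hleft := sub_mul_cdf_gaussianReal_le 0 one_ne_zero w
  rw [NNReal.coe_one, one_mul] at hright hleft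
  rw [steinSol, ← mul_div_assoc, abs_div, abs_of_pos hφ, div_le_one hφ, abs_le]
  rcases le_total 0 w with h | h <;> constructor <;> nlinarith

lemma one_sixth_le_gaussianPDFReal {w : ℝ} (h : |w| ≤ 1) : 1 / 6 ≤ φ w := by
  have hw : w ^ 2 ≤ 1 := (sq_le_one_iff_abs_le_one w).2 h
  have hsqrt : √(2 * Real.pi) ≤ 3 := by
    rw [Real.sqrt_le_left (by norm_num)]
    linarith [Real.pi_le_four]
  have hexp : (1 : ℝ) / 2 ≤ Real.exp (-(w ^ 2) / 2) := by
    linarith [Real.add_one_le_exp (-(w ^ 2) / 2)]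
  rw [gaussianPDFReal, NNReal.coe_one, mul_one, mul_one, sub_zero, inv_mul_eq_div,
    div_le_div_iff₀ (by norm_num) (by positivity)]
  linarith

lemma steinSol_le (z w : ℝ) : steinSol z w ≤ 6 := by
  rcases le_total |w| 1 with h | h
  · rw [steinSol, div_le_iff₀ (gaussianPDFReal_pos 0 1 w one_ne_zero)]
    linarith [(le_min_iff.1 (cdf_min_sub_mul_mem_Icc z w).2).1, cdf_le_one (gaussianReal 0 1) w,
      one_sixth_le_gaussianPDFReal h]
  · have hmul := abs_mul_steinSol_le_one z w
    rw [abs_mul, abs_of_nonneg (steinSol_nonneg z w)] at hmul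
    nlinarith [steinSol_nonneg z w]

lemma abs_steinSol_le (z w : ℝ) : |steinSol z w| ≤ 6 :=
  (abs_of_nonneg (steinSol_nonneg z w)).trans_le (steinSol_le z w)

lemma abs_steinDer_le (z w : ℝ) : |steinDer z w| ≤ 2 := by
  have hmul := abs_le.1 (abs_mul_steinSol_le_one z w)
  have hind : (Iic z).indicator (1 : ℝ → ℝ) w ∈ Icc 0 1 :=
    ⟨indicator_nonneg (fun _ _ => zero_le_one) w, indicator_le_self' (fun _ _ => zero_le_one) w⟩
  rw [steinDer, abs_le]
  constructor <;>
    linarith [hind.1, hind.2, cdf_nonneg (gaussianReal 0 1) z, cdf_le_one (gaussianReal 0 1) z]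

lemma intervalIntegrable_steinDer (z a b : ℝ) : IntervalIntegrable (steinDer z) volume a b :=
  (intervalIntegrable_const (c := (2 : ℝ))).mono_fun
    (measurable_steinDer z).aestronglyMeasurable
    (ae_of_all _ fun w => by simpa using abs_steinDer_le z w)

lemma integral_steinDer (z a b : ℝ) : ∫ t in a..b, steinDer z t = steinSol z b - steinSol z a :=
  integral_eq_of_hasDerivAt_off_countable (steinSol z) (steinDer z) (countable_singleton z)
    (continuous_steinSol z).continuousOn (fun _ ht => hasDerivAt_steinSol ht.2)
    (intervalIntegrable_steinDer z a b)

lemma abs_steinSol_sub_le (z x y : ℝ) : |steinSol z y - steinSol z x| ≤ 2 * |y - x| := by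
  rw [← integral_steinDer]
  refine intervalIntegral.norm_integral_le_of_norm_le_const (f := steinDer z) fun t _ => ?_
  exact abs_steinDer_le z t

lemma abs_mul_steinSol_sub_le (z w y : ℝ) :
    |y * steinSol z y - w * steinSol z w| ≤ (2 * |w| + 6) * |y - w| := calc
  |y * steinSol z y - w * steinSol z w|
      = |w * (steinSol z y - steinSol z w) + (y - w) * steinSol z y| := by ring_nf
  _ ≤ |w| * |steinSol z y - steinSol z w| + |y - w| * |steinSol z y| := by
    simpa only [abs_mul] using
      abs_add_le (w * (steinSol z y - steinSol z w)) ((y - w) * steinSol z y)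
  _ ≤ |w| * (2 * |y - w|) + |y - w| * 6 := by
    gcongr
    exacts [abs_steinSol_sub_le z w y, abs_steinSol_le z y]
  _ = (2 * |w| + 6) * |y - w| := by ring

lemma abs_indicator_Iic_sub_le {z w y s : ℝ} (h : |y - w| ≤ s) :
    |(Iic z).indicator (1 : ℝ → ℝ) y - (Iic z).indicator 1 w|
      ≤ (Icc (z - s) (z + s)).indicator 1 w := by
  obtain ⟨hl, hr⟩ := abs_le.1 h
  simp only [indicator_apply, mem_Iic, mem_Icc, Pi.one_apply]
  split_ifs <;> norm_num <;> grind

lemma abs_steinDer_sub_le {z w y s : ℝ} (h : |y - w| ≤ s) :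
    |steinDer z y - steinDer z w| ≤ steinOsc z w s := by
  have hsplit : steinDer z y - steinDer z w = (y * steinSol z y - w * steinSol z w)
      + ((Iic z).indicator 1 y - (Iic z).indicator 1 w) := by
    simp only [steinDer]
    ring
  rw [hsplit]
  refine (abs_add_le _ _).trans (add_le_add ((abs_mul_steinSol_sub_le z w y).trans ?_)
    (abs_indicator_Iic_sub_le h))
  gcongr

lemma abs_steinSol_sub_sub_le (z w y : ℝ) :
    |steinSol z y - steinSol z w - (y - w) * steinDer z w| ≤ steinOsc z w |y - w| * |y - w| := by
  have hint : ∫ t in w..y, (steinDer z t - steinDer z w)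
      = steinSol z y - steinSol z w - (y - w) * steinDer z w := by
    rw [intervalIntegral.integral_sub (intervalIntegrable_steinDer z w y)
      intervalIntegrable_const, integral_steinDer, intervalIntegral.integral_const, smul_eq_mul]
  rw [← hint]
  refine intervalIntegral.norm_integral_le_of_norm_le_const
    (f := fun t => steinDer z t - steinDer z w) fun t ht => ?_
  exact abs_steinDer_sub_le (abs_sub_left_of_mem_uIcc (uIoc_subset_uIcc ht))

/-! ### Standardized sums of independent random variables -/

section Moments

variable {Ω : Type*} [MeasurableSpace Ω] {μ : Measure Ω} {X Y : Ω → ℝ}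

lemma integral_abs_mul_abs_le_sqrt (hX : MemLp X 2 μ) (hY : MemLp Y 2 μ) :
    ∫ ω, |X ω| * |Y ω| ∂μ ≤ √(∫ ω, X ω ^ 2 ∂μ) * √(∫ ω, Y ω ^ 2 ∂μ) := by
  have h := integral_mul_norm_le_Lp_mul_Lq (p := 2) (q := 2) (μ := μ) (f := X) (g := Y)
    Real.HolderConjugate.two_two (by simpa using hX) (by simpa using hY)
  simpa [Real.sqrt_eq_rpow] using h

lemma integrable_abs_pow {p : ℕ} (hX : MemLp X p μ) (hp : p ≠ 0) :
    Integrable (fun ω => |X ω| ^ p) μ := by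
  simpa only [Real.norm_eq_abs] using hX.integrable_norm_pow hp

variable [IsProbabilityMeasure μ]

lemma integral_abs_le_sqrt (hX : MemLp X 2 μ) : ∫ ω, |X ω| ∂μ ≤ √(∫ ω, X ω ^ 2 ∂μ) := by
  simpa using integral_abs_mul_abs_le_sqrt hX (memLp_const (1 : ℝ))

lemma sq_integral_abs_le (hX : MemLp X 2 μ) : (∫ ω, |X ω| ∂μ) ^ 2 ≤ ∫ ω, X ω ^ 2 ∂μ :=
  (Real.le_sqrt (integral_nonneg fun _ => abs_nonneg _)
    (integral_nonneg fun _ => sq_nonneg _)).1 (integral_abs_le_sqrt hX)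

lemma integral_sq_mul_integral_abs_le (hX : MemLp X 3 μ) :
    (∫ ω, X ω ^ 2 ∂μ) * ∫ ω, |X ω| ∂μ ≤ ∫ ω, |X ω| ^ 3 ∂μ := by
  have hX2 : MemLp X 2 μ := hX.mono_exponent (by norm_num)
  have hint1 : Integrable (fun ω => |X ω|) μ := (hX.integrable (by norm_num)).abs
  set a := ∫ ω, |X ω| ∂μ with ha
  set v := ∫ ω, X ω ^ 2 ∂μ with hv
  have hpoint (ω : Ω) : a * X ω ^ 2 + a ^ 2 * (|X ω| - a) ≤ |X ω| ^ 3 := by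
    have : 0 ≤ (|X ω| - a) ^ 2 * (|X ω| + a) :=
      mul_nonneg (sq_nonneg _) (add_nonneg (abs_nonneg _) (integral_nonneg fun _ => abs_nonneg _))
    rw [← sq_abs (X ω)]
    linarith
  have hint2 : Integrable (fun ω => a * X ω ^ 2) μ := hX2.integrable_sq.const_mul a
  have hint3 : Integrable (fun ω => a ^ 2 * (|X ω| - a)) μ :=
    (hint1.sub (integrable_const a)).const_mul _
  have hle : ∫ ω, (a * X ω ^ 2 + a ^ 2 * (|X ω| - a)) ∂μ ≤ ∫ ω, |X ω| ^ 3 ∂μ :=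
    integral_mono (hint2.add hint3) (integrable_abs_pow (p := 3) hX (by norm_num)) hpoint
  rwa [integral_add hint2 hint3, integral_const_mul, integral_const_mul,
    integral_sub hint1 (integrable_const a), integral_const, probReal_univ, one_smul, ← ha, ← hv,
    sub_self, mul_zero, add_zero, mul_comm] at hle

end Moments

section StdFamily

variable {Ω : Type*} [MeasurableSpace Ω] {ι : Type*} [Fintype ι]

/-- The summands of a standardized sum: independent, centered, with finite third moments and
variances summing to one. -/
structure IsStdFamily (μ : Measure Ω) (ξ : ι → Ω → ℝ) : Prop where
  meas : ∀ i, Measurable (ξ i)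
  indep : iIndepFun ξ μ
  memLp : ∀ i, MemLp (ξ i) 3 μ
  mean : ∀ i, ∫ ω, ξ i ω ∂μ = 0
  var : ∑ i, ∫ ω, ξ i ω ^ 2 ∂μ = 1

/-- The Lyapunov ratio `∑ E|ξᵢ|³` of a standardized family. -/
def lyapunov (μ : Measure Ω) (ξ : ι → Ω → ℝ) : ℝ := ∑ i, ∫ ω, |ξ i ω| ^ 3 ∂μ

/-- The leave-one-out sum: the total sum without the summand `ξ i`. It is written as a difference,
so that no decidable equality on the index type is needed. -/
def sumExcept (ξ : ι → Ω → ℝ) (i : ι) (ω : Ω) : ℝ := ∑ j, ξ j ω - ξ i ω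

namespace IsStdFamily

variable {μ : Measure Ω} {ξ : ι → Ω → ℝ}

lemma measurable_sum (h : IsStdFamily μ ξ) : Measurable fun ω => ∑ i, ξ i ω :=
  Finset.measurable_sum _ fun i _ => h.meas i

lemma measurable_sumExcept (h : IsStdFamily μ ξ) (i : ι) : Measurable (sumExcept ξ i) :=
  h.measurable_sum.sub (h.meas i)

lemma neg (h : IsStdFamily μ ξ) : IsStdFamily μ fun i ω => -ξ i ω where
  meas i := (h.meas i).neg
  indep := h.indep.comp (fun _ x => -x) fun _ => measurable_neg
  memLp i := (h.memLp i).neg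
  mean i := by rw [integral_neg, h.mean i, neg_zero]
  var := by simpa using h.var

lemma variance_eq (h : IsStdFamily μ ξ) (i : ι) : Var[ξ i; μ] = ∫ ω, ξ i ω ^ 2 ∂μ :=
  variance_of_integral_eq_zero (h.meas i).aemeasurable (h.mean i)

lemma integral_sq_le_one (h : IsStdFamily μ ξ) (i : ι) : ∫ ω, ξ i ω ^ 2 ∂μ ≤ 1 := by
  rw [← h.var]
  exact Finset.single_le_sum (f := fun i => ∫ ω, ξ i ω ^ 2 ∂μ)
    (fun j _ => integral_nonneg fun _ => sq_nonneg _) (Finset.mem_univ i)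

lemma indepFun_sumExcept (h : IsStdFamily μ ξ) (i : ι) : IndepFun (ξ i) (sumExcept ξ i) μ := by
  classical
  have hindep := (h.indep.indepFun_finsetSum_of_notMem h.meas (Finset.notMem_erase i .univ)).symm
  have heq : sumExcept ξ i = ∑ j ∈ Finset.univ.erase i, ξ j := by
    ext ω
    rw [sumExcept, Finset.sum_apply, Finset.sum_erase_eq_sub (Finset.mem_univ i)]
  rwa [heq]

lemma lyapunov_pos (h : IsStdFamily μ ξ) : 0 < lyapunov μ ξ := by
  have hnonneg (i : ι) : 0 ≤ ∫ ω, |ξ i ω| ^ 3 ∂μ := integral_nonneg fun ω => by positivity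
  refine (Finset.sum_nonneg fun i _ => hnonneg i).lt_of_ne fun hzero => ?_
  have hsq (i : ι) : ∫ ω, ξ i ω ^ 2 ∂μ = 0 := by
    have hi := (Finset.sum_eq_zero_iff_of_nonneg fun i _ => hnonneg i).1 hzero.symm i
      (Finset.mem_univ i)
    rw [integral_eq_zero_iff_of_nonneg (fun ω => by positivity)
      (integrable_abs_pow (p := 3) (h.memLp i) (by norm_num))] at hi
    refine integral_eq_zero_of_ae (hi.mono fun ω hω => ?_)
    simpa using hω
  simpa [hsq] using h.var

variable [IsProbabilityMeasure μ]

lemma memLp_two (h : IsStdFamily μ ξ) (i : ι) : MemLp (ξ i) 2 μ :=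
  (h.memLp i).mono_exponent (by norm_num)

lemma integrable (h : IsStdFamily μ ξ) (i : ι) : Integrable (ξ i) μ :=
  (h.memLp i).integrable (by norm_num)

lemma memLp_sum (h : IsStdFamily μ ξ) : MemLp (fun ω => ∑ i, ξ i ω) 2 μ :=
  memLp_finsetSum _ fun i _ => h.memLp_two i

lemma integral_sum (h : IsStdFamily μ ξ) : ∫ ω, ∑ i, ξ i ω ∂μ = 0 := by
  rw [integral_finsetSum _ fun i _ => h.integrable i]
  exact Finset.sum_eq_zero fun i _ => h.mean i

lemma integral_sum_sq (h : IsStdFamily μ ξ) : ∫ ω, (∑ i, ξ i ω) ^ 2 ∂μ = 1 := by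
  have hvar := IndepFun.variance_sum (s := .univ) (X := ξ) (μ := μ) (fun i _ => h.memLp_two i)
    fun i _ j _ hij => h.indep.indepFun hij
  rw [← variance_of_integral_eq_zero h.measurable_sum.aemeasurable h.integral_sum, ← h.var,
    ← Finset.sum_fn, hvar]
  exact Finset.sum_congr rfl fun i _ => h.variance_eq i

lemma integral_abs_sum_le_one (h : IsStdFamily μ ξ) : ∫ ω, |∑ i, ξ i ω| ∂μ ≤ 1 := by
  simpa only [h.integral_sum_sq, Real.sqrt_one] using integral_abs_le_sqrt h.memLp_sum

end IsStdFamily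

end StdFamily

/-! ### The randomized concentration inequality -/

section ConcFun

/-- The test function `w ↦ w - c + δ` clamped to `[0, θ + 2 * δ]`; it has slope one on the
`δ`-neighbourhood of the interval `[c, c + θ]` whose probability is to be bounded. -/
def concFun (c δ w θ : ℝ) : ℝ := min (max (w - c + δ) 0) (θ + 2 * δ)

/-- The square of `x`, damped to linear growth beyond `δ`. -/
def truncSq (δ x : ℝ) : ℝ := |x| * min δ |x|

lemma measurable_concFun (c δ : ℝ) : Measurable fun p : ℝ × ℝ => concFun c δ p.1 p.2 := by
  unfold concFun
  fun_prop

lemma measurable_truncSq (δ : ℝ) : Measurable (truncSq δ) := by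
  unfold truncSq
  fun_prop

variable {c δ w w' θ : ℝ}

lemma abs_concFun_le (hδ : 0 ≤ δ) (c w θ : ℝ) : |concFun c δ w θ| ≤ |θ| + 2 * δ := by
  have hneg := neg_abs_le θ
  have habs := abs_nonneg θ
  refine abs_le.2 ⟨le_min ?_ (by linarith), (min_le_right _ _).trans (by linarith [le_abs_self θ])⟩
  exact le_trans (by linarith) (le_max_right _ _)

lemma abs_concFun_sub_le (c δ w θ θ' : ℝ) :
    |concFun c δ w θ - concFun c δ w θ'| ≤ |θ - θ'| := by
  simpa [concFun] using abs_min_sub_min_le_max (max (w - c + δ) 0) (θ + 2 * δ) (max (w - c + δ) 0)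
    (θ' + 2 * δ)

lemma concFun_mono (h : w ≤ w') : concFun c δ w θ ≤ concFun c δ w' θ := by
  unfold concFun
  gcongr

lemma mul_concFun_sub_nonneg (c δ w θ x : ℝ) :
    0 ≤ x * (concFun c δ w θ - concFun c δ (w - x) θ) := by
  rcases le_total 0 x with h | h
  · exact mul_nonneg h (sub_nonneg.2 (concFun_mono (by linarith)))
  · exact mul_nonneg_of_nonpos_of_nonpos h (sub_nonpos.2 (concFun_mono (by linarith)))

lemma truncSq_le_mul_concFun_sub (hδ : 0 ≤ δ) (hw : w ∈ Icc c (c + θ)) (x : ℝ) :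
    truncSq δ x ≤ x * (concFun c δ w θ - concFun c δ (w - x) θ) := by
  obtain ⟨hcw, hwθ⟩ := hw
  have hval : concFun c δ w θ = w - c + δ := by
    rw [concFun, max_eq_left (by linarith), min_eq_left (by linarith)]
  rw [truncSq, hval]
  rcases le_total 0 x with h | h
  · rw [abs_of_nonneg h]
    refine mul_le_mul_of_nonneg_left ?_ h
    have hle : concFun c δ (w - x) θ ≤ max (w - x - c + δ) 0 := min_le_left _ _
    grind
  · rw [abs_of_nonpos h, neg_mul, ← mul_neg, mul_comm x, mul_comm x]
    refine mul_le_mul_of_nonpos_right ?_ h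
    rw [concFun]
    grind

lemma sq_sub_le_truncSq (hδ : 0 < δ) (x : ℝ) : x ^ 2 - |x| ^ 3 / (4 * δ) ≤ truncSq δ x := by
  rw [← sq_abs x, truncSq]
  rcases le_total δ |x| with h | h
  · have hsq : |x| * δ - (|x| ^ 2 - |x| ^ 3 / (4 * δ)) = |x| * (|x| - 2 * δ) ^ 2 / (4 * δ) := by
      field_simp
      ring
    rw [min_eq_left h, ← sub_nonneg, hsq]
    positivity
  · rw [min_eq_right h, ← sq, sub_le_self_iff]
    positivity

lemma abs_truncSq_le (hδ : 0 ≤ δ) (x : ℝ) : |truncSq δ x| ≤ δ * |x| := by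
  rw [truncSq, abs_of_nonneg (mul_nonneg (abs_nonneg _) (le_min hδ (abs_nonneg _))), mul_comm δ]
  exact mul_le_mul_of_nonneg_left (min_le_left _ _) (abs_nonneg _)

lemma indicator_sum_truncSq_le {ι : Type*} [Fintype ι] (hδ : 0 ≤ δ) (hθ : 0 ≤ θ) (c : ℝ)
    (x θ' : ι → ℝ) :
    (Icc c (c + θ)).indicator (fun _ => ∑ i, truncSq δ (x i)) (∑ i, x i)
      ≤ |∑ i, x i| * θ + 2 * δ * |∑ i, x i|
        - ∑ i, x i * concFun c δ (∑ j, x j - x i) (θ' i) + ∑ i, |x i| * |θ - θ' i| := by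
  set w := ∑ i, x i with hw
  have htotal : ∑ i, x i * concFun c δ w θ ≤ |w| * θ + 2 * δ * |w| := by
    have hbound := abs_concFun_le hδ c w θ
    rw [abs_of_nonneg hθ] at hbound
    rw [← Finset.sum_mul, ← hw]
    calc w * concFun c δ w θ ≤ |w| * |concFun c δ w θ| := (le_abs_self _).trans_eq (abs_mul _ _)
      _ ≤ |w| * (θ + 2 * δ) := by gcongr
      _ = |w| * θ + 2 * δ * |w| := by ring
  have hreplace (i : ι) : x i * concFun c δ (w - x i) (θ' i)
      ≤ x i * concFun c δ (w - x i) θ + |x i| * |θ - θ' i| := by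
    rw [← sub_le_iff_le_add', ← mul_sub]
    refine (le_abs_self _).trans ?_
    rw [abs_mul, abs_sub_comm θ]
    exact mul_le_mul_of_nonneg_left (abs_concFun_sub_le _ _ _ _ _) (abs_nonneg _)
  have hslope : (Icc c (c + θ)).indicator (fun _ => ∑ i, truncSq δ (x i)) w
      ≤ ∑ i, x i * (concFun c δ w θ - concFun c δ (w - x i) θ) := by
    by_cases h : w ∈ Icc c (c + θ)
    · rw [indicator_of_mem h]
      exact Finset.sum_le_sum fun i _ => truncSq_le_mul_concFun_sub hδ h (x i)
    · rw [indicator_of_notMem h]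
      exact Finset.sum_nonneg fun i _ => mul_concFun_sub_nonneg c δ w θ (x i)
  simp only [mul_sub, Finset.sum_sub_distrib] at hslope
  have hsum := Finset.sum_le_sum fun i (_ : i ∈ Finset.univ) => hreplace i
  rw [Finset.sum_add_distrib] at hsum
  linarith

end ConcFun

section Concentration

variable {Ω : Type*} [MeasurableSpace Ω] {ι : Type*} [Fintype ι] {μ : Measure Ω}
  {ξ : ι → Ω → ℝ}

lemma memLp_concFun [IsFiniteMeasure μ] {V T : Ω → ℝ} {p : ℝ≥0∞} {δ : ℝ} (hδ : 0 ≤ δ) (c : ℝ)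
    (hV : AEMeasurable V μ) (hT : MemLp T p μ) : MemLp (fun ω => concFun c δ (V ω) (T ω)) p μ :=
  (hT.norm.add (memLp_const (2 * δ))).mono'
    ((measurable_concFun c δ).comp_aemeasurable (hV.prodMk hT.aemeasurable)).aestronglyMeasurable
    (ae_of_all _ fun _ => abs_concFun_le hδ _ _ _)

lemma integral_mul_concFun_eq_zero {X V T : Ω → ℝ} (hX : AEMeasurable X μ)
    (hX0 : ∫ ω, X ω ∂μ = 0) (hV : AEMeasurable V μ) (hT : AEMeasurable T μ)
    (hindep : IndepFun X (fun ω => (V ω, T ω)) μ) (c δ : ℝ) :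
    ∫ ω, X ω * concFun c δ (V ω) (T ω) ∂μ = 0 := by
  have hmul := (hindep.comp measurable_id
    (measurable_concFun c δ)).integral_fun_mul_eq_mul_integral hX.aestronglyMeasurable
    ((measurable_concFun c δ).comp_aemeasurable (hV.prodMk hT)).aestronglyMeasurable
  simpa only [Function.comp_apply, id_eq, hX0, zero_mul] using hmul

lemma mul_measureReal_le_integral_indicator_add [IsFiniteMeasure μ] {S : Ω → ℝ}
    (hS : Integrable S μ) {A : Set Ω} (hA : MeasurableSet A) (e : ℝ) :
    e * μ.real A ≤ ∫ ω, A.indicator S ω ∂μ + ∫ ω, |S ω - e| ∂μ := by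
  have hdev : Integrable (fun ω => |S ω - e|) μ := (hS.sub (integrable_const e)).abs
  calc e * μ.real A = ∫ ω, A.indicator (fun _ => e) ω ∂μ := by
        rw [integral_indicator_const _ hA, smul_eq_mul, mul_comm]
    _ ≤ ∫ ω, (A.indicator S ω + |S ω - e|) ∂μ := by
        refine integral_mono ((integrable_const e).indicator hA) ((hS.indicator hA).add hdev)
          fun ω => ?_
        by_cases hω : ω ∈ A
        · simpa only [indicator_of_mem hω, abs_sub_comm] using
            sub_le_iff_le_add'.1 (le_abs_self (e - S ω))
        · simp [indicator_of_notMem hω]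
    _ = _ := integral_add (hS.indicator hA) hdev

namespace IsStdFamily

variable [IsProbabilityMeasure μ]

lemma memLp_truncSq (h : IsStdFamily μ ξ) {δ : ℝ} (hδ : 0 ≤ δ) (i : ι) :
    MemLp (fun ω => truncSq δ (ξ i ω)) 2 μ :=
  ((h.memLp_two i).norm.const_mul δ).mono'
    ((measurable_truncSq δ).comp (h.meas i)).aestronglyMeasurable
    (ae_of_all _ fun ω => abs_truncSq_le hδ (ξ i ω))

lemma one_sub_lyapunov_div_le_integral_sum_truncSq (h : IsStdFamily μ ξ) {δ : ℝ} (hδ : 0 < δ) :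
    1 - lyapunov μ ξ / (4 * δ) ≤ ∫ ω, ∑ i, truncSq δ (ξ i ω) ∂μ := by
  have hint (i : ι) := (h.memLp_truncSq hδ.le i).integrable one_le_two
  rw [integral_finsetSum _ fun i _ => hint i, lyapunov, ← h.var, Finset.sum_div,
    ← Finset.sum_sub_distrib]
  refine Finset.sum_le_sum fun i _ => ?_
  have hcube := (integrable_abs_pow (p := 3) (h.memLp i) (by norm_num)).div_const (4 * δ)
  rw [← integral_div, ← integral_sub (h.memLp_two i).integrable_sq hcube]
  exact integral_mono ((h.memLp_two i).integrable_sq.sub hcube) (hint i) fun ω =>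
    sq_sub_le_truncSq hδ _

lemma variance_sum_truncSq_le (h : IsStdFamily μ ξ) {δ : ℝ} (hδ : 0 ≤ δ) :
    Var[fun ω => ∑ i, truncSq δ (ξ i ω); μ] ≤ δ ^ 2 := by
  have hle (i : ι) : Var[fun ω => truncSq δ (ξ i ω); μ] ≤ δ ^ 2 * ∫ ω, ξ i ω ^ 2 ∂μ := by
    refine (variance_le_expectation_sq (h.memLp_truncSq hδ i).aestronglyMeasurable).trans ?_
    rw [← integral_const_mul]
    refine integral_mono (h.memLp_truncSq hδ i).integrable_sq
      ((h.memLp_two i).integrable_sq.const_mul _) fun ω => ?_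
    simpa only [sq_abs, mul_pow, Pi.pow_apply] using
      pow_le_pow_left₀ (abs_nonneg _) (abs_truncSq_le hδ (ξ i ω)) 2
  have hsum := IndepFun.variance_sum (s := .univ) (fun i _ => h.memLp_truncSq hδ i)
    fun i _ j _ hij => (h.indep.indepFun hij).comp (measurable_truncSq δ) (measurable_truncSq δ)
  rw [Finset.sum_fn] at hsum
  calc Var[fun ω => ∑ i, truncSq δ (ξ i ω); μ]
      = ∑ i, Var[fun ω => truncSq δ (ξ i ω); μ] := hsum
    _ ≤ ∑ i, δ ^ 2 * ∫ ω, ξ i ω ^ 2 ∂μ := Finset.sum_le_sum fun i _ => hle i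
    _ = δ ^ 2 := by rw [← Finset.mul_sum, h.var, mul_one]

lemma integral_abs_sum_truncSq_sub_le (h : IsStdFamily μ ξ) {δ : ℝ} (hδ : 0 ≤ δ) :
    ∫ ω, |∑ i, truncSq δ (ξ i ω) - ∫ ω', ∑ i, truncSq δ (ξ i ω') ∂μ| ∂μ ≤ δ := by
  have hmem : MemLp (fun ω => ∑ i, truncSq δ (ξ i ω)) 2 μ :=
    memLp_finsetSum _ fun i _ => h.memLp_truncSq hδ i
  refine (integral_abs_le_sqrt (hmem.sub (memLp_const _))).trans ((Real.sqrt_le_left hδ).2 ?_)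
  exact (variance_eq_integral hmem.aemeasurable).symm.trans_le (h.variance_sum_truncSq_le hδ)

variable {Θ : Ω → ℝ} {Θ' : ι → Ω → ℝ}

lemma integral_indicator_sum_truncSq_le (h : IsStdFamily μ ξ) {δ : ℝ} (hδ : 0 ≤ δ) (c : ℝ)
    (hΘ0 : ∀ ω, 0 ≤ Θ ω) (hΘ : MemLp Θ 2 μ) (hΘm : Measurable Θ) (hΘ' : ∀ i, MemLp (Θ' i) 2 μ)
    (hindep : ∀ i, IndepFun (ξ i) (fun ω => (sumExcept ξ i ω, Θ' i ω)) μ) :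
    ∫ ω, {ω | ∑ i, ξ i ω ∈ Icc c (c + Θ ω)}.indicator (fun ω => ∑ i, truncSq δ (ξ i ω)) ω ∂μ
      ≤ ∫ ω, |∑ i, ξ i ω| * Θ ω ∂μ + 2 * δ
        + ∑ i, ∫ ω, |ξ i ω| * |Θ ω - Θ' i ω| ∂μ := by
  have hWΘ : Integrable (fun ω => |∑ i, ξ i ω| * Θ ω) μ := h.memLp_sum.norm.integrable_mul hΘ
  have hW : Integrable (fun ω => 2 * δ * |∑ i, ξ i ω|) μ :=
    (h.memLp_sum.integrable one_le_two).abs.const_mul _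
  have hterm (i : ι) :
      Integrable (fun ω => ξ i ω * concFun c δ (sumExcept ξ i ω) (Θ' i ω)) μ :=
    (h.memLp_two i).integrable_mul
      (memLp_concFun hδ c (h.measurable_sumExcept i).aemeasurable (hΘ' i))
  have hdiff (i : ι) : Integrable (fun ω => |ξ i ω| * |Θ ω - Θ' i ω|) μ :=
    (h.memLp_two i).norm.integrable_mul (hΘ.sub (hΘ' i)).norm
  have hA : MeasurableSet {ω | ∑ i, ξ i ω ∈ Icc c (c + Θ ω)} :=
    (measurableSet_le measurable_const h.measurable_sum).inter
      (measurableSet_le h.measurable_sum (measurable_const.add hΘm))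
  have hS : Integrable (fun ω => ∑ i, truncSq δ (ξ i ω)) μ :=
    integrable_finsetSum _ fun i _ => (h.memLp_truncSq hδ i).integrable one_le_two
  have hle := integral_mono (hS.indicator hA)
    (((hWΘ.add hW).sub (integrable_finsetSum .univ fun i _ => hterm i)).add
      (integrable_finsetSum .univ fun i _ => hdiff i))
    fun ω => indicator_sum_truncSq_le hδ (hΘ0 ω) c (fun i => ξ i ω) fun i => Θ' i ω
  have hzero : ∑ i, ∫ ω, ξ i ω * concFun c δ (sumExcept ξ i ω) (Θ' i ω) ∂μ = 0 :=
    Finset.sum_eq_zero fun i _ => integral_mul_concFun_eq_zero (h.meas i).aemeasurable (h.mean i)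
      (h.measurable_sumExcept i).aemeasurable (hΘ' i).aemeasurable (hindep i) c δ
  refine hle.trans ?_
  rw [integral_add' ((hWΘ.add hW).sub (integrable_finsetSum .univ fun i _ => hterm i))
      (integrable_finsetSum .univ fun i _ => hdiff i),
    integral_sub' (hWΘ.add hW) (integrable_finsetSum .univ fun i _ => hterm i),
    integral_add' hWΘ hW, integral_finsetSum _ fun i _ => hterm i,
    integral_finsetSum _ fun i _ => hdiff i, hzero, integral_const_mul, sub_zero]
  refine add_le_add_left (add_le_add_right ?_ _) _
  exact mul_le_of_le_one_right (mul_nonneg zero_le_two hδ) h.integral_abs_sum_le_one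

theorem measureReal_sum_mem_Icc_add_le (h : IsStdFamily μ ξ) (c : ℝ)
    (hΘ0 : ∀ ω, 0 ≤ Θ ω) (hΘ : MemLp Θ 2 μ) (hΘm : Measurable Θ) (hΘ' : ∀ i, MemLp (Θ' i) 2 μ)
    (hindep : ∀ i, IndepFun (ξ i) (fun ω => (sumExcept ξ i ω, Θ' i ω)) μ) :
    μ.real {ω | ∑ i, ξ i ω ∈ Icc c (c + Θ ω)}
      ≤ 2 * ∫ ω, |∑ i, ξ i ω| * Θ ω ∂μ + 3 * lyapunov μ ξ
        + 2 * ∑ i, ∫ ω, |ξ i ω| * |Θ ω - Θ' i ω| ∂μ := by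
  have hL := h.lyapunov_pos
  -- with this `δ` the truncated second moments still sum to at least `1 / 2`
  obtain ⟨δ, hδ⟩ : ∃ δ, δ = lyapunov μ ξ / 2 := ⟨_, rfl⟩
  have hδ0 : 0 < δ := hδ ▸ half_pos hL
  have hA : MeasurableSet {ω | ∑ i, ξ i ω ∈ Icc c (c + Θ ω)} :=
    (measurableSet_le measurable_const h.measurable_sum).inter
      (measurableSet_le h.measurable_sum (measurable_const.add hΘm))
  have hmean : 1 / 2 ≤ ∫ ω, ∑ i, truncSq δ (ξ i ω) ∂μ := by
    have hhalf : 1 - lyapunov μ ξ / (4 * δ) = 1 / 2 := by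
      rw [hδ]
      field_simp
      norm_num
    exact hhalf ▸ h.one_sub_lyapunov_div_le_integral_sum_truncSq hδ0
  have hS : Integrable (fun ω => ∑ i, truncSq δ (ξ i ω)) μ :=
    integrable_finsetSum _ fun i _ => (h.memLp_truncSq hδ0.le i).integrable one_le_two
  have hmul := mul_measureReal_le_integral_indicator_add hS hA
    (∫ ω, ∑ i, truncSq δ (ξ i ω) ∂μ)
  have hdev := h.integral_abs_sum_truncSq_sub_le hδ0.le
  have hind := h.integral_indicator_sum_truncSq_le hδ0.le c hΘ0 hΘ hΘm hΘ' hindep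
  linarith [mul_le_mul_of_nonneg_right hmean
    (measureReal_nonneg (μ := μ) (s := {ω | ∑ i, ξ i ω ∈ Icc c (c + Θ ω)}))]

theorem measureReal_sum_mem_Icc_sub_le (h : IsStdFamily μ ξ) (c : ℝ)
    (hΘ0 : ∀ ω, 0 ≤ Θ ω) (hΘ : MemLp Θ 2 μ) (hΘm : Measurable Θ) (hΘ' : ∀ i, MemLp (Θ' i) 2 μ)
    (hindep : ∀ i, IndepFun (ξ i) (fun ω => (sumExcept ξ i ω, Θ' i ω)) μ) :
    μ.real {ω | ∑ i, ξ i ω ∈ Icc (c - Θ ω) c}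
      ≤ 2 * ∫ ω, |∑ i, ξ i ω| * Θ ω ∂μ + 3 * lyapunov μ ξ
        + 2 * ∑ i, ∫ ω, |ξ i ω| * |Θ ω - Θ' i ω| ∂μ := by
  have hneg (i : ι) (ω : Ω) : sumExcept (fun i ω => -ξ i ω) i ω = -sumExcept ξ i ω := by
    simp only [sumExcept, Finset.sum_neg_distrib]
    ring
  have hle := h.neg.measureReal_sum_mem_Icc_add_le (-c) hΘ0 hΘ hΘm hΘ' fun i => by
    simp only [hneg]
    exact (hindep i).comp measurable_neg (measurable_fst.neg.prodMk measurable_snd)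
  simp only [Finset.sum_neg_distrib, abs_neg, lyapunov] at hle ⊢
  convert hle using 4 with ω
  simp only [mem_Icc]
  constructor <;> rintro ⟨hl, hr⟩ <;> constructor <;> linarith

end IsStdFamily

end Concentration

/-! ### Berry–Esseen bounds for sums and for nonlinear statistics -/

section Independence

variable {Ω : Type*} [MeasurableSpace Ω] {μ : Measure Ω} [IsProbabilityMeasure μ]

lemma integrable_and_integral_le_of_indepFun {α β : Type*} [MeasurableSpace α]
    [MeasurableSpace β] {X : Ω → α} {Y : Ω → β} (hX : Measurable X) (hY : Measurable Y)
    (hXY : IndepFun X Y μ) {F : α × β → ℝ} (hF : Measurable F) (hF0 : ∀ p, 0 ≤ F p)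
    {G : α → ℝ} (hG : Measurable G) (hint : ∀ x, Integrable (fun ω => F (x, Y ω)) μ)
    (hle : ∀ x, ∫ ω, F (x, Y ω) ∂μ ≤ G x) (hGX : Integrable (fun ω => G (X ω)) μ) :
    Integrable (fun ω => F (X ω, Y ω)) μ ∧ ∫ ω, F (X ω, Y ω) ∂μ ≤ ∫ ω, G (X ω) ∂μ := by
  have : IsProbabilityMeasure (μ.map X) := Measure.isProbabilityMeasure_map hX.aemeasurable
  have : IsProbabilityMeasure (μ.map Y) := Measure.isProbabilityMeasure_map hY.aemeasurable
  have hsection (x : α) : Measurable fun y => F (x, y) := hF.comp measurable_prodMk_left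
  have hinner (x : α) : ∫ y, F (x, y) ∂μ.map Y = ∫ ω, F (x, Y ω) ∂μ :=
    integral_map hY.aemeasurable (hsection x).aestronglyMeasurable
  have hGint : Integrable G (μ.map X) :=
    (integrable_map_measure hG.aestronglyMeasurable hX.aemeasurable).2 hGX
  have hmap := (indepFun_iff_map_prod_eq_prod_map_map hX.aemeasurable hY.aemeasurable).1 hXY
  have hprod : Integrable F ((μ.map X).prod (μ.map Y)) := by
    refine (integrable_prod_iff hF.aestronglyMeasurable).2 ⟨ae_of_all _ fun x =>
      (integrable_map_measure (hsection x).aestronglyMeasurable hY.aemeasurable).2 (hint x), ?_⟩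
    refine hGint.mono' (hF.norm.stronglyMeasurable.integral_prod_right).aestronglyMeasurable
      (ae_of_all _ fun x => ?_)
    simp only [Real.norm_of_nonneg (hF0 _), hinner,
      Real.norm_of_nonneg (integral_nonneg fun ω => hF0 (x, Y ω)), hle]
  constructor
  · rw [← hmap] at hprod
    exact (integrable_map_measure hF.aestronglyMeasurable (hX.prodMk hY).aemeasurable).1 hprod
  · rw [← integral_map (hX.prodMk hY).aemeasurable hF.aestronglyMeasurable, hmap,
      integral_prod F hprod, ← integral_map hX.aemeasurable hG.aestronglyMeasurable]
    exact integral_mono hprod.integral_prod_left hGint fun x => (hinner x).trans_le (hle x)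

lemma half_le_measureReal_abs_le {X : Ω → ℝ} (hX : Measurable X) (hint : Integrable X μ) :
    1 / 2 ≤ μ.real {ω | |X ω| ≤ 2 * ∫ ω, |X ω| ∂μ} := by
  have ha : 0 ≤ ∫ ω, |X ω| ∂μ := integral_nonneg fun ω => abs_nonneg (X ω)
  rcases ha.eq_or_lt with hzero | hpos
  · have hae := (integral_eq_zero_iff_of_nonneg (fun ω => abs_nonneg (X ω)) hint.abs).1 hzero.symm
    have hone : μ.real {ω | |X ω| ≤ 2 * ∫ ω, |X ω| ∂μ} = 1 := by
      have hevent : ∀ᵐ ω ∂μ, ω ∈ {ω | |X ω| ≤ 2 * ∫ ω, |X ω| ∂μ} := by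
        filter_upwards [hae] with ω hω
        simpa only [← hzero, mul_zero] using (show |X ω| ≤ 0 from hω.le)
      rw [measureReal_def, (mem_ae_iff_prob_eq_one₀
        (nullMeasurableSet_le hX.abs.aemeasurable aemeasurable_const)).1 hevent, ENNReal.toReal_one]
    rw [hone]
    norm_num
  · have hmarkov : 2 * (∫ ω, |X ω| ∂μ) * μ.real {ω | 2 * ∫ ω, |X ω| ∂μ ≤ |X ω|}
        ≤ ∫ ω, |X ω| ∂μ :=
      mul_meas_ge_le_integral_of_nonneg (ae_of_all _ fun ω => abs_nonneg (X ω)) hint.abs _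
    have hcompl : μ.real {ω | |X ω| ≤ 2 * ∫ ω, |X ω| ∂μ}ᶜ
        ≤ μ.real {ω | 2 * ∫ ω, |X ω| ∂μ ≤ |X ω|} :=
      measureReal_mono fun ω (hω : ¬ |X ω| ≤ _) => (not_le.1 hω).le
    rw [probReal_compl_eq_one_sub (measurableSet_le hX.abs measurable_const)] at hcompl
    nlinarith

lemma measureReal_mem_Icc_le_two_mul {X V : Ω → ℝ} (hXV : IndepFun X V μ) {K : ℝ}
    (hK : 1 / 2 ≤ μ.real {ω | |X ω| ≤ K}) (a b : ℝ) :
    μ.real {ω | V ω ∈ Icc a b} ≤ 2 * μ.real {ω | V ω + X ω ∈ Icc (a - K) (b + K)} := by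
  have hmul : μ.real ({ω | |X ω| ≤ K} ∩ {ω | V ω ∈ Icc a b})
      = μ.real {ω | |X ω| ≤ K} * μ.real {ω | V ω ∈ Icc a b} := by
    rw [measureReal_def, measureReal_def, measureReal_def, ← ENNReal.toReal_mul]
    exact congrArg ENNReal.toReal (hXV.measure_inter_preimage_eq_mul {x | |x| ≤ K} _
      (measurableSet_le measurable_abs measurable_const) measurableSet_Icc)
  have hsub : μ.real ({ω | |X ω| ≤ K} ∩ {ω | V ω ∈ Icc a b})
      ≤ μ.real {ω | V ω + X ω ∈ Icc (a - K) (b + K)} := by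
    refine measureReal_mono fun ω ⟨hX, hV⟩ => ?_
    have hX' := abs_le.1 (mem_ofPred_eq.mp hX)
    exact ⟨by linarith [hV.1], by linarith [hV.2]⟩
  have hnonneg : 0 ≤ μ.real {ω | V ω ∈ Icc a b} := measureReal_nonneg
  nlinarith

end Independence

section BerryEsseen

variable {Ω : Type*} [MeasurableSpace Ω] {ι : Type*} [Fintype ι] {μ : Measure Ω}
  [IsProbabilityMeasure μ]

lemma memLp_steinSol_comp {X : Ω → ℝ} (hX : Measurable X) (z : ℝ) (p : ℝ≥0∞) :
    MemLp (fun ω => steinSol z (X ω)) p μ :=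
  (memLp_const 6).mono' ((continuous_steinSol z).measurable.comp hX).aestronglyMeasurable
    (ae_of_all _ fun _ => abs_steinSol_le z _)

lemma integrable_steinDer_comp {X : Ω → ℝ} (hX : Measurable X) (z : ℝ) :
    Integrable (fun ω => steinDer z (X ω)) μ :=
  (integrable_const 2).mono' ((measurable_steinDer z).comp hX).aestronglyMeasurable
    (ae_of_all _ fun _ => abs_steinDer_le z _)

lemma integral_steinDer_sub_mul_steinSol {W : Ω → ℝ} (hW : Measurable W) (z : ℝ) :
    ∫ ω, (steinDer z (W ω) - W ω * steinSol z (W ω)) ∂μ = μ.real {ω | W ω ≤ z} - Φ z := by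
  have hset : MeasurableSet {ω | W ω ≤ z} := measurableSet_le hW measurable_const
  have hstein (ω : Ω) : steinDer z (W ω) - W ω * steinSol z (W ω)
      = {ω | W ω ≤ z}.indicator 1 ω - Φ z := by
    change W ω * steinSol z (W ω) + {ω | W ω ≤ z}.indicator 1 ω - Φ z
      - W ω * steinSol z (W ω) = _
    ring
  have hind : Integrable ({ω | W ω ≤ z}.indicator (1 : Ω → ℝ)) μ :=
    (integrable_const (1 : ℝ)).indicator hset
  simp_rw [hstein]
  rw [integral_sub hind (integrable_const _),
    integral_indicator_one hset, integral_const, probReal_univ, one_smul]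

namespace IsStdFamily

variable {ξ : ι → Ω → ℝ}

lemma measureReal_sum_mem_Icc_le (h : IsStdFamily μ ξ) {a b : ℝ} (hab : a ≤ b) :
    μ.real {ω | ∑ i, ξ i ω ∈ Icc a b} ≤ 2 * (b - a) + 3 * lyapunov μ ξ := by
  have hconc := h.measureReal_sum_mem_Icc_add_le a (Θ := fun _ => b - a)
    (Θ' := fun _ _ => b - a) (fun _ => sub_nonneg.2 hab) (memLp_const _) measurable_const
    (fun _ => memLp_const _) fun i => (h.indepFun_sumExcept i).comp measurable_id
      (measurable_id.prodMk measurable_const)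
  simp only [sub_self, abs_zero, mul_zero, integral_zero, Finset.sum_const_zero, add_zero,
    integral_mul_const, add_sub_cancel] at hconc
  nlinarith [h.integral_abs_sum_le_one]

lemma measureReal_sumExcept_mem_Icc_le (h : IsStdFamily μ ξ) (i : ι) {a b : ℝ} (hab : a ≤ b) :
    μ.real {ω | sumExcept ξ i ω ∈ Icc a b}
      ≤ 4 * (b - a) + 16 * ∫ ω, |ξ i ω| ∂μ + 6 * lyapunov μ ξ := by
  have ha : 0 ≤ ∫ ω, |ξ i ω| ∂μ := integral_nonneg fun _ => abs_nonneg _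
  have hle := measureReal_mem_Icc_le_two_mul (h.indepFun_sumExcept i)
    (half_le_measureReal_abs_le (h.meas i) (h.integrable i)) a b
  have hconc := h.measureReal_sum_mem_Icc_le
    (a := a - 2 * ∫ ω, |ξ i ω| ∂μ) (b := b + 2 * ∫ ω, |ξ i ω| ∂μ) (by linarith)
  simp only [sumExcept, sub_add_cancel] at hle ⊢
  linarith

lemma memLp_sumExcept (h : IsStdFamily μ ξ) (i : ι) : MemLp (sumExcept ξ i) 2 μ :=
  h.memLp_sum.sub (h.memLp_two i)

lemma integral_abs_sumExcept_le_two (h : IsStdFamily μ ξ) (i : ι) :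
    ∫ ω, |sumExcept ξ i ω| ∂μ ≤ 2 := by
  have hξ : ∫ ω, |ξ i ω| ∂μ ≤ 1 :=
    (integral_abs_le_sqrt (h.memLp_two i)).trans (Real.sqrt_le_one.2 (h.integral_sq_le_one i))
  have hsum : Integrable (fun ω => |∑ j, ξ j ω|) μ := (h.memLp_sum.integrable one_le_two).abs
  calc ∫ ω, |sumExcept ξ i ω| ∂μ ≤ ∫ ω, (|∑ j, ξ j ω| + |ξ i ω|) ∂μ :=
        integral_mono ((h.memLp_sumExcept i).integrable one_le_two).abs
          (hsum.add (h.integrable i).abs) fun ω => abs_sub _ _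
    _ ≤ 2 := by
        rw [integral_add hsum (h.integrable i).abs]
        linarith [h.integral_abs_sum_le_one]

lemma integrable_steinOsc_sumExcept (h : IsStdFamily μ ξ) (z : ℝ) (i : ι) (s : ℝ) :
    Integrable (fun ω => steinOsc z (sumExcept ξ i ω) s) μ := by
  have hV : Integrable (fun ω => |sumExcept ξ i ω|) μ :=
    ((h.memLp_sumExcept i).integrable one_le_two).abs
  exact (((hV.const_mul 2).add (integrable_const 6)).mul_const s).add
    ((integrable_const (1 : ℝ)).indicator (h.measurable_sumExcept i measurableSet_Icc))

lemma integral_steinOsc_sumExcept_le (h : IsStdFamily μ ξ) (z : ℝ) (i : ι) {s : ℝ}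
    (hs : 0 ≤ s) :
    ∫ ω, steinOsc z (sumExcept ξ i ω) s ∂μ
      ≤ 18 * s + (16 * ∫ ω, |ξ i ω| ∂μ + 6 * lyapunov μ ξ) := by
  have hV : Integrable (fun ω => |sumExcept ξ i ω|) μ :=
    ((h.memLp_sumExcept i).integrable one_le_two).abs
  have hset : MeasurableSet {ω | sumExcept ξ i ω ∈ Icc (z - s) (z + s)} :=
    h.measurable_sumExcept i measurableSet_Icc
  have hlin : Integrable (fun ω => (2 * |sumExcept ξ i ω| + 6) * s) μ :=
    ((hV.const_mul 2).add (integrable_const 6)).mul_const s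
  have hind : Integrable ({ω | sumExcept ξ i ω ∈ Icc (z - s) (z + s)}.indicator (1 : Ω → ℝ)) μ :=
    (integrable_const (1 : ℝ)).indicator hset
  have hconc := h.measureReal_sumExcept_mem_Icc_le i (a := z - s) (b := z + s) (by linarith)
  calc ∫ ω, steinOsc z (sumExcept ξ i ω) s ∂μ
      = ∫ ω, ((2 * |sumExcept ξ i ω| + 6) * s
          + {ω | sumExcept ξ i ω ∈ Icc (z - s) (z + s)}.indicator 1 ω) ∂μ := rfl
    _ = (2 * ∫ ω, |sumExcept ξ i ω| ∂μ + 6) * s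
          + μ.real {ω | sumExcept ξ i ω ∈ Icc (z - s) (z + s)} := by
        rw [integral_add hlin hind, integral_mul_const, integral_add (hV.const_mul 2)
          (integrable_const 6), integral_const_mul, integral_const, probReal_univ, one_smul,
          integral_indicator_one hset]
    _ ≤ _ := by nlinarith [h.integral_abs_sumExcept_le_two i]

lemma integrable_and_integral_mul_steinOsc_le (h : IsStdFamily μ ξ) (z : ℝ) (i : ι) :
    Integrable (fun ω => (∫ ω', ξ i ω' ^ 2 ∂μ + ξ i ω ^ 2)
        * steinOsc z (sumExcept ξ i ω) |ξ i ω|) μ ∧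
      ∫ ω, (∫ ω', ξ i ω' ^ 2 ∂μ + ξ i ω ^ 2) * steinOsc z (sumExcept ξ i ω) |ξ i ω| ∂μ
        ≤ 68 * ∫ ω, |ξ i ω| ^ 3 ∂μ + 12 * lyapunov μ ξ * ∫ ω, ξ i ω ^ 2 ∂μ := by
  set v := ∫ ω, ξ i ω ^ 2 ∂μ
  have : 0 ≤ v := integral_nonneg fun _ => sq_nonneg _
  set b := 16 * ∫ ω, |ξ i ω| ∂μ + 6 * lyapunov μ ξ with hb
  have hint1 := (h.integrable i).abs
  have hint2 := (h.memLp_two i).integrable_sq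
  have hint3 := integrable_abs_pow (p := 3) (h.memLp i) (by norm_num)
  have hG (x : ℝ) : (v + x ^ 2) * (18 * |x| + b)
      = 18 * v * |x| + 18 * |x| ^ 3 + (v * b + b * x ^ 2) := by
    rw [← sq_abs x]
    ring
  have hodd : Integrable (fun ω => 18 * v * |ξ i ω| + 18 * |ξ i ω| ^ 3) μ :=
    (hint1.const_mul _).add (hint3.const_mul _)
  have heven : Integrable (fun ω => v * b + b * ξ i ω ^ 2) μ :=
    (integrable_const _).add (hint2.const_mul _)
  have hGint : Integrable (fun ω => (v + ξ i ω ^ 2) * (18 * |ξ i ω| + b)) μ := by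
    simp only [hG]
    exact hodd.add heven
  obtain ⟨hint, hle⟩ := integrable_and_integral_le_of_indepFun (h.meas i)
    (h.measurable_sumExcept i) (h.indepFun_sumExcept i)
    (F := fun p => (v + p.1 ^ 2) * steinOsc z p.2 |p.1|)
    (G := fun x => (v + x ^ 2) * (18 * |x| + b))
    (((measurable_fst.pow_const 2).const_add v).mul
      ((measurable_steinOsc z).comp (measurable_snd.prodMk measurable_fst.abs)))
    (fun p => mul_nonneg (by positivity) (steinOsc_nonneg z p.2 (abs_nonneg p.1))) (by fun_prop)
    (fun x => (h.integrable_steinOsc_sumExcept z i |x|).const_mul (v + x ^ 2))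
    (fun x => (integral_const_mul (v + x ^ 2) _).trans_le (mul_le_mul_of_nonneg_left
      (h.integral_steinOsc_sumExcept_le z i (abs_nonneg x)) (by positivity))) hGint
  refine ⟨hint, hle.trans ?_⟩
  simp only [hG]
  rw [integral_add hodd heven, integral_add (hint1.const_mul _) (hint3.const_mul _),
    integral_add (integrable_const _) (hint2.const_mul _), integral_const, probReal_univ, one_smul,
    integral_const_mul, integral_const_mul, integral_const_mul, hb]
  linarith [integral_sq_mul_integral_abs_le (h.memLp i)]

lemma integral_mul_steinSol_eq (h : IsStdFamily μ ξ) (z : ℝ) (i : ι) :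
    (∫ ω, ξ i ω ^ 2 ∂μ) * ∫ ω, steinDer z (∑ j, ξ j ω) ∂μ
        - ∫ ω, ξ i ω * steinSol z (∑ j, ξ j ω) ∂μ
      = ∫ ω, ((∫ ω', ξ i ω' ^ 2 ∂μ) * (steinDer z (∑ j, ξ j ω) - steinDer z (sumExcept ξ i ω))
          - ξ i ω * (steinSol z (∑ j, ξ j ω) - steinSol z (sumExcept ξ i ω)
            - ξ i ω * steinDer z (sumExcept ξ i ω))) ∂μ := by
  have hVm := h.measurable_sumExcept i
  have hmean : ∫ ω, ξ i ω * steinSol z (sumExcept ξ i ω) ∂μ = 0 := by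
    have hmul := ((h.indepFun_sumExcept i).comp measurable_id
      (continuous_steinSol z).measurable).integral_fun_mul_eq_mul_integral
      (h.meas i).aestronglyMeasurable (memLp_steinSol_comp hVm z 1).aestronglyMeasurable
    simpa only [Function.comp_apply, id_eq, h.mean i, zero_mul] using hmul
  have hindep := (h.indepFun_sumExcept i).comp (measurable_id.pow_const 2) (measurable_steinDer z)
  have hvar : ∫ ω, ξ i ω ^ 2 * steinDer z (sumExcept ξ i ω) ∂μ
      = (∫ ω, ξ i ω ^ 2 ∂μ) * ∫ ω, steinDer z (sumExcept ξ i ω) ∂μ :=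
    hindep.integral_fun_mul_eq_mul_integral (h.memLp_two i).integrable_sq.aestronglyMeasurable
      (integrable_steinDer_comp hVm z).aestronglyMeasurable
  have hW' := integrable_steinDer_comp (μ := μ) h.measurable_sum z
  have hV' := integrable_steinDer_comp (μ := μ) hVm z
  have hW : Integrable (fun ω => ξ i ω * steinSol z (∑ j, ξ j ω)) μ :=
    (h.memLp_two i).integrable_mul (memLp_steinSol_comp h.measurable_sum z 2)
  have hV : Integrable (fun ω => ξ i ω * steinSol z (sumExcept ξ i ω)) μ :=
    (h.memLp_two i).integrable_mul (memLp_steinSol_comp hVm z 2)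
  have hsq : Integrable (fun ω => ξ i ω ^ 2 * steinDer z (sumExcept ξ i ω)) μ :=
    hindep.integrable_mul (h.memLp_two i).integrable_sq hV'
  have hsol : Integrable
      (fun ω => ξ i ω * steinSol z (∑ j, ξ j ω) - ξ i ω * steinSol z (sumExcept ξ i ω)) μ :=
    hW.sub hV
  have hrem : Integrable (fun ω => ξ i ω * steinSol z (∑ j, ξ j ω)
      - ξ i ω * steinSol z (sumExcept ξ i ω) - ξ i ω ^ 2 * steinDer z (sumExcept ξ i ω)) μ :=
    hsol.sub hsq
  simp only [mul_sub, ← mul_assoc, ← sq]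
  rw [integral_sub ?_ hrem, integral_sub (hW'.const_mul _) (hV'.const_mul _),
    integral_sub hsol hsq, integral_sub hW hV, integral_const_mul, integral_const_mul, hmean, hvar]
  · ring
  · exact (hW'.const_mul _).sub (hV'.const_mul _)

lemma abs_integral_mul_steinSol_sub_le (h : IsStdFamily μ ξ) (z : ℝ) (i : ι) :
    |(∫ ω, ξ i ω ^ 2 ∂μ) * ∫ ω, steinDer z (∑ j, ξ j ω) ∂μ
        - ∫ ω, ξ i ω * steinSol z (∑ j, ξ j ω) ∂μ|
      ≤ 68 * ∫ ω, |ξ i ω| ^ 3 ∂μ + 12 * lyapunov μ ξ * ∫ ω, ξ i ω ^ 2 ∂μ := by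
  obtain ⟨hint, hle⟩ := h.integrable_and_integral_mul_steinOsc_le z i
  have hv : 0 ≤ ∫ ω, ξ i ω ^ 2 ∂μ := integral_nonneg fun _ => sq_nonneg _
  rw [h.integral_mul_steinSol_eq z i, ← Real.norm_eq_abs]
  refine (norm_integral_le_of_norm_le hint (ae_of_all _ fun ω => ?_)).trans hle
  have hdiff : ∑ j, ξ j ω - sumExcept ξ i ω = ξ i ω := sub_sub_cancel _ _
  have hder := abs_steinDer_sub_le (z := z) (y := ∑ j, ξ j ω) (w := sumExcept ξ i ω)
    (congrArg abs hdiff).le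
  have hsol := abs_steinSol_sub_sub_le z (sumExcept ξ i ω) (∑ j, ξ j ω)
  rw [hdiff] at hsol
  rw [Real.norm_eq_abs]
  refine (abs_sub _ _).trans ?_
  rw [abs_mul, abs_mul, abs_of_nonneg hv, add_mul]
  refine add_le_add (mul_le_mul_of_nonneg_left hder hv)
    ((mul_le_mul_of_nonneg_left hsol (abs_nonneg _)).trans_eq ?_)
  rw [← sq_abs (ξ i ω)]
  ring

theorem abs_measureReal_sum_le_sub_cdf_le (h : IsStdFamily μ ξ) (z : ℝ) :
    |μ.real {ω | ∑ i, ξ i ω ≤ z} - Φ z| ≤ 80 * lyapunov μ ξ := by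
  have hterm (i : ι) : Integrable (fun ω => ξ i ω * steinSol z (∑ j, ξ j ω)) μ :=
    (h.memLp_two i).integrable_mul (memLp_steinSol_comp h.measurable_sum z 2)
  have hsplit : μ.real {ω | ∑ i, ξ i ω ≤ z} - Φ z
      = ∑ i, ((∫ ω, ξ i ω ^ 2 ∂μ) * ∫ ω, steinDer z (∑ j, ξ j ω) ∂μ
        - ∫ ω, ξ i ω * steinSol z (∑ j, ξ j ω) ∂μ) := by
    rw [Finset.sum_sub_distrib, ← Finset.sum_mul, h.var, one_mul,
      ← integral_steinDer_sub_mul_steinSol h.measurable_sum]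
    simp only [Finset.sum_mul]
    rw [integral_sub (integrable_steinDer_comp h.measurable_sum z)
      (integrable_finsetSum _ fun i _ => hterm i), integral_finsetSum _ fun i _ => hterm i]
  calc |μ.real {ω | ∑ i, ξ i ω ≤ z} - Φ z|
      ≤ ∑ i, (68 * ∫ ω, |ξ i ω| ^ 3 ∂μ + 12 * lyapunov μ ξ * ∫ ω, ξ i ω ^ 2 ∂μ) := by
        rw [hsplit]
        exact (Finset.abs_sum_le_sum_abs _ _).trans
          (Finset.sum_le_sum fun i _ => h.abs_integral_mul_steinSol_sub_le z i)
    _ = 80 * lyapunov μ ξ := by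
        rw [Finset.sum_add_distrib, ← Finset.mul_sum, ← Finset.mul_sum, h.var, ← lyapunov]
        ring

/-- `W + Δ ≤ z` and `W ≤ z` can differ only when `W` lies within `|Δ|` of `z`. -/
theorem abs_measureReal_sum_add_le_sub_cdf_le (h : IsStdFamily μ ξ) {Δ : Ω → ℝ}
    {Δ' : ι → Ω → ℝ} (hΔ : MemLp Δ 2 μ) (hΔm : Measurable Δ) (hΔ' : ∀ i, MemLp (Δ' i) 2 μ)
    (hindep : ∀ i, IndepFun (ξ i) (fun ω => (sumExcept ξ i ω, Δ' i ω)) μ) (z : ℝ) :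
    |μ.real {ω | ∑ i, ξ i ω + Δ ω ≤ z} - Φ z|
      ≤ 83 * lyapunov μ ξ + 2 * ∫ ω, |∑ i, ξ i ω| * |Δ ω| ∂μ
        + 2 * ∑ i, ∫ ω, |ξ i ω| * |Δ ω - Δ' i ω| ∂μ := by
  have hlinear := abs_le.1 (h.abs_measureReal_sum_le_sub_cdf_le z)
  have hdiff : ∑ i, ∫ ω, |ξ i ω| * |(|Δ ω| - |Δ' i ω|)| ∂μ
      ≤ ∑ i, ∫ ω, |ξ i ω| * |Δ ω - Δ' i ω| ∂μ := by
    refine Finset.sum_le_sum fun i _ => integral_mono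
      ((h.memLp_two i).norm.integrable_mul (hΔ.norm.sub (hΔ' i).norm).norm)
      ((h.memLp_two i).norm.integrable_mul (hΔ.sub (hΔ' i)).norm) fun ω => ?_
    exact mul_le_mul_of_nonneg_left (abs_abs_sub_abs_le_abs_sub _ _) (abs_nonneg _)
  have hindep' (i : ι) : IndepFun (ξ i) (fun ω => (sumExcept ξ i ω, |Δ' i ω|)) μ :=
    (hindep i).comp measurable_id (measurable_fst.prodMk measurable_snd.abs)
  have hright := h.measureReal_sum_mem_Icc_add_le z (Θ := fun ω => |Δ ω|)
    (Θ' := fun i ω => |Δ' i ω|) (fun ω => abs_nonneg (Δ ω)) hΔ.norm hΔm.abs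
    (fun i => (hΔ' i).norm) hindep'
  have hleft := h.measureReal_sum_mem_Icc_sub_le z (Θ := fun ω => |Δ ω|)
    (Θ' := fun i ω => |Δ' i ω|) (fun ω => abs_nonneg (Δ ω)) hΔ.norm hΔm.abs
    (fun i => (hΔ' i).norm) hindep'
  have hupper : μ.real {ω | ∑ i, ξ i ω + Δ ω ≤ z} ≤ μ.real {ω | ∑ i, ξ i ω ≤ z}
      + μ.real {ω | ∑ i, ξ i ω ∈ Icc z (z + |Δ ω|)} := by
    refine (measureReal_mono fun ω (hω : _ ≤ z) => ?_).trans (measureReal_union_le _ _)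
    exact (le_total _ z).imp id fun hz => ⟨hz, by linarith [neg_abs_le (Δ ω)]⟩
  have hlower : μ.real {ω | ∑ i, ξ i ω ≤ z} ≤ μ.real {ω | ∑ i, ξ i ω + Δ ω ≤ z}
      + μ.real {ω | ∑ i, ξ i ω ∈ Icc (z - |Δ ω|) z} := by
    refine (measureReal_mono fun ω (hω : _ ≤ z) => ?_).trans (measureReal_union_le _ _)
    exact (le_total _ z).imp id fun hz => ⟨by linarith [le_abs_self (Δ ω)], hω⟩
  rw [abs_le]
  constructor <;> linarith

end IsStdFamily

end BerryEsseen

/-! ### Degenerate kernels -/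

lemma integral_comp_eq_of_measurePreserving {α β E : Type*} [MeasurableSpace α]
    [MeasurableSpace β] [NormedAddCommGroup E] [NormedSpace ℝ E] {μ : Measure α} {ν : Measure β}
    {f : α → β} (hf : MeasurePreserving f μ ν) {g : β → E} (hg : AEStronglyMeasurable g ν) :
    ∫ x, g (f x) ∂μ = ∫ y, g y ∂ν := by
  rw [← hf.map_eq] at hg ⊢
  exact (integral_map hf.aemeasurable hg).symm

section Resampling

variable {ι κ : Type*} [Fintype ι] [Fintype κ]

lemma measurePreserving_piecewise [DecidableEq ι] {𝒴 : ι → Type*} [∀ i, MeasurableSpace (𝒴 i)]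
    (ν : ∀ i, Measure (𝒴 i)) [∀ i, IsProbabilityMeasure (ν i)] (T : Finset ι) :
    MeasurePreserving (fun p : (∀ i, 𝒴 i) × (∀ i, 𝒴 i) => T.piecewise p.2 p.1)
      ((Measure.pi ν).prod (Measure.pi ν)) (Measure.pi ν) := by
  have hmeas : Measurable fun p : (∀ i, 𝒴 i) × (∀ i, 𝒴 i) => T.piecewise p.2 p.1 := by
    refine measurable_pi_lambda _ fun i => ?_
    by_cases hi : i ∈ T
    · simp only [hi, Finset.piecewise_eq_of_mem]
      fun_prop
    · simp only [hi, not_false_eq_true, Finset.piecewise_eq_of_notMem]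
      fun_prop
  refine ⟨hmeas, (Measure.pi_eq fun s hs => ?_).symm⟩
  have hpreimage : (fun p : (∀ i, 𝒴 i) × (∀ i, 𝒴 i) => T.piecewise p.2 p.1) ⁻¹' univ.pi s
      = univ.pi (fun i => if i ∈ T then univ else s i) ×ˢ
        univ.pi (fun i => if i ∈ T then s i else univ) := by
    ext p
    simp only [mem_preimage, Set.mem_pi, mem_univ, forall_const, mem_prod, ← forall_and]
    refine forall_congr' fun i => ?_
    by_cases hi : i ∈ T <;> simp [hi]
  rw [Measure.map_apply hmeas (MeasurableSet.univ_pi hs), hpreimage, Measure.prod_prod,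
    Measure.pi_pi, Measure.pi_pi, ← Finset.prod_mul_distrib]
  refine Finset.prod_congr rfl fun i _ => ?_
  by_cases hi : i ∈ T <;> simp [hi]

lemma measurePreserving_update [DecidableEq ι] {𝒴 : ι → Type*} [∀ i, MeasurableSpace (𝒴 i)]
    (ν : ∀ i, Measure (𝒴 i)) [∀ i, IsProbabilityMeasure (ν i)] (a : ι) :
    MeasurePreserving (fun p : (∀ i, 𝒴 i) × 𝒴 a => Function.update p.1 a p.2)
      ((Measure.pi ν).prod (ν a)) (Measure.pi ν) := by
  have heval : MeasurePreserving (Prod.map id (Function.eval a))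
      ((Measure.pi ν).prod (Measure.pi ν)) ((Measure.pi ν).prod (ν a)) :=
    (MeasurePreserving.id _).prod (measurePreserving_eval ν a)
  have hcomp : (fun p : (∀ i, 𝒴 i) × 𝒴 a => Function.update p.1 a p.2) ∘
      Prod.map id (Function.eval a) = fun p => ({a} : Finset ι).piecewise p.2 p.1 := by
    ext p i
    by_cases hi : i = a
    · subst hi
      simp
    · simp [hi]
  refine ⟨measurable_update', ?_⟩
  rw [← heval.map_eq, Measure.map_map measurable_update' heval.measurable, hcomp,
    (measurePreserving_piecewise ν {a}).map_eq]

lemma measurePreserving_comp_of_injective {𝒴 : Type*} [MeasurableSpace 𝒴] (ν : Measure 𝒴)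
    [IsProbabilityMeasure ν] {i : κ → ι} (hi : i.Injective) :
    MeasurePreserving (fun (y : ι → 𝒴) k => y (i k)) (Measure.pi fun _ => ν)
      (Measure.pi fun _ => ν) := by
  refine ⟨measurable_pi_lambda _ fun k => measurable_pi_apply _, ?_⟩
  have hindep := (iIndepFun_pi (X := fun (_ : ι) (y : 𝒴) => y) (μ := fun _ : ι => ν)
    fun _ => aemeasurable_id).precomp hi
  rw [(iIndepFun_iff_map_fun_eq_pi_map
    fun k => (measurable_pi_apply (i k)).aemeasurable).1 hindep]
  exact congrArg Measure.pi (funext fun k => (measurePreserving_eval (fun _ => ν) (i k)).map_eq)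

end Resampling

section Counting

variable {ι κ : Type*} [Fintype ι] [Fintype κ] [DecidableEq ι] [DecidableEq κ]

lemma card_filter_forall_mem_eq_mul_pow (K : Finset κ) (c : κ → ι) :
    (Finset.univ.filter fun j : κ → ι => ∀ k ∈ K, j k = c k).card * Fintype.card ι ^ K.card
      = Fintype.card ι ^ Fintype.card κ := by
  have hfilter : (Finset.univ.filter fun j : κ → ι => ∀ k ∈ K, j k = c k)
      = Fintype.piFinset fun k => if k ∈ K then {c k} else Finset.univ := by
    ext j
    simp only [Finset.mem_filter, Finset.mem_univ, true_and, Fintype.mem_piFinset]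
    refine forall_congr' fun k => ?_
    by_cases hk : k ∈ K <;> simp [hk]
  have hcard (k : κ) : (if k ∈ K then {c k} else Finset.univ : Finset ι).card
      = if k ∈ Kᶜ then Fintype.card ι else 1 := by
    by_cases hk : k ∈ K <;> simp [hk]
  rw [hfilter, Fintype.card_piFinset]
  simp only [hcard]
  rw [Finset.prod_ite_mem, Finset.univ_inter, Finset.prod_const, ← pow_add,
    Finset.card_compl_add_card]

lemma card_filter_exists_eq_mul_le (l : ι) :
    (Finset.univ.filter fun i : κ → ι => ∃ k, i k = l).card * Fintype.card ι
      ≤ Fintype.card κ * Fintype.card ι ^ Fintype.card κ := by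
  have hsub : (Finset.univ.filter fun i : κ → ι => ∃ k, i k = l) ⊆ Finset.univ.biUnion fun k =>
      Finset.univ.filter fun i : κ → ι => ∀ k' ∈ ({k} : Finset κ), i k' = l := by
    intro i hi
    simpa using hi
  calc _ ≤ (∑ k : κ, (Finset.univ.filter
        fun i : κ → ι => ∀ k' ∈ ({k} : Finset κ), i k' = l).card) * Fintype.card ι :=
        Nat.mul_le_mul_right _ ((Finset.card_le_card hsub).trans Finset.card_biUnion_le)
    _ = ∑ _k : κ, Fintype.card ι ^ Fintype.card κ := by
        rw [Finset.sum_mul]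
        refine Finset.sum_congr rfl fun k _ => ?_
        simpa using card_filter_forall_mem_eq_mul_pow {k} fun _ => l
    _ = _ := by rw [Finset.sum_const, smul_eq_mul, Finset.card_univ]

end Counting

section Degenerate

variable {ι κ : Type*} [Fintype ι] [Fintype κ]

/-- Two tuples of indices overlap if they share at least two indices. -/
def Overlap (i j : κ → ι) : Prop :=
  ∃ a a' b b', a ≠ a' ∧ b ≠ b' ∧ i a = j b ∧ i a' = j b'

open Classical in
lemma card_overlap_mul_sq_le [DecidableEq κ] (i : κ → ι) :
    (Finset.univ.filter (Overlap i)).card * Fintype.card ι ^ 2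
      ≤ Fintype.card κ ^ 4 * Fintype.card ι ^ Fintype.card κ := by
  let Q : Finset (κ × κ × κ × κ) := Finset.univ.filter fun q => q.2.2.1 ≠ q.2.2.2
  let c (q : κ × κ × κ × κ) (k : κ) : ι := if k = q.2.2.1 then i q.1 else i q.2.1
  have hsub : Finset.univ.filter (Overlap i) ⊆ Q.biUnion fun q =>
      Finset.univ.filter fun j => ∀ k ∈ ({q.2.2.1, q.2.2.2} : Finset κ), j k = c q k := by
    intro j hj
    obtain ⟨a, a', b, b', -, hb, hab, hab'⟩ := (Finset.mem_filter.1 hj).2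
    exact Finset.mem_biUnion.2 ⟨(a, a', b, b'), by simp [Q, hb], by simp [c, hab, hab', hb.symm]⟩
  calc _ ≤ (∑ q ∈ Q, (Finset.univ.filter fun j : κ → ι =>
        ∀ k ∈ ({q.2.2.1, q.2.2.2} : Finset κ), j k = c q k).card) * Fintype.card ι ^ 2 :=
        Nat.mul_le_mul_right _ ((Finset.card_le_card hsub).trans Finset.card_biUnion_le)
    _ = Q.card * Fintype.card ι ^ Fintype.card κ := by
        rw [Finset.sum_mul, ← smul_eq_mul, ← Finset.sum_const]
        refine Finset.sum_congr rfl fun q hq => ?_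
        rw [← card_filter_forall_mem_eq_mul_pow {q.2.2.1, q.2.2.2} (c q),
          Finset.card_pair (Finset.mem_filter.1 hq).2]
    _ ≤ Fintype.card κ ^ 4 * Fintype.card ι ^ Fintype.card κ := by
        refine Nat.mul_le_mul_right _ ((Finset.card_le_univ Q).trans_eq ?_)
        simp only [Fintype.card_prod]
        ring

variable {𝒴 : Type*} [MeasurableSpace 𝒴] {ν : Measure 𝒴}

lemma integral_mul_comp_le [IsProbabilityMeasure ν] {R : (κ → 𝒴) → ℝ}
    (hR : MemLp R 2 (Measure.pi fun _ => ν)) {i j : κ → ι} (hi : i.Injective)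
    (hj : j.Injective) :
    ∫ y, R (fun k => y (i k)) * R (fun k => y (j k)) ∂(Measure.pi fun _ : ι => ν)
      ≤ ∫ v, R v ^ 2 ∂(Measure.pi fun _ => ν) := by
  have hsq {i : κ → ι} (hi : i.Injective) :
      ∫ y : ι → 𝒴, R (fun k => y (i k)) ^ 2 ∂(Measure.pi fun _ => ν)
        = ∫ v, R v ^ 2 ∂(Measure.pi fun _ => ν) :=
    integral_comp_eq_of_measurePreserving (measurePreserving_comp_of_injective ν hi)
      (hR.aestronglyMeasurable.pow 2)
  have hmemLp {i : κ → ι} (hi : i.Injective) :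
      MemLp (fun y : ι → 𝒴 => R (fun k => y (i k))) 2 (Measure.pi fun _ => ν) :=
    hR.comp_measurePreserving (measurePreserving_comp_of_injective ν hi)
  have hcs := integral_abs_mul_abs_le_sqrt (hmemLp hi) (hmemLp hj)
  rw [hsq hi, hsq hj, Real.mul_self_sqrt (integral_nonneg fun _ => sq_nonneg _)] at hcs
  refine (integral_mono ((hmemLp hi).integrable_mul (hmemLp hj))
    ((hmemLp hi).norm.integrable_mul (hmemLp hj).norm) fun y => ?_).trans hcs
  exact (le_abs_self _).trans_eq (abs_mul _ _)

variable [DecidableEq κ]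

/-- A kernel is degenerate if its conditional mean given any one of its arguments vanishes. -/
def IsDegenerate (ν : Measure 𝒴) (R : (κ → 𝒴) → ℝ) : Prop :=
  ∀ a : κ, ∀ᵐ y ∂ν, ∫ v, R (Function.update v a y) ∂(Measure.pi fun _ => ν) = 0

variable [IsProbabilityMeasure ν] {R : (κ → 𝒴) → ℝ}

/-- Resampling the arguments of the first factor other than `i a` leaves the second factor
unchanged and averages the first one to zero. -/
lemma integral_mul_eq_zero_of_isDegenerate (hR : MemLp R 2 (Measure.pi fun _ => ν))
    (hRm : Measurable R) (hdeg : IsDegenerate ν R) {i j : κ → ι} (hi : i.Injective)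
    (hj : j.Injective) (a : κ) (ha : ∀ b ≠ a, ∀ c, i b ≠ j c) :
    ∫ y, R (fun k => y (i k)) * R (fun k => y (j k)) ∂(Measure.pi fun _ : ι => ν) = 0 := by
  classical
  set T : Finset ι := (Finset.univ.erase a).image i with hT
  have hresample := measurePreserving_piecewise (fun _ : ι => ν) T
  have hint : Integrable (fun y : ι → 𝒴 => R (fun k => y (i k)) * R (fun k => y (j k)))
      (Measure.pi fun _ => ν) :=
    (hR.comp_measurePreserving (measurePreserving_comp_of_injective ν hi)).integrable_mul
      (hR.comp_measurePreserving (measurePreserving_comp_of_injective ν hj))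
  have hint' : Integrable (fun p : (ι → 𝒴) × (ι → 𝒴) =>
      R (fun k => T.piecewise p.2 p.1 (i k)) * R (fun k => T.piecewise p.2 p.1 (j k)))
      ((Measure.pi fun _ => ν).prod (Measure.pi fun _ => ν)) :=
    hresample.integrable_comp_of_integrable hint
  have hjT (v y : ι → 𝒴) : (fun k => T.piecewise v y (j k)) = fun k => y (j k) :=
    funext fun k => Finset.piecewise_eq_of_notMem _ _ _ (by simpa [hT] using fun b hb => ha b hb k)
  have hiT (v y : ι → 𝒴) : (fun k => T.piecewise v y (i k))
      = Function.update (fun k => v (i k)) a (y (i a)) := by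
    ext k
    by_cases hk : k = a <;> simp [Finset.piecewise, hT, hi.eq_iff, hk]
  rw [← integral_comp_eq_of_measurePreserving hresample hint.aestronglyMeasurable,
    integral_prod _ hint']
  refine integral_eq_zero_of_ae ?_
  filter_upwards [(measurePreserving_eval (fun _ : ι => ν) (i a)).quasiMeasurePreserving.ae
    (hdeg a)] with y hy
  simp only [hiT, hjT]
  rw [integral_mul_const, integral_comp_eq_of_measurePreserving
    (measurePreserving_comp_of_injective ν hi) (g := fun v => R (Function.update v a (y (i a))))
    (hRm.comp measurable_update_left).aestronglyMeasurable]
  exact mul_eq_zero_of_left hy _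

lemma integral_mul_eq_zero_of_not_overlap [Nonempty κ] (hR : MemLp R 2 (Measure.pi fun _ => ν))
    (hRm : Measurable R) (hdeg : IsDegenerate ν R) {i j : κ → ι} (hi : i.Injective)
    (hj : j.Injective) (hij : ¬ Overlap i j) :
    ∫ y, R (fun k => y (i k)) * R (fun k => y (j k)) ∂(Measure.pi fun _ : ι => ν) = 0 := by
  by_cases! hmeet : ∃ a b, i a = j b
  · obtain ⟨a, b, hab⟩ := hmeet
    refine integral_mul_eq_zero_of_isDegenerate hR hRm hdeg hi hj a fun a' ha' b' hab' =>
      hij ⟨a', a, b', b, ha', ?_, hab', hab⟩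
    rintro rfl
    exact ha' (hi (hab'.trans hab.symm))
  · exact integral_mul_eq_zero_of_isDegenerate hR hRm hdeg hi hj (Classical.arbitrary κ)
      fun b _ c => hmeet b c

open Classical in
lemma integral_sum_sq_le_sum_overlap [Nonempty κ] (hR : MemLp R 2 (Measure.pi fun _ => ν))
    (hRm : Measurable R) (hdeg : IsDegenerate ν R) {S : Finset (κ → ι)}
    (hS : ∀ i ∈ S, i.Injective) :
    ∫ y, (∑ i ∈ S, R (fun k => y (i k))) ^ 2 ∂(Measure.pi fun _ : ι => ν)
      ≤ ∑ i ∈ S, ∑ j ∈ S, if Overlap i j then ∫ v, R v ^ 2 ∂(Measure.pi fun _ => ν) else 0 := by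
  have hint : ∀ i ∈ S, ∀ j ∈ S, Integrable (fun y : ι → 𝒴 =>
      R (fun k => y (i k)) * R (fun k => y (j k))) (Measure.pi fun _ => ν) := fun i hi j hj =>
    (hR.comp_measurePreserving (measurePreserving_comp_of_injective ν (hS i hi))).integrable_mul
      (hR.comp_measurePreserving (measurePreserving_comp_of_injective ν (hS j hj)))
  simp_rw [sq, Finset.sum_mul_sum, ← sq]
  rw [integral_finsetSum _ fun i hi => integrable_finsetSum _ fun j hj => hint i hi j hj]
  refine Finset.sum_le_sum fun i hi => ?_
  rw [integral_finsetSum _ fun j hj => hint i hi j hj]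
  refine Finset.sum_le_sum fun j hj => ?_
  split_ifs with hij
  · exact integral_mul_comp_le hR (hS i hi) (hS j hj)
  · exact (integral_mul_eq_zero_of_not_overlap hR hRm hdeg (hS i hi) (hS j hj) hij).le

lemma integral_sum_sq_mul_sq_le [Nonempty κ] (hR : MemLp R 2 (Measure.pi fun _ => ν))
    (hRm : Measurable R) (hdeg : IsDegenerate ν R) {S : Finset (κ → ι)}
    (hS : ∀ i ∈ S, i.Injective) :
    (∫ y, (∑ i ∈ S, R (fun k => y (i k))) ^ 2 ∂(Measure.pi fun _ : ι => ν)) * Fintype.card ι ^ 2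
      ≤ S.card * (Fintype.card κ ^ 4 * Fintype.card ι ^ Fintype.card κ)
        * ∫ v, R v ^ 2 ∂(Measure.pi fun _ => ν) := by
  classical
  set E := ∫ v, R v ^ 2 ∂(Measure.pi fun _ : κ => ν)
  have hE : 0 ≤ E := integral_nonneg fun _ => sq_nonneg _
  have hcount (i : κ → ι) : (∑ j ∈ S, if Overlap i j then E else 0) * (Fintype.card ι : ℝ) ^ 2
      ≤ Fintype.card κ ^ 4 * Fintype.card ι ^ Fintype.card κ * E := by
    rw [← Finset.sum_filter, Finset.sum_const, nsmul_eq_mul, mul_right_comm]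
    refine mul_le_mul_of_nonneg_right ?_ hE
    exact_mod_cast (Nat.mul_le_mul_right _ (Finset.card_le_card (Finset.filter_subset_filter
      (Overlap i) S.subset_univ))).trans (card_overlap_mul_sq_le i)
  calc _ ≤ (∑ i ∈ S, ∑ j ∈ S, if Overlap i j then E else 0) * (Fintype.card ι : ℝ) ^ 2 := by
        gcongr
        exact integral_sum_sq_le_sum_overlap hR hRm hdeg hS
    _ ≤ ∑ i ∈ S, Fintype.card κ ^ 4 * Fintype.card ι ^ Fintype.card κ * E := by
        rw [Finset.sum_mul]
        exact Finset.sum_le_sum fun i _ => hcount i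
    _ = _ := by
        rw [Finset.sum_const, nsmul_eq_mul]
        ring

end Degenerate

/-! ### Increasing tuples -/

section IncreasingTuples

lemma card_filter_mem_powersetCard_mul_card {α : Type*} [DecidableEq α] {s : Finset α} {a : α}
    (ha : a ∈ s) (r : ℕ) :
    ((s.powersetCard r).filter fun t => a ∈ t).card * s.card = r * s.card.choose r := by
  cases r with
  | zero => simp [Finset.filter_singleton]
  | succ r =>
    obtain ⟨m, hm⟩ := Nat.exists_eq_add_one_of_ne_zero (Finset.card_ne_zero_of_mem ha)
    have h := Finset.card_filter_powersetCard_subset {a} s (r + 1)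
      (Finset.singleton_subset_iff.2 ha) (by simp)
    simp only [Finset.singleton_subset_iff, Finset.card_singleton, hm, Nat.add_sub_cancel] at h
    rw [h, hm, mul_comm, Nat.add_one_mul_choose_eq, mul_comm]

lemma sum_powersetCard_sum_mul_card {α : Type*} (s : Finset α) (r : ℕ)
    (g : α → ℝ) :
    (∑ t ∈ s.powersetCard r, ∑ a ∈ t, g a) * s.card = r * s.card.choose r * ∑ a ∈ s, g a := by
  classical
  have hswap : ∑ t ∈ s.powersetCard r, ∑ a ∈ t, g a
      = ∑ a ∈ s, ∑ _t ∈ (s.powersetCard r).filter fun t => a ∈ t, g a :=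
    Finset.sum_comm' fun t a => by
      simp only [Finset.mem_filter, Finset.mem_powersetCard]
      exact ⟨fun ⟨⟨hts, hcard⟩, hat⟩ => ⟨⟨⟨hts, hcard⟩, hat⟩, hts hat⟩, fun h => h.1⟩
  rw [hswap, Finset.sum_mul, Finset.mul_sum]
  refine Finset.sum_congr rfl fun a ha => ?_
  have hcard : (((s.powersetCard r).filter fun t => a ∈ t).card : ℝ) * s.card
      = r * s.card.choose r := mod_cast card_filter_mem_powersetCard_mul_card ha r
  rw [Finset.sum_const, nsmul_eq_mul]
  linear_combination g a * hcard

lemma pow_le_pow_mul_factorial_mul_choose {r n : ℕ} (h : r ≤ n) :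
    (n : ℝ) ^ r ≤ (r ^ r * r.factorial : ℕ) * n.choose r := by
  rcases Nat.eq_zero_or_pos r with rfl | hr
  · simp
  have hn : n ≤ r * (n + 1 - r) := by
    obtain ⟨d, rfl⟩ := Nat.exists_eq_add_of_le h
    rw [show r + d + 1 - r = d + 1 by lia]
    nlinarith
  have hchoose : ((n + 1 - r : ℕ) ^ r : ℝ) ≤ r.factorial * n.choose r := by
    have := Nat.pow_le_choose (α := ℝ) r n
    rw [div_le_iff₀ (by positivity)] at this
    linarith
  calc (n : ℝ) ^ r ≤ ((r * (n + 1 - r) : ℕ) : ℝ) ^ r := by gcongr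
    _ = r ^ r * ((n + 1 - r : ℕ) ^ r : ℝ) := by rw [Nat.cast_mul, mul_pow]
    _ ≤ r ^ r * (r.factorial * n.choose r) := by gcongr
    _ = _ := by push_cast; ring

variable {r n : ℕ}

open Classical in
/-- The increasing tuples of indices, over which the U-statistic averages. -/
def incTuples (r n : ℕ) : Finset (Fin r → Fin n) :=
  Finset.univ.filter StrictMono

lemma mem_incTuples {i : Fin r → Fin n} : i ∈ incTuples r n ↔ StrictMono i := by
  simp [incTuples]

lemma injective_of_mem_incTuples {i : Fin r → Fin n} (hi : i ∈ incTuples r n) : i.Injective :=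
  (mem_incTuples.1 hi).injective

lemma sum_incTuples_image (G : Finset (Fin n) → ℝ) :
    ∑ i ∈ incTuples r n, G (Finset.univ.image i) = ∑ s ∈ Finset.univ.powersetCard r, G s := by
  refine Finset.sum_bij' (fun i _ => Finset.univ.image i)
    (fun s hs => s.orderEmbOfFin (Finset.mem_powersetCard.1 hs).2) ?_ ?_ ?_ ?_ fun _ _ => rfl
  · intro i hi
    rw [Finset.mem_powersetCard, Finset.card_image_of_injective _ (injective_of_mem_incTuples hi),
      Finset.card_univ, Fintype.card_fin]
    exact ⟨Finset.subset_univ _, rfl⟩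
  · intro s _
    exact mem_incTuples.2 (s.orderEmbOfFin _).strictMono
  · intro i hi
    exact (Finset.orderEmbOfFin_unique _ (fun x => Finset.mem_image_of_mem _ (Finset.mem_univ x))
      (mem_incTuples.1 hi)).symm
  · intro s _
    exact Finset.image_orderEmbOfFin_univ _ _

lemma card_incTuples : ((incTuples r n).card : ℝ) = n.choose r := by
  simpa using sum_incTuples_image (r := r) (n := n) fun _ => 1

lemma sum_incTuples_sum_mul (g : Fin n → ℝ) :
    (∑ i ∈ incTuples r n, ∑ k, g (i k)) * n = r * n.choose r * ∑ l, g l := by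
  have himage : ∑ i ∈ incTuples r n, ∑ k, g (i k)
      = ∑ i ∈ incTuples r n, ∑ l ∈ Finset.univ.image i, g l :=
    Finset.sum_congr rfl fun i hi => by
      rw [Finset.sum_image (injective_of_mem_incTuples hi).injOn]
  rw [himage, sum_incTuples_image fun s => ∑ l ∈ s, g l]
  simpa using sum_powersetCard_sum_mul_card Finset.univ r g

lemma card_filter_incTuples_exists_eq_mul_le (l : Fin n) :
    ((incTuples r n).filter fun i => ∃ k, i k = l).card * n ≤ r * n ^ r := by
  calc _ ≤ (Finset.univ.filter fun i : Fin r → Fin n => ∃ k, i k = l).card * n :=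
        Nat.mul_le_mul_right _
          (Finset.card_le_card (Finset.filter_subset_filter _ (Finset.subset_univ _)))
    _ ≤ r * n ^ r := by
        convert card_filter_exists_eq_mul_le (κ := Fin r) l <;> simp

end IncreasingTuples

/-! ### Hoeffding decomposition -/

section Fibers

variable {α β : Type*} [MeasurableSpace α] [MeasurableSpace β] {μ : Measure α} {ν : Measure β}
  [IsProbabilityMeasure μ] [IsProbabilityMeasure ν] {F : α × β → ℝ}

lemma ae_sq_integral_prod_left_le (hF : MemLp F 2 (μ.prod ν)) :
    ∀ᵐ y ∂ν, (∫ x, F (x, y) ∂μ) ^ 2 ≤ ∫ x, F (x, y) ^ 2 ∂μ := by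
  filter_upwards [(hF.integrable one_le_two).prod_left_ae, hF.integrable_sq.prod_left_ae]
    with y hint hsq
  rw [← sq_abs]
  exact (pow_le_pow_left₀ (abs_nonneg _) abs_integral_le_integral_abs 2).trans
    (sq_integral_abs_le ((memLp_two_iff_integrable_sq hint.aestronglyMeasurable).2 hsq))

lemma memLp_integral_prod_left (hF : MemLp F 2 (μ.prod ν)) :
    MemLp (fun y => ∫ x, F (x, y) ∂μ) 2 ν := by
  have hmeas : AEStronglyMeasurable (fun y => ∫ x, F (x, y) ∂μ) ν :=
    hF.aestronglyMeasurable.prod_swap.integral_prod_right'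
  refine (memLp_two_iff_integrable_sq hmeas).2
    (hF.integrable_sq.integral_prod_right.mono' (hmeas.pow 2) ?_)
  filter_upwards [ae_sq_integral_prod_left_le hF] with y hy
  rwa [Real.norm_eq_abs, abs_of_nonneg (sq_nonneg _)]

lemma integral_sq_integral_prod_left_le (hF : MemLp F 2 (μ.prod ν)) :
    ∫ y, (∫ x, F (x, y) ∂μ) ^ 2 ∂ν ≤ ∫ p, F p ^ 2 ∂(μ.prod ν) := by
  rw [integral_prod_symm _ hF.integrable_sq]
  exact integral_mono_ae (memLp_integral_prod_left hF).integrable_sq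
    hF.integrable_sq.integral_prod_right (ae_sq_integral_prod_left_le hF)

end Fibers

section Projection

variable {𝒳 : Type u} {𝒴 : Type v} [MeasurableSpace 𝒳] [MeasurableSpace 𝒴] {r n : ℕ}
  {ℓ : (Fin r → 𝒴) → ℝ} {P : Measure (𝒳 × 𝒴)}

instance [IsProbabilityMeasure P] : IsProbabilityMeasure (lawYs r P) := by
  unfold lawYs
  infer_instance

/-- The centered first projection `ℓ₁ - ψ`. -/
def proj1 [NeZero r] (ℓ : (Fin r → 𝒴) → ℝ) (P : Measure (𝒳 × 𝒴)) (y : 𝒴) : ℝ :=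
  ell1 ℓ P y - psi ℓ P

/-- The degenerate part of the kernel: `ℓ - ψ` minus the sum of its first projections. -/
def projRem [NeZero r] (ℓ : (Fin r → 𝒴) → ℝ) (P : Measure (𝒳 × 𝒴)) (v : Fin r → 𝒴) : ℝ :=
  ℓ v - psi ℓ P - ∑ k, proj1 ℓ P (v k)

lemma sigmaL_sq (hℓ : Measurable ℓ) :
    sigmaL ℓ P ^ 2 = ∫ v, (ℓ v - psi ℓ P) ^ 2 ∂(lawYs r P) := by
  rw [sigmaL, Real.sq_sqrt (variance_nonneg _ _), variance_eq_integral hℓ.aemeasurable, psi]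

lemma ae_integrable_update [IsProbabilityMeasure P] (hL : MemLp ℓ 2 (lawYs r P)) (a : Fin r) :
    ∀ᵐ y ∂P.snd, Integrable (fun v => ℓ (Function.update v a y)) (lawYs r P) :=
  ((measurePreserving_update (fun _ => P.snd) a).integrable_comp_of_integrable
    (hL.integrable one_le_two)).prod_left_ae

variable [NeZero r]

lemma uStat_sub_psi (hn : r ≤ n) (y : Fin n → 𝒴) :
    uStat ℓ y - psi ℓ P = (r : ℝ) / n * ∑ l, proj1 ℓ P (y l)
      + (n.choose r : ℝ)⁻¹ * ∑ i ∈ incTuples r n, projRem ℓ P (fun k => y (i k)) := by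
  have hchoose : (n.choose r : ℝ) ≠ 0 := mod_cast (Nat.choose_pos hn).ne'
  have hn0 : (n : ℝ) ≠ 0 := mod_cast ((NeZero.pos r).trans_le hn).ne'
  have hsum := sum_incTuples_sum_mul (r := r) fun l => proj1 ℓ P (y l)
  change (n.choose r : ℝ)⁻¹ * (∑ i ∈ incTuples r n, ℓ fun k => y (i k)) - _ = _
  simp only [projRem, Finset.sum_sub_distrib, Finset.sum_const, nsmul_eq_mul, card_incTuples]
  field_simp
  linarith

lemma projRem_sq_le (v : Fin r → 𝒴) :
    projRem ℓ P v ^ 2 ≤ (r + 1) * ((ℓ v - psi ℓ P) ^ 2 + ∑ k, proj1 ℓ P (v k) ^ 2) := by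
  have h := sq_sum_le_card_mul_sum_sq (s := Finset.univ)
    (f := fun k : Option (Fin r) => k.elim (ℓ v - psi ℓ P) fun k => -proj1 ℓ P (v k))
  simp only [Fintype.sum_option, Option.elim, Finset.sum_neg_distrib, neg_sq, Finset.card_univ,
    Fintype.card_option, Fintype.card_fin, Nat.cast_add, Nat.cast_one] at h
  simpa only [projRem, sub_eq_add_neg] using h

variable [IsProbabilityMeasure P]

lemma measurable_ell1 (hℓ : Measurable ℓ) : Measurable (ell1 ℓ P) := by
  have h : StronglyMeasurable fun p : 𝒴 × (Fin r → 𝒴) => ℓ (Function.update p.2 0 p.1) :=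
    (hℓ.comp (measurable_update'.comp measurable_swap)).stronglyMeasurable
  exact h.integral_prod_right.measurable

lemma measurable_proj1 (hℓ : Measurable ℓ) : Measurable (proj1 ℓ P) :=
  (measurable_ell1 hℓ).sub_const _

lemma measurable_projRem (hℓ : Measurable ℓ) : Measurable (projRem ℓ P) :=
  (hℓ.sub_const _).sub (Finset.measurable_sum _ fun k _ =>
    (measurable_proj1 hℓ).comp (measurable_pi_apply k))

lemma integral_update_eq_ell1 (hℓ : Measurable ℓ) (hsym : SymmetricKernel ℓ) (a : Fin r) (y : 𝒴) :
    ∫ v, ℓ (Function.update v a y) ∂(lawYs r P) = ell1 ℓ P y := by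
  have hswap : ∀ v : Fin r → 𝒴, ℓ (Function.update v a y)
      = ℓ (Function.update (fun k => v (Equiv.swap 0 a k)) 0 y) := by
    intro v
    rw [← hsym (Equiv.swap 0 a)]
    congr 1
    ext k
    by_cases hk : k = 0
    · subst hk
      simp
    · rw [Function.update_of_ne hk, Function.update_of_ne]
      rwa [Ne, Equiv.swap_apply_eq_iff, Equiv.swap_apply_right]
  simp_rw [hswap]
  exact integral_comp_eq_of_measurePreserving
    (measurePreserving_comp_of_injective P.snd (Equiv.swap 0 a).injective)
    (g := fun v => ℓ (Function.update v 0 y)) (hℓ.comp measurable_update_left).aestronglyMeasurable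

section

variable (hL : MemLp ℓ 2 (lawYs r P))
include hL

lemma integral_ell1 : ∫ y, ell1 ℓ P y ∂P.snd = psi ℓ P := by
  have hpres := measurePreserving_update (fun _ => P.snd) (0 : Fin r)
  have hint := hL.integrable one_le_two
  exact (integral_prod_symm _ (hpres.integrable_comp_of_integrable hint)).symm.trans
    (integral_comp_eq_of_measurePreserving hpres hint.aestronglyMeasurable)

lemma memLp_sub_psi_update :
    MemLp (fun p : (Fin r → 𝒴) × 𝒴 => ℓ (Function.update p.1 0 p.2) - psi ℓ P) 2
      ((lawYs r P).prod P.snd) :=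
  (hL.sub (memLp_const _)).comp_measurePreserving (measurePreserving_update (fun _ => P.snd) 0)

lemma proj1_ae_eq :
    proj1 ℓ P =ᵐ[P.snd]
      fun y => ∫ v, (ℓ (Function.update v 0 y) - psi ℓ P) ∂(lawYs r P) := by
  filter_upwards [ae_integrable_update hL 0] with y hy
  rw [integral_sub hy (integrable_const _)]
  simp [proj1, ell1]

lemma memLp_proj1 : MemLp (proj1 ℓ P) 2 P.snd :=
  (memLp_integral_prod_left (memLp_sub_psi_update hL)).ae_eq (proj1_ae_eq hL).symm

lemma memLp_proj1_comp (k : Fin r) :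
    MemLp (fun v : Fin r → 𝒴 => proj1 ℓ P (v k)) 2 (lawYs r P) :=
  (memLp_proj1 hL).comp_measurePreserving (measurePreserving_eval (fun _ => P.snd) k)

lemma memLp_projRem : MemLp (projRem ℓ P) 2 (lawYs r P) :=
  (hL.sub (memLp_const _)).sub (memLp_finsetSum _ fun k _ => memLp_proj1_comp hL k)

lemma memLp_ell1 : MemLp (ell1 ℓ P) 2 P.snd := by
  have h : MemLp (fun y => proj1 ℓ P y + psi ℓ P) 2 P.snd := (memLp_proj1 hL).add (memLp_const _)
  simpa only [proj1, sub_add_cancel] using h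

lemma integral_proj1 : ∫ y, proj1 ℓ P y ∂P.snd = 0 := by
  simp only [proj1]
  rw [integral_sub ((memLp_ell1 hL).integrable one_le_two) (integrable_const _), integral_ell1 hL]
  simp

end

lemma integral_proj1_sq_le (hℓ : Measurable ℓ) (hL : MemLp ℓ 2 (lawYs r P)) :
    ∫ y, proj1 ℓ P y ^ 2 ∂P.snd ≤ sigmaL ℓ P ^ 2 := by
  calc ∫ y, proj1 ℓ P y ^ 2 ∂P.snd
      = ∫ y, (∫ v, (ℓ (Function.update v 0 y) - psi ℓ P) ∂(lawYs r P)) ^ 2 ∂P.snd :=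
        integral_congr_ae ((proj1_ae_eq hL).pow_const 2)
    _ ≤ ∫ p : (Fin r → 𝒴) × 𝒴, (ℓ (Function.update p.1 0 p.2) - psi ℓ P) ^ 2
          ∂((lawYs r P).prod P.snd) :=
        integral_sq_integral_prod_left_le (memLp_sub_psi_update hL)
    _ = ∫ v, (ℓ v - psi ℓ P) ^ 2 ∂(lawYs r P) :=
        integral_comp_eq_of_measurePreserving (measurePreserving_update (fun _ => P.snd) 0)
          (g := fun v => (ℓ v - psi ℓ P) ^ 2)
          ((hℓ.sub_const _).pow_const 2).aestronglyMeasurable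
    _ = sigmaL ℓ P ^ 2 := (sigmaL_sq hℓ).symm

lemma integrable_proj1_update (hL : MemLp ℓ 2 (lawYs r P)) (a k : Fin r) (y : 𝒴) :
    Integrable (fun v : Fin r → 𝒴 => proj1 ℓ P (Function.update v a y k)) (lawYs r P) := by
  by_cases hk : k = a
  · subst hk
    simp
  · simpa only [Function.update_of_ne hk] using (memLp_proj1_comp hL k).integrable one_le_two

lemma integral_proj1_update (hℓ : Measurable ℓ) (hL : MemLp ℓ 2 (lawYs r P)) (a k : Fin r)
    (y : 𝒴) :
    ∫ v, proj1 ℓ P (Function.update v a y k) ∂(lawYs r P) = if k = a then proj1 ℓ P y else 0 := by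
  by_cases hk : k = a
  · subst hk
    simp
  · simp only [Function.update_of_ne hk, if_neg hk]
    rw [← integral_proj1 hL]
    exact integral_comp_eq_of_measurePreserving (measurePreserving_eval (fun _ => P.snd) k)
      (measurable_proj1 hℓ).aestronglyMeasurable

lemma isDegenerate_projRem (hℓ : Measurable ℓ) (hsym : SymmetricKernel ℓ)
    (hL : MemLp ℓ 2 (lawYs r P)) : IsDegenerate P.snd (projRem ℓ P) := by
  intro a
  filter_upwards [ae_integrable_update hL a] with y hy
  change ∫ v, projRem ℓ P (Function.update v a y) ∂(lawYs r P) = 0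
  simp only [projRem]
  have hcentered : Integrable (fun v => ℓ (Function.update v a y) - psi ℓ P) (lawYs r P) :=
    hy.sub (integrable_const _)
  have hproj := fun k (_ : k ∈ Finset.univ) => integrable_proj1_update hL a k y
  rw [integral_sub hcentered (integrable_finsetSum _ hproj), integral_sub hy (integrable_const _),
    integral_finsetSum _ hproj, integral_update_eq_ell1 hℓ hsym]
  simp only [integral_proj1_update hℓ hL]
  simp [proj1]

lemma integral_projRem_sq_le (hℓ : Measurable ℓ) (hL : MemLp ℓ 2 (lawYs r P)) :
    ∫ v, projRem ℓ P v ^ 2 ∂(lawYs r P) ≤ (r + 1) ^ 2 * sigmaL ℓ P ^ 2 := by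
  have hcentered : Integrable (fun v => (ℓ v - psi ℓ P) ^ 2) (lawYs r P) :=
    (hL.sub (memLp_const _)).integrable_sq
  have hproj : ∀ k ∈ Finset.univ,
      Integrable (fun v : Fin r → 𝒴 => proj1 ℓ P (v k) ^ 2) (lawYs r P) :=
    fun k _ => (memLp_proj1_comp hL k).integrable_sq
  have hproj_le : ∀ k ∈ Finset.univ,
      ∫ v : Fin r → 𝒴, proj1 ℓ P (v k) ^ 2 ∂(lawYs r P) ≤ sigmaL ℓ P ^ 2 := fun k _ =>
    (integral_comp_eq_of_measurePreserving (measurePreserving_eval (fun _ => P.snd) k)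
      (g := fun y => proj1 ℓ P y ^ 2)
      ((measurable_proj1 hℓ).pow_const 2).aestronglyMeasurable).trans_le
      (integral_proj1_sq_le hℓ hL)
  have hsum := integrable_finsetSum _ hproj
  calc ∫ v, projRem ℓ P v ^ 2 ∂(lawYs r P)
      ≤ ∫ v, (r + 1) * ((ℓ v - psi ℓ P) ^ 2 + ∑ k, proj1 ℓ P (v k) ^ 2) ∂(lawYs r P) :=
        integral_mono (memLp_projRem hL).integrable_sq ((hcentered.add hsum).const_mul _)
          projRem_sq_le
    _ = (r + 1) * (sigmaL ℓ P ^ 2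
          + ∑ k, ∫ v : Fin r → 𝒴, proj1 ℓ P (v k) ^ 2 ∂(lawYs r P)) := by
        rw [integral_const_mul, integral_add hcentered hsum, integral_finsetSum _ hproj,
          sigmaL_sq hℓ]
    _ ≤ (r + 1) * (sigmaL ℓ P ^ 2 + ∑ _k : Fin r, sigmaL ℓ P ^ 2) := by
        gcongr with k hk
        exact hproj_le k hk
    _ = (r + 1) ^ 2 * sigmaL ℓ P ^ 2 := by
        rw [Finset.sum_const, Finset.card_univ, Fintype.card_fin, nsmul_eq_mul]
        ring

end Projection

section Remainder

variable {𝒳 : Type u} {𝒴 : Type v} [MeasurableSpace 𝒳] [MeasurableSpace 𝒴] {r n : ℕ} [NeZero r]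
  {ℓ : (Fin r → 𝒴) → ℝ} {P : Measure (𝒳 × 𝒴)}

/-- The contribution of the tuples in `S` to the remainder of the Hoeffding decomposition
`uStat_sub_psi`. -/
def uRem (ℓ : (Fin r → 𝒴) → ℝ) (P : Measure (𝒳 × 𝒴)) (S : Finset (Fin r → Fin n))
    (y : Fin n → 𝒴) : ℝ :=
  (n.choose r : ℝ)⁻¹ * ∑ i ∈ S, projRem ℓ P (fun k => y (i k))

/-- The increasing tuples that avoid the index `l`. -/
def incTuplesOff (r : ℕ) (l : Fin n) : Finset (Fin r → Fin n) :=
  (incTuples r n).filter fun i => ¬ ∃ k, i k = l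

/-- The constant in the bounds on the remainder of the Hoeffding decomposition: the first factor
comes from `n ^ r ≤ r ^ r * r! * n.choose r`, the square of the second bounds the counts of tuples
overlapping a given one (`r ^ 4`) and of tuples through an index (`r`) and the variance of the
degenerate kernel (`(r + 1) ^ 2`). -/
def remConst (r : ℕ) : ℝ := (r ^ r * r.factorial : ℕ) * (r ^ 3 * (r + 1))

lemma remConst_nonneg (r : ℕ) : 0 ≤ remConst r := by
  unfold remConst
  positivity

lemma uRem_sub_uRem_filter_not (S : Finset (Fin r → Fin n)) (p : (Fin r → Fin n) → Prop)
    [DecidablePred p] (y : Fin n → 𝒴) :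
    uRem ℓ P S y - uRem ℓ P (S.filter fun i => ¬ p i) y = uRem ℓ P (S.filter p) y := by
  simp only [uRem]
  rw [← Finset.sum_filter_add_sum_filter_not S p]
  ring

variable [IsProbabilityMeasure P]

lemma measurable_uRem (hℓ : Measurable ℓ) (S : Finset (Fin r → Fin n)) :
    Measurable (uRem ℓ P S) :=
  (Finset.measurable_sum _ fun i _ => (measurable_projRem hℓ).comp
    (measurable_pi_lambda _ fun k => measurable_pi_apply (i k))).const_mul _

lemma memLp_uRem (hL : MemLp ℓ 2 (lawYs r P)) {S : Finset (Fin r → Fin n)}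
    (hS : ∀ i ∈ S, i.Injective) : MemLp (uRem ℓ P S) 2 (Measure.pi fun _ => P.snd) :=
  (memLp_finsetSum _ fun i hi => (memLp_projRem hL).comp_measurePreserving
    (measurePreserving_comp_of_injective P.snd (hS i hi))).const_mul _

variable (hℓ : Measurable ℓ) (hsym : SymmetricKernel ℓ) (hL : MemLp ℓ 2 (lawYs r P))
include hℓ hsym hL

lemma integral_uRem_sq_mul_le {S : Finset (Fin r → Fin n)} (hS : ∀ i ∈ S, i.Injective)
    (hn : r ≤ n) :
    (∫ y, uRem ℓ P S y ^ 2 ∂(Measure.pi fun _ => P.snd)) * (n.choose r : ℝ) ^ 2 * n ^ 2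
      ≤ S.card * (r ^ 4 * n ^ r) * ((r + 1) ^ 2 * sigmaL ℓ P ^ 2) := by
  have hchoose : (n.choose r : ℝ) ≠ 0 := mod_cast (Nat.choose_pos hn).ne'
  have hsum := integral_sum_sq_mul_sq_le (memLp_projRem hL) (measurable_projRem hℓ)
    (isDegenerate_projRem hℓ hsym hL) hS
  simp only [Fintype.card_fin] at hsum
  have hscale : (∫ y, uRem ℓ P S y ^ 2 ∂(Measure.pi fun _ => P.snd)) * (n.choose r : ℝ) ^ 2
      = ∫ y, (∑ i ∈ S, projRem ℓ P (fun k => y (i k))) ^ 2 ∂(Measure.pi fun _ => P.snd) := by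
    simp only [uRem, mul_pow]
    rw [integral_const_mul]
    field_simp
  rw [hscale]
  exact hsum.trans
    (mul_le_mul_of_nonneg_left (integral_projRem_sq_le hℓ hL) (by positivity))

lemma integral_uRem_sq_le_of_card_le {S : Finset (Fin r → Fin n)} (hS : ∀ i ∈ S, i.Injective)
    (hn : r ≤ n) {a : ℝ} (ha : 0 ≤ a) (hcard : S.card ≤ a * r * n ^ r) :
    ∫ y, uRem ℓ P S y ^ 2 ∂(Measure.pi fun _ => P.snd)
      ≤ a * (remConst r * sigmaL ℓ P / n) ^ 2 := by
  have hr : (1 : ℝ) ≤ r := mod_cast NeZero.one_le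
  have hn0 : (0 : ℝ) < n := mod_cast (NeZero.pos r).trans_le hn
  have hC : (0 : ℝ) < n.choose r := mod_cast Nat.choose_pos hn
  have hpow := pow_le_pow_mul_factorial_mul_choose hn
  have hI := integral_uRem_sq_mul_le hℓ hsym hL hS hn
  have hK : (0 : ℝ) ≤ (r ^ r * r.factorial : ℕ) := Nat.cast_nonneg _
  rw [remConst]
  generalize ((r ^ r * r.factorial : ℕ) : ℝ) = K at hpow hK ⊢
  generalize (n.choose r : ℝ) = C at hC hpow hI
  generalize ∫ y, uRem ℓ P S y ^ 2 ∂(Measure.pi fun _ => P.snd) = I at hI ⊢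
  have hscaled : I * n ^ 2 * C ^ 2
      ≤ a * (K * (r ^ 3 * (r + 1)) * sigmaL ℓ P) ^ 2 * C ^ 2 := by
    calc I * n ^ 2 * C ^ 2 = I * C ^ 2 * n ^ 2 := by ring
      _ ≤ S.card * (r ^ 4 * n ^ r) * ((r + 1) ^ 2 * sigmaL ℓ P ^ 2) := hI
      _ ≤ a * r * (K * C) * (r ^ 4 * (K * C)) * ((r + 1) ^ 2 * sigmaL ℓ P ^ 2) := by
        gcongr
        exact hcard.trans (by gcongr)
      _ = a * K ^ 2 * r ^ 5 * ((r + 1) ^ 2 * sigmaL ℓ P ^ 2) * C ^ 2 := by ring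
      _ ≤ a * K ^ 2 * r ^ 6 * ((r + 1) ^ 2 * sigmaL ℓ P ^ 2) * C ^ 2 := by
        gcongr
        norm_num
      _ = _ := by ring
  rw [div_pow, mul_div_assoc', le_div_iff₀ (by positivity)]
  exact le_of_mul_le_mul_right hscaled (by positivity)

lemma integral_uRem_sq_le (hn : r ≤ n) :
    ∫ y, uRem ℓ P (incTuples r n) y ^ 2 ∂(Measure.pi fun _ => P.snd)
      ≤ (remConst r * sigmaL ℓ P / n) ^ 2 := by
  rw [← one_mul ((_ / _ : ℝ) ^ 2)]
  refine integral_uRem_sq_le_of_card_le hℓ hsym hL (fun i => injective_of_mem_incTuples) hn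
    zero_le_one ?_
  have hcard : (incTuples r n).card ≤ n ^ r :=
    (Finset.card_le_univ _).trans_eq (by simp)
  have : 1 * n ^ r ≤ r * n ^ r := Nat.mul_le_mul_right _ NeZero.one_le
  rw [one_mul]
  exact_mod_cast hcard.trans (one_mul (n ^ r) ▸ this)

lemma integral_uRem_sub_sq_le (hn : r ≤ n) (l : Fin n) :
    ∫ y, (uRem ℓ P (incTuples r n) y - uRem ℓ P (incTuplesOff r l) y) ^ 2
        ∂(Measure.pi fun _ => P.snd)
      ≤ (n : ℝ)⁻¹ * (remConst r * sigmaL ℓ P / n) ^ 2 := by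
  simp_rw [incTuplesOff, uRem_sub_uRem_filter_not]
  refine integral_uRem_sq_le_of_card_le hℓ hsym hL
    (fun i hi => injective_of_mem_incTuples (Finset.mem_of_mem_filter i hi)) hn
    (by positivity) ?_
  have hn0 : (0 : ℝ) < n := mod_cast l.pos
  rw [mul_assoc, inv_mul_eq_div, le_div_iff₀ hn0]
  exact_mod_cast card_filter_incTuples_exists_eq_mul_le l

end Remainder

/-! ### The asymptotic variance -/

section Conditioning

variable {Ω : Type*} {m₀ m : MeasurableSpace Ω} {μ : Measure[m₀] Ω} [IsProbabilityMeasure μ]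
  {X G : Ω → ℝ}

lemma integral_condVar_le_variance_sub (hm : m ≤ m₀) (hX : MemLp X 2 μ) (hG : MemLp G 2 μ)
    (hGm : StronglyMeasurable[m] G) : ∫ ω, (Var[X; μ | m]) ω ∂μ ≤ Var[X - G; μ] := by
  have hGint := hG.integrable one_le_two
  have hcond := condExp_sub (hX.integrable one_le_two) hGint m
  rw [condExp_of_stronglyMeasurable hm hGm hGint] at hcond
  have hcondVar : Var[X - G; μ | m] =ᵐ[μ] Var[X; μ | m] := by
    refine condExp_congr_ae ?_
    filter_upwards [hcond] with ω hω
    simp only [Pi.pow_apply, Pi.sub_apply, hω]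
    ring
  rw [← integral_congr_ae hcondVar, ← integral_condVar_add_variance_condExp hm (hX.sub hG)]
  exact le_add_of_nonneg_right (variance_nonneg _ _)

lemma covariance_condExp_right (hm : m ≤ m₀) (hX : MemLp X 2 μ) (hG : MemLp G 2 μ)
    (hGm : StronglyMeasurable[m] G) : cov[G, μ[X | m]; μ] = cov[G, X; μ] := by
  have hmul : μ[G * X | m] =ᵐ[μ] G * μ[X | m] :=
    condExp_mul_of_stronglyMeasurable_left hGm (hG.integrable_mul hX) (hX.integrable one_le_two)
  rw [covariance_eq_sub hG hX, covariance_eq_sub hG (hX.condExp one_le_two),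
    integral_condExp hm, ← integral_condExp hm (f := G * X), integral_congr_ae hmul]

end Conditioning

/-- The proportion of unlabeled observations in the pooled sample. -/
def unlabeledFraction (n m : ℕ) : ℝ := m / (n + m)

lemma unlabeledFraction_nonneg (n m : ℕ) : 0 ≤ unlabeledFraction n m := by
  unfold unlabeledFraction
  positivity

lemma unlabeledFraction_le_one (n m : ℕ) : unlabeledFraction n m ≤ 1 :=
  div_le_one_of_le₀ (le_add_of_nonneg_left n.cast_nonneg) (by positivity)

lemma abs_sub_unlabeledFraction_mul_le (n m : ℕ) (x y : ℝ) :
    |x - unlabeledFraction n m * y| ≤ |x| + |y| := by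
  refine (abs_sub _ _).trans (add_le_add_right ?_ _)
  rw [abs_mul, abs_of_nonneg (unlabeledFraction_nonneg n m)]
  exact mul_le_of_le_one_left (abs_nonneg _) (unlabeledFraction_le_one n m)

section AsymptoticVariance

variable {𝒳 : Type u} {𝒴 : Type v} [MeasurableSpace 𝒳] {f : 𝒳 → ℝ}

lemma stronglyMeasurable_sigmaX (hf : Measurable f) :
    StronglyMeasurable[sigmaX 𝒳 𝒴] fun p : 𝒳 × 𝒴 => f p.1 :=
  (hf.comp (comap_measurable Prod.fst)).stronglyMeasurable

variable [MeasurableSpace 𝒴] {P : Measure (𝒳 × 𝒴)} {r n m : ℕ} {ℓ : (Fin r → 𝒴) → ℝ}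

lemma measurePreserving_fst_marginal : MeasurePreserving Prod.fst P P.fst :=
  ⟨measurable_fst, rfl⟩

lemma measurePreserving_snd_marginal : MeasurePreserving Prod.snd P P.snd :=
  ⟨measurable_snd, rfl⟩

variable [NeZero r] [IsProbabilityMeasure P] (hL : MemLp ℓ 2 (lawYs r P)) (hf : Measurable f)
  (hfL : MemLp f 2 P.fst)
include hL

lemma memLp_ell1_snd : MemLp (fun p : 𝒳 × 𝒴 => ell1 ℓ P p.2) 2 P :=
  (memLp_ell1 hL).comp_measurePreserving measurePreserving_snd_marginal

include hf hfL

/-- Completing the square in the definition of `Λ`. -/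
lemma Lam_eq_variance_sub_add : Lam n m ℓ P f = (r : ℝ) ^ 2 *
    (Var[fun p : 𝒳 × 𝒴 => ell1 ℓ P p.2 - unlabeledFraction n m * f p.1; P]
      + unlabeledFraction n m * (1 - unlabeledFraction n m) * Var[fun p : 𝒳 × 𝒴 => f p.1; P]) := by
  have hell := memLp_ell1_snd hL
  have hfst : MemLp (fun p : 𝒳 × 𝒴 => f p.1) 2 P :=
    hfL.comp_measurePreserving measurePreserving_fst_marginal
  rw [variance_fun_sub hell (hfst.const_mul _), variance_const_mul, covariance_const_mul_right,
    covariance_comm, Lam, psi1X,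
    covariance_condExp_right measurable_fst.comap_le hell hfst (stronglyMeasurable_sigmaX hf),
    unlabeledFraction]
  ring

/-- Subtracting a function of `X` from `ℓ₁(Y)` does not change its conditional variance given
`X`. -/
lemma sq_mul_sigma1Sq_le_Lam : (r : ℝ) ^ 2 * sigma1Sq ℓ P ≤ Lam n m ℓ P f := by
  have hfst : MemLp (fun p : 𝒳 × 𝒴 => f p.1) 2 P :=
    hfL.comp_measurePreserving measurePreserving_fst_marginal
  have hle : sigma1Sq ℓ P
      ≤ Var[fun p : 𝒳 × 𝒴 => ell1 ℓ P p.2 - unlabeledFraction n m * f p.1; P] :=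
    integral_condVar_le_variance_sub measurable_fst.comap_le (memLp_ell1_snd hL)
      (hfst.const_mul _) ((stronglyMeasurable_sigmaX hf).const_mul _)
  have hnonneg := mul_nonneg (mul_nonneg (unlabeledFraction_nonneg n m)
    (sub_nonneg.2 (unlabeledFraction_le_one n m))) (variance_nonneg (fun p : 𝒳 × 𝒴 => f p.1) P)
  rw [Lam_eq_variance_sub_add hL hf hfL]
  gcongr
  linarith

end AsymptoticVariance

/-! ### Linear statistics of product measures -/

section ProductSpace

variable {ι : Type*} [Fintype ι]

lemma indepFun_eval_of_update_invariant [DecidableEq ι] {α : ι → Type*} {β : Type*}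
    [∀ i, MeasurableSpace (α i)] [MeasurableSpace β] (ν : ∀ i, Measure (α i))
    [∀ i, IsProbabilityMeasure (ν i)] (k : ι) {F : (∀ i, α i) → β} (hF : Measurable F)
    (hinv : ∀ e p, F (Function.update e k p) = F e) :
    IndepFun (fun e => e k) F (Measure.pi ν) := by
  have hupd := measurePreserving_update ν k
  have hprod : IndepFun (fun q : (∀ i, α i) × α k => q.2) (fun q => F q.1)
      ((Measure.pi ν).prod (ν k)) :=
    (indepFun_prod hF measurable_id).symm
  rw [indepFun_iff_measure_inter_preimage_eq_mul] at hprod ⊢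
  intro s t hs ht
  have hms : MeasurableSet ((fun e : ∀ i, α i => e k) ⁻¹' s) := measurable_pi_apply k hs
  rw [← hupd.measure_preimage (hms.inter (hF ht)).nullMeasurableSet,
    ← hupd.measure_preimage hms.nullMeasurableSet,
    ← hupd.measure_preimage (hF ht).nullMeasurableSet]
  simpa only [preimage_inter, preimage_preimage, Function.update_self, hinv]
    using hprod s t hs ht

variable {E : Type*} [MeasurableSpace E] {P : Measure E} [IsProbabilityMeasure P]

lemma integral_pi_eval {g : E → ℝ} (hg : AEStronglyMeasurable g P) (k : ι) :
    ∫ e : ι → E, g (e k) ∂(Measure.pi fun _ => P) = ∫ p, g p ∂P :=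
  integral_comp_eq_of_measurePreserving (measurePreserving_eval (fun _ => P) k) hg

variable {ξ : ι → E → ℝ} (hξ : ∀ k, Measurable (ξ k))
include hξ

lemma isStdFamily_pi (hL : ∀ k, MemLp (ξ k) 3 P) (hmean : ∀ k, ∫ p, ξ k p ∂P = 0)
    (hvar : ∑ k, ∫ p, ξ k p ^ 2 ∂P = 1) :
    IsStdFamily (Measure.pi fun _ : ι => P) fun k e => ξ k (e k) where
  meas k := (hξ k).comp (measurable_pi_apply k)
  indep := iIndepFun_pi (X := ξ) fun k => (hξ k).aemeasurable
  memLp k := (hL k).comp_measurePreserving (measurePreserving_eval (fun _ => P) k)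
  mean k := by rw [integral_pi_eval (hξ k).aestronglyMeasurable, hmean]
  var := by
    rw [← hvar]
    exact Finset.sum_congr rfl fun k _ =>
      integral_pi_eval (g := fun p => ξ k p ^ 2) ((hξ k).pow_const 2).aestronglyMeasurable k

lemma lyapunov_pi :
    lyapunov (Measure.pi fun _ : ι => P) (fun k e => ξ k (e k)) = ∑ k, ∫ p, |ξ k p| ^ 3 ∂P :=
  Finset.sum_congr rfl fun k _ =>
    integral_pi_eval (g := fun p => |ξ k p| ^ 3) ((hξ k).abs.pow_const 3).aestronglyMeasurable k

lemma indepFun_sumExcept_of_update_invariant [DecidableEq ι] (k : ι) {D : (ι → E) → ℝ}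
    (hD : Measurable D) (hinv : ∀ e p, D (Function.update e k p) = D e) :
    IndepFun (fun e => ξ k (e k)) (fun e => (sumExcept (fun k e => ξ k (e k)) k e, D e))
      (Measure.pi fun _ => P) := by
  have hmeas (j : ι) : Measurable fun e : ι → E => ξ j (e j) := (hξ j).comp (measurable_pi_apply j)
  have hsum : Measurable (sumExcept (fun k (e : ι → E) => ξ k (e k)) k) :=
    (Finset.measurable_sum _ fun j _ => hmeas j).sub (hmeas k)
  refine (indepFun_eval_of_update_invariant (fun _ => P) k (hsum.prodMk hD) fun e p => ?_).comp
    (hξ k) measurable_id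
  simp only [sumExcept, hinv, Prod.mk.injEq, and_true,
    ← Finset.sum_erase_eq_sub (Finset.mem_univ k)]
  exact Finset.sum_congr rfl fun j hj => by
    rw [Function.update_of_ne (Finset.ne_of_mem_erase hj)]

end ProductSpace

section LinearStatistic

variable {E : Type*} [MeasurableSpace E] {P : Measure E} {n m : ℕ} {h g : E → ℝ} {s : ℝ}

/-- The summands of the linear statistic `∑ h / (√n s) - (√n / s) (n⁻¹ ∑ g - (n + m)⁻¹ ∑' g)`,
where `∑` runs over the first `n` observations, indexed by `Sum.inl`, and `∑'` over all `n + m` of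
them, the last `m` being indexed by `Sum.inr`. -/
def summand (n m : ℕ) (h g : E → ℝ) (s : ℝ) : Fin n ⊕ Fin m → E → ℝ
  | Sum.inl _ => fun p => (h p - unlabeledFraction n m * g p) / (√n * s)
  | Sum.inr _ => fun p => √n * g p / ((n + m) * s)

lemma measurable_summand (hh : Measurable h) (hg : Measurable g) (k : Fin n ⊕ Fin m) :
    Measurable (summand n m h g s k) := by
  rcases k with _ | _
  · exact (hh.sub (hg.const_mul _)).div_const _
  · exact (hg.const_mul _).div_const _

lemma memLp_summand {p : ℝ≥0∞} (hh : MemLp h p P) (hg : MemLp g p P) (k : Fin n ⊕ Fin m) :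
    MemLp (summand n m h g s k) p P := by
  rcases k with _ | _
  · simpa only [summand, div_eq_inv_mul] using! (hh.sub (hg.const_mul _)).const_mul (√n * s)⁻¹
  · simpa only [summand, div_eq_inv_mul] using! (hg.const_mul √n).const_mul ((n + m) * s)⁻¹

lemma sqrt_integral_sub_sq_le (hh : MemLp h 2 P) (hg : MemLp g 2 P) :
    √(∫ p, (h p - unlabeledFraction n m * g p) ^ 2 ∂P)
      ≤ √(∫ p, h p ^ 2 ∂P) + √(∫ p, g p ^ 2 ∂P) := by
  have hint : Integrable (fun p => |h p| * |g p|) P := (hh.abs).integrable_mul hg.abs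
  have hsq : Integrable (fun p => h p ^ 2 + g p ^ 2) P := hh.integrable_sq.add hg.integrable_sq
  have hle : ∫ p, (h p - unlabeledFraction n m * g p) ^ 2 ∂P
      ≤ ∫ p, (h p ^ 2 + g p ^ 2 + 2 * (|h p| * |g p|)) ∂P := by
    refine integral_mono (hh.sub (hg.const_mul _)).integrable_sq (hsq.add (hint.const_mul 2))
      fun p => ?_
    calc _ ≤ (|h p| + |g p|) ^ 2 :=
          sq_le_sq' (neg_le_of_abs_le (abs_sub_unlabeledFraction_mul_le n m _ _))
            (le_of_abs_le (abs_sub_unlabeledFraction_mul_le n m _ _))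
      _ = |h p| ^ 2 + |g p| ^ 2 + 2 * (|h p| * |g p|) := by ring
      _ = _ := by rw [sq_abs, sq_abs]
  rw [integral_add hsq (hint.const_mul 2), integral_const_mul,
    integral_add hh.integrable_sq hg.integrable_sq] at hle
  have hnn (f : E → ℝ) : 0 ≤ ∫ p, f p ^ 2 ∂P := integral_nonneg fun _ => sq_nonneg _
  rw [Real.sqrt_le_left (by positivity), add_sq, Real.sq_sqrt (hnn h), Real.sq_sqrt (hnn g)]
  linarith [integral_abs_mul_abs_le_sqrt hh hg]

lemma integral_abs_sub_pow_three_le (hh : MemLp h 3 P) (hg : MemLp g 3 P) :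
    ∫ p, |h p - unlabeledFraction n m * g p| ^ 3 ∂P
      ≤ 4 * (∫ p, |h p| ^ 3 ∂P + ∫ p, |g p| ^ 3 ∂P) := by
  have hh3 := integrable_abs_pow (p := 3) hh (by norm_num)
  have hg3 := integrable_abs_pow (p := 3) hg (by norm_num)
  rw [← integral_add hh3 hg3, ← integral_const_mul]
  refine integral_mono (integrable_abs_pow (p := 3) (hh.sub (hg.const_mul _)) (by norm_num))
    ((hh3.add hg3).const_mul 4) fun p => ?_
  calc _ ≤ (|h p| + |g p|) ^ 3 :=
        pow_le_pow_left₀ (abs_nonneg _) (abs_sub_unlabeledFraction_mul_le n m _ _) 3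
    _ ≤ 2 ^ (3 - 1) * (|h p| ^ 3 + |g p| ^ 3) := add_pow_le (abs_nonneg _) (abs_nonneg _) 3
    _ = _ := by norm_num

/-- For centered `h` and `g`, the variance of the linear statistic with summands
`summand n m h g s`, up to the factor `s ^ 2`. -/
def linearVariance (P : Measure E) (n m : ℕ) (h g : E → ℝ) : ℝ :=
  ∫ p, (h p - unlabeledFraction n m * g p) ^ 2 ∂P
    + unlabeledFraction n m * (1 - unlabeledFraction n m) * ∫ p, g p ^ 2 ∂P

lemma sum_integral_summand_sq (hn : 0 < n) (s : ℝ) :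
    ∑ k, ∫ p, summand n m h g s k p ^ 2 ∂P = linearVariance P n m h g / s ^ 2 := by
  have hn0 : (0 : ℝ) < n := mod_cast hn
  have hinl (p : E) : ((h p - unlabeledFraction n m * g p) / (√n * s)) ^ 2
      = (n * s ^ 2)⁻¹ * (h p - unlabeledFraction n m * g p) ^ 2 := by
    rw [div_pow, mul_pow, Real.sq_sqrt hn0.le, div_eq_inv_mul]
  have hinr (p : E) : (√n * g p / ((n + m) * s)) ^ 2 = n / ((n + m) * s) ^ 2 * g p ^ 2 := by
    rw [div_pow, mul_pow, Real.sq_sqrt hn0.le, mul_div_right_comm]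
  simp only [Fintype.sum_sum_type, summand, hinl, hinr, integral_const_mul, Finset.sum_const,
    Finset.card_univ, Fintype.card_fin, nsmul_eq_mul, linearVariance]
  generalize ∫ p, (h p - unlabeledFraction n m * g p) ^ 2 ∂P = A
  have hfraction : unlabeledFraction n m * (1 - unlabeledFraction n m) = m * n / (n + m) ^ 2 := by
    unfold unlabeledFraction
    field_simp
    ring
  rw [hfraction]
  obtain rfl | hs := eq_or_ne s 0
  · simp
  · field_simp

lemma sum_integral_abs_summand_pow_three_le (hn : 0 < n) (hh : MemLp h 3 P) (hg : MemLp g 3 P)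
    (hs : 0 < s) :
    ∑ k, ∫ p, |summand n m h g s k p| ^ 3 ∂P
      ≤ 5 * ((∫ p, |h p| ^ 3 ∂P + ∫ p, |g p| ^ 3 ∂P) / (√n * s ^ 3)) := by
  have hn0 : (0 : ℝ) < n := mod_cast hn
  have : (0 : ℝ) ≤ m := m.cast_nonneg
  have hsqrt : √(n : ℝ) ^ 2 = n := Real.sq_sqrt hn0.le
  have hsqrt0 : 0 < √(n : ℝ) := Real.sqrt_pos.2 hn0
  have hA := integral_abs_sub_pow_three_le (n := n) (m := m) hh hg
  have hH : 0 ≤ ∫ p, |h p| ^ 3 ∂P := integral_nonneg fun _ => by positivity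
  have hG : 0 ≤ ∫ p, |g p| ^ 3 ∂P := integral_nonneg fun _ => by positivity
  have hinl (p : E) : |(h p - unlabeledFraction n m * g p) / (√n * s)| ^ 3
      = ((√n * s) ^ 3)⁻¹ * |h p - unlabeledFraction n m * g p| ^ 3 := by
    rw [abs_div, abs_of_pos (mul_pos hsqrt0 hs), div_pow, div_eq_inv_mul]
  have hinr (p : E) : |√n * g p / ((n + m) * s)| ^ 3 = (√n / ((n + m) * s)) ^ 3 * |g p| ^ 3 := by
    rw [mul_div_right_comm, abs_mul, mul_pow, abs_of_nonneg (by positivity)]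
  simp only [Fintype.sum_sum_type, summand, hinl, hinr, integral_const_mul, Finset.sum_const,
    Finset.card_univ, Fintype.card_fin, nsmul_eq_mul]
  generalize ∫ p, |h p - unlabeledFraction n m * g p| ^ 3 ∂P = A at hA ⊢
  generalize ∫ p, |h p| ^ 3 ∂P = H at hA hH ⊢
  generalize ∫ p, |g p| ^ 3 ∂P = G at hA hG ⊢
  have hfraction : (m : ℝ) * n ^ 2 / (n + m) ^ 3 ≤ 1 := by
    rw [div_le_one (by positivity)]
    calc (m : ℝ) * n ^ 2 ≤ (n + m) * (n + m) ^ 2 := by gcongr <;> linarith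
      _ = _ := by ring
  calc _ = (A + m * n ^ 2 / (n + m) ^ 3 * G) / (√n * s ^ 3) := by
        field_simp
        linear_combination (√(n : ℝ) ^ 2 * (√n ^ 2 + n) * m * G - A * (n + m) ^ 3) * hsqrt
    _ ≤ (4 * (H + G) + 1 * (H + G)) / (√n * s ^ 3) := by
        gcongr
        linarith
    _ = _ := by ring

variable [IsProbabilityMeasure P] (hh : Measurable h) (hg : Measurable g) (hn : 0 < n)
  (hs : 0 < s)
include hh hg hn hs

lemma integral_abs_summand_inl_mul_le (hh2 : MemLp h 2 P) (hg2 : MemLp g 2 P) {δ : ℝ}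
    {D : (Fin n ⊕ Fin m → E) → ℝ} (hD : MemLp D 2 (Measure.pi fun _ => P))
    (hδ : √(∫ e, D e ^ 2 ∂(Measure.pi fun _ => P)) ≤ δ / √n) (l : Fin n) :
    ∫ e, |summand n m h g s (Sum.inl l) (e (Sum.inl l))| * |D e| ∂(Measure.pi fun _ => P)
      ≤ (√(∫ p, h p ^ 2 ∂P) + √(∫ p, g p ^ 2 ∂P)) / s * δ / n := by
  have hn0 : (0 : ℝ) < n := mod_cast hn
  have hsqrt : √(n : ℝ) * √n = n := Real.mul_self_sqrt hn0.le
  have hmeas := measurable_summand (s := s) (n := n) (m := m) hh hg (Sum.inl l)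
  have hL : MemLp (fun e : Fin n ⊕ Fin m → E => summand n m h g s (Sum.inl l) (e (Sum.inl l))) 2
      (Measure.pi fun _ => P) :=
    (memLp_summand hh2 hg2 _).comp_measurePreserving (measurePreserving_eval (fun _ => P) _)
  have hsq : √(∫ p, summand n m h g s (Sum.inl l) p ^ 2 ∂P)
      ≤ (√(∫ p, h p ^ 2 ∂P) + √(∫ p, g p ^ 2 ∂P)) / (√n * s) := by
    simp only [summand, div_pow]
    rw [integral_div, Real.sqrt_div' _ (by positivity), Real.sqrt_sq (by positivity)]
    gcongr
    exact sqrt_integral_sub_sq_le hh2 hg2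
  calc _ ≤ _ := integral_abs_mul_abs_le_sqrt hL hD
    _ ≤ (√(∫ p, h p ^ 2 ∂P) + √(∫ p, g p ^ 2 ∂P)) / (√n * s) * (δ / √n) := by
      rw [integral_pi_eval (hmeas.pow_const 2).aestronglyMeasurable (g := fun p =>
        summand n m h g s (Sum.inl l) p ^ 2)]
      gcongr
    _ = _ := by
      nth_rewrite 3 [← hsqrt]
      field_simp

variable (hh3 : MemLp h 3 P) (hg3 : MemLp g 3 P)
include hh3 hg3

lemma isStdFamily_summand (hh0 : ∫ p, h p ∂P = 0) (hg0 : ∫ p, g p ∂P = 0)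
    (hvar : s ^ 2 = linearVariance P n m h g) :
    IsStdFamily (Measure.pi fun _ : Fin n ⊕ Fin m => P) fun k e => summand n m h g s k (e k) := by
  refine isStdFamily_pi (measurable_summand hh hg) (memLp_summand hh3 hg3) ?_ ?_
  · rintro (i | j)
    · simp only [summand]
      rw [integral_div, integral_sub (hh3.integrable (by norm_num))
        ((hg3.integrable (by norm_num)).const_mul _), integral_const_mul, hh0, hg0]
      simp
    · simp only [summand]
      rw [integral_div, integral_const_mul, hg0, mul_zero, zero_div]
  · rw [sum_integral_summand_sq hn, ← hvar, div_self (by positivity)]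

theorem abs_measureReal_sum_summand_add_le_sub_cdf_le (hh0 : ∫ p, h p ∂P = 0)
    (hg0 : ∫ p, g p ∂P = 0) (hvar : s ^ 2 = linearVariance P n m h g) {δ : ℝ}
    {D : (Fin n ⊕ Fin m → E) → ℝ} {D' : Fin n → (Fin n ⊕ Fin m → E) → ℝ} (hDm : Measurable D)
    (hDm' : ∀ l, Measurable (D' l)) (hD : MemLp D 2 (Measure.pi fun _ => P))
    (hD' : ∀ l, MemLp (D' l) 2 (Measure.pi fun _ => P))
    (hinr : ∀ j e p, D (Function.update e (Sum.inr j) p) = D e)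
    (hinl : ∀ l e p, D' l (Function.update e (Sum.inl l) p) = D' l e)
    (hδ : √(∫ e, D e ^ 2 ∂(Measure.pi fun _ => P)) ≤ δ)
    (hδ' : ∀ l, √(∫ e, (D e - D' l e) ^ 2 ∂(Measure.pi fun _ => P)) ≤ δ / √n) (z : ℝ) :
    |(Measure.pi fun _ : Fin n ⊕ Fin m => P).real {e | ∑ k, summand n m h g s k (e k) + D e ≤ z}
        - Φ z|
      ≤ 415 * ((∫ p, |h p| ^ 3 ∂P + ∫ p, |g p| ^ 3 ∂P) / (√n * s ^ 3))
        + 2 * δ * ((√(∫ p, h p ^ 2 ∂P) + √(∫ p, g p ^ 2 ∂P)) / s + 1) := by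
  have hn0 : (n : ℝ) ≠ 0 := mod_cast hn.ne'
  have hmeas := measurable_summand (s := s) (n := n) (m := m) hh hg
  have hstd := isStdFamily_summand hh hg hn hs hh3 hg3 hh0 hg0 hvar
  have hlyapunov := sum_integral_abs_summand_pow_three_le (m := m) hn hh3 hg3 hs
  rw [← lyapunov_pi hmeas] at hlyapunov
  have hbound := hstd.abs_measureReal_sum_add_le_sub_cdf_le hD hDm
    (Δ' := Sum.elim D' fun _ => D) (by rintro (l | _); exacts [hD' l, hD])
    (by
      rintro (l | j)
      exacts [indepFun_sumExcept_of_update_invariant hmeas _ (hDm' l) (hinl l),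
        indepFun_sumExcept_of_update_invariant hmeas _ hDm (hinr j)]) z
  have hprod := integral_abs_mul_abs_le_sqrt hstd.memLp_sum hD
  rw [hstd.integral_sum_sq, Real.sqrt_one, one_mul] at hprod
  have hdiff := Finset.sum_le_sum fun l (_ : l ∈ Finset.univ) => integral_abs_summand_inl_mul_le
    hh hg hn hs (hh3.mono_exponent (by norm_num)) (hg3.mono_exponent (by norm_num))
    (hD.sub (hD' l)) (hδ' l) l
  rw [Finset.sum_const, Finset.card_univ, Fintype.card_fin, nsmul_eq_mul,
    mul_div_cancel₀ _ hn0] at hdiff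
  simp only [Fintype.sum_sum_type (α₁ := Fin n) (f := fun k => ∫ e, |summand n m h g s k (e k)| *
    |D e - Sum.elim D' (fun _ => D) k e| ∂(Measure.pi fun _ => P)), Sum.elim_inl, Sum.elim_inr,
    sub_self, abs_zero, mul_zero, integral_zero, Finset.sum_const_zero, add_zero] at hbound
  simp only [Pi.sub_apply] at hdiff
  linarith

end LinearStatistic

/-! ### Fixed assistant function -/

section FixedFunction

variable {𝒳 : Type u} {𝒴 : Type v} {r n m : ℕ}

/-- The responses of the labeled observations, in a sample whose labeled observations are indexed
by `Sum.inl`. -/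
def responses (n m : ℕ) (e : Fin n ⊕ Fin m → 𝒳 × 𝒴) (l : Fin n) : 𝒴 := (e (Sum.inl l)).2

lemma responses_update_inr (e : Fin n ⊕ Fin m → 𝒳 × 𝒴) (j : Fin m) (p : 𝒳 × 𝒴) :
    responses n m (Function.update e (Sum.inr j) p) = responses n m e := by
  ext l
  simp [responses]

lemma responses_update_inl_of_ne (e : Fin n ⊕ Fin m → 𝒳 × 𝒴) {l l' : Fin n} (h : l' ≠ l)
    (p : 𝒳 × 𝒴) : responses n m (Function.update e (Sum.inl l) p) l' = responses n m e l' := by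
  simp [responses, h]

variable [MeasurableSpace 𝒳] [MeasurableSpace 𝒴] {ℓ : (Fin r → 𝒴) → ℝ} {P : Measure (𝒳 × 𝒴)}
  {f : 𝒳 → ℝ}

lemma measurePreserving_responses [IsProbabilityMeasure P] :
    MeasurePreserving (responses n m) (Measure.pi fun _ => P) (Measure.pi fun _ => P.snd) :=
  (measurePreserving_pi (fun _ : Fin n => P) (fun _ => P.snd)
    fun _ => measurePreserving_snd_marginal).comp
    (measurePreserving_fst.comp
      (measurePreserving_sumPiEquivProdPi (X := fun _ : Fin n ⊕ Fin m => 𝒳 × 𝒴) fun _ => P))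

/-- The centered assistant function, as a function on the space of the pairs `(X, Y)`. -/
def assistantScore (P : Measure (𝒳 × 𝒴)) (f : 𝒳 → ℝ) (p : 𝒳 × 𝒴) : ℝ :=
  f p.1 - ∫ x, f x ∂P.fst

lemma measurable_assistantScore (hf : Measurable f) : Measurable (assistantScore P f) :=
  (hf.comp measurable_fst).sub_const _

lemma integral_assistantScore [IsProbabilityMeasure P] (hf : MemLp f 2 P.fst) :
    ∫ p, assistantScore P f p ∂P = 0 := by
  have hint := hf.integrable one_le_two
  have hfst : Integrable (fun p : 𝒳 × 𝒴 => f p.1) P :=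
    measurePreserving_fst_marginal.integrable_comp_of_integrable hint
  simp only [assistantScore]
  rw [integral_sub hfst (integrable_const _), integral_comp_eq_of_measurePreserving
    measurePreserving_fst_marginal hint.aestronglyMeasurable, integral_const, probReal_univ,
    one_smul, sub_self]

lemma memLp_of_memLp_assistantScore [IsProbabilityMeasure P] (hf : Measurable f) {p : ℝ≥0∞}
    (hfL : MemLp (assistantScore P f) p P) : MemLp f p P.fst := by
  refine (memLp_map_measure_iff hf.aestronglyMeasurable measurable_fst.aemeasurable).2 ?_
  refine (hfL.add (memLp_const (∫ x, f x ∂P.fst))).ae_eq (ae_of_all _ fun p => ?_)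
  simp [assistantScore]

variable [NeZero r]

/-- The centered projection `ℓ₁ - ψ`, as a function on the space of the pairs `(X, Y)`. -/
def responseScore (ℓ : (Fin r → 𝒴) → ℝ) (P : Measure (𝒳 × 𝒴)) (p : 𝒳 × 𝒴) : ℝ :=
  proj1 ℓ P p.2

/-- The standardized estimator `√n (U_single - ψ) / √Λ`. -/
def stdEstimator (ℓ : (Fin r → 𝒴) → ℝ) (P : Measure (𝒳 × 𝒴)) (f : 𝒳 → ℝ)
    (xy : Fin n → 𝒳 × 𝒴) (x' : Fin m → 𝒳) : ℝ :=
  √(n : ℝ) * (uSemi ℓ f xy x' - psi ℓ P) / √(Lam n m ℓ P f)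

lemma uSemi_sub_psi (hn : r ≤ n) (e : Fin n ⊕ Fin m → 𝒳 × 𝒴) :
    uSemi ℓ f (fun i => e (Sum.inl i)) (fun j => (e (Sum.inr j)).1) - psi ℓ P
      = r / n * ∑ i, (responseScore ℓ P (e (Sum.inl i))
            - unlabeledFraction n m * assistantScore P f (e (Sum.inl i)))
        + r / (n + m) * ∑ j, assistantScore P f (e (Sum.inr j))
        + uRem ℓ P (incTuples r n) (responses n m e) := by
  have hn0 : (0 : ℝ) < n := mod_cast (NeZero.pos r).trans_le hn
  have hHoeffding := uStat_sub_psi (P := P) (ℓ := ℓ) hn fun i => (e (Sum.inl i)).2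
  simp only [uSemi, uRem, responseScore, assistantScore, unlabeledFraction, Finset.sum_sub_distrib,
    ← Finset.mul_sum, Finset.sum_const, Finset.card_univ, Fintype.card_fin, nsmul_eq_mul]
  simp only [responses]
  generalize ∑ i : Fin n, f (e (Sum.inl i)).1 = F
  generalize ∑ j : Fin m, f (e (Sum.inr j)).1 = F'
  rw [add_sub_right_comm, sub_right_comm, hHoeffding]
  field_simp
  ring

lemma stdEstimator_eq_sum_summand_add (hn : r ≤ n) (e : Fin n ⊕ Fin m → 𝒳 × 𝒴) :
    stdEstimator ℓ P f (fun i => e (Sum.inl i)) (fun j => (e (Sum.inr j)).1)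
      = ∑ k, summand n m (responseScore ℓ P) (assistantScore P f) (√(Lam n m ℓ P f) / r) k (e k)
        + √n / √(Lam n m ℓ P f) * uRem ℓ P (incTuples r n) (responses n m e) := by
  have hn0 : (0 : ℝ) < n := mod_cast (NeZero.pos r).trans_le hn
  have hsqrt : √(n : ℝ) ^ 2 = n := Real.sq_sqrt hn0.le
  rw [stdEstimator, uSemi_sub_psi hn, Fintype.sum_sum_type]
  simp only [summand, ← Finset.sum_div, ← Finset.mul_sum]
  generalize ∑ i, (responseScore ℓ P (e (Sum.inl i)) - _) = A
  obtain hΛ | hΛ := eq_or_ne √(Lam n m ℓ P f) 0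
  · simp [hΛ]
  · field_simp
    linear_combination (r * A * (n + m)) * hsqrt

variable [IsProbabilityMeasure P]

lemma measurable_responseScore (hℓ : Measurable ℓ) : Measurable (responseScore ℓ P) :=
  (measurable_proj1 hℓ).comp measurable_snd

section SquareIntegrable

variable (hL : MemLp ℓ 2 (lawYs r P))
include hL

lemma memLp_responseScore : MemLp (responseScore ℓ P) 2 P :=
  (memLp_proj1 hL).comp_measurePreserving measurePreserving_snd_marginal

lemma integral_responseScore : ∫ p, responseScore ℓ P p ∂P = 0 :=
  (integral_comp_eq_of_measurePreserving measurePreserving_snd_marginal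
    (memLp_proj1 hL).aestronglyMeasurable).trans (integral_proj1 hL)

lemma sq_mul_linearVariance_eq_Lam (hf : Measurable f) (hfL : MemLp f 2 P.fst) :
    (r : ℝ) ^ 2 * linearVariance P n m (responseScore ℓ P) (assistantScore P f)
      = Lam n m ℓ P f := by
  have hfst : MemLp (fun p : 𝒳 × 𝒴 => f p.1) 2 P :=
    hfL.comp_measurePreserving measurePreserving_fst_marginal
  have hg : MemLp (assistantScore P f) 2 P := hfst.sub (memLp_const _)
  have hdiff : MemLp
      (fun p => responseScore ℓ P p - unlabeledFraction n m * assistantScore P f p) 2 P :=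
    (memLp_responseScore hL).sub (hg.const_mul _)
  have hdiff' : MemLp (fun p : 𝒳 × 𝒴 => ell1 ℓ P p.2 - unlabeledFraction n m * f p.1) 2 P :=
    (memLp_ell1_snd hL).sub (hfst.const_mul _)
  have hmean :
      ∫ p, (responseScore ℓ P p - unlabeledFraction n m * assistantScore P f p) ∂P = 0 := by
    rw [integral_sub ((memLp_responseScore hL).integrable one_le_two)
      ((hg.integrable one_le_two).const_mul _), integral_const_mul, integral_responseScore hL,
      integral_assistantScore hfL, mul_zero, sub_zero]
  have hvar : Var[assistantScore P f; P] = Var[fun p : 𝒳 × 𝒴 => f p.1; P] :=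
    variance_sub_const hfst.aestronglyMeasurable _
  have hshift : (fun p => responseScore ℓ P p - unlabeledFraction n m * assistantScore P f p)
      = fun p => ell1 ℓ P p.2 - unlabeledFraction n m * f p.1
        - (psi ℓ P - unlabeledFraction n m * ∫ x, f x ∂P.fst) := by
    ext p
    simp only [responseScore, proj1, assistantScore]
    ring
  rw [Lam_eq_variance_sub_add hL hf hfL, linearVariance,
    ← variance_of_integral_eq_zero hdiff.aemeasurable hmean,
    ← variance_of_integral_eq_zero hg.aemeasurable (integral_assistantScore hfL), hshift, hvar,
    variance_sub_const hdiff'.aestronglyMeasurable]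

end SquareIntegrable

end FixedFunction

section FixedFunctionBound

variable {𝒳 : Type u} {𝒴 : Type v} {r n m : ℕ} [MeasurableSpace 𝒳] [MeasurableSpace 𝒴] [NeZero r]
  {ℓ : (Fin r → 𝒴) → ℝ} {P : Measure (𝒳 × 𝒴)}

lemma uRem_incTuplesOff_responses_update_inl (l : Fin n) (e : Fin n ⊕ Fin m → 𝒳 × 𝒴)
    (p : 𝒳 × 𝒴) : uRem ℓ P (incTuplesOff r l) (responses n m (Function.update e (Sum.inl l) p))
      = uRem ℓ P (incTuplesOff r l) (responses n m e) := by
  refine congrArg ((n.choose r : ℝ)⁻¹ * ·)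
    (Finset.sum_congr rfl fun i hi => congrArg (projRem ℓ P) (funext fun k => ?_))
  exact responses_update_inl_of_ne e (fun h => (Finset.mem_filter.1 hi).2 ⟨k, h⟩) p

/-- The constant of the Berry–Esseen bound. -/
def boundConst (r : ℕ) : ℝ := 415 + 2 * remConst r

lemma boundConst_pos (r : ℕ) : 0 < boundConst r := by
  have := remConst_nonneg r
  unfold boundConst
  positivity

lemma linear_add_remainder_bound_le {a b c d q q' σ s s' : ℝ} (ha : 0 ≤ a) (hb : 0 ≤ b)
    (hc : 0 ≤ c) (hd : 0 ≤ d) (hσ : 0 < σ) (hs : σ ≤ s) (hs' : σ ≤ s') (hq : 0 < q)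
    (hqq' : q ≤ q') :
    415 * (a / (q' * s' ^ 3)) + 2 * (c * d / (q' * s)) * (b / s' + 1)
      ≤ (415 + 2 * c) * (a / (q' * σ ^ 3) + (b + σ) * d / (q * σ ^ 2)) := by
  have hq' : 0 < q' := hq.trans_le hqq'
  have hlinear : 0 ≤ c * (a / (q' * σ ^ 3)) := by positivity
  have hremainder : 0 ≤ (b + σ) * d / (q * σ ^ 2) := by positivity
  calc _ ≤ 415 * (a / (q' * σ ^ 3)) + 2 * (c * d / (q * σ)) * (b / σ + 1) := by
        have : 0 < s' := hσ.trans_le hs'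
        gcongr
    _ = 415 * (a / (q' * σ ^ 3)) + 2 * c * ((b + σ) * d / (q * σ ^ 2)) := by field_simp
    _ ≤ _ := by linarith

variable [IsProbabilityMeasure P]

lemma sqrt_integral_sq_responses_le {G : (Fin n → 𝒴) → ℝ} (hG : Measurable G) {c b : ℝ}
    (hc : 0 ≤ c) (hb : √(∫ y, G y ^ 2 ∂(Measure.pi fun _ => P.snd)) ≤ b) :
    √(∫ e, (c * G (responses n m e)) ^ 2 ∂(Measure.pi fun _ => P)) ≤ c * b := by
  simp only [mul_pow]
  rw [integral_const_mul, Real.sqrt_mul (sq_nonneg c), Real.sqrt_sq hc,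
    integral_comp_eq_of_measurePreserving measurePreserving_responses
      (g := fun y => G y ^ 2) (hG.pow_const 2).aestronglyMeasurable]
  gcongr

variable (hℓ : Measurable ℓ) (hsym : SymmetricKernel ℓ) (hL : MemLp ℓ 2 (lawYs r P))
include hℓ hsym hL

lemma sqrt_integral_mul_uRem_responses_sq_le (hn : r ≤ n) {s : ℝ} (hs : 0 < s) :
    √(∫ e, (√n / s * uRem ℓ P (incTuples r n) (responses n m e)) ^ 2 ∂(Measure.pi fun _ => P))
      ≤ remConst r * sigmaL ℓ P / (√n * s) := by
  have hn0 : (0 : ℝ) < n := mod_cast (NeZero.pos r).trans_le hn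
  have hsigma : 0 ≤ sigmaL ℓ P := Real.sqrt_nonneg _
  have hconst := remConst_nonneg r
  have hrem := (Real.sqrt_le_left (by positivity)).2 (integral_uRem_sq_le hℓ hsym hL hn)
  refine (sqrt_integral_sq_responses_le (measurable_uRem hℓ _) (by positivity) hrem).trans_eq ?_
  nth_rewrite 2 [← Real.sq_sqrt hn0.le]
  field_simp

lemma sqrt_integral_mul_uRem_sub_responses_sq_le (hn : r ≤ n) {s : ℝ} (hs : 0 < s) (l : Fin n) :
    √(∫ e, (√n / s * uRem ℓ P (incTuples r n) (responses n m e)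
        - √n / s * uRem ℓ P (incTuplesOff r l) (responses n m e)) ^ 2 ∂(Measure.pi fun _ => P))
      ≤ remConst r * sigmaL ℓ P / (√n * s) / √n := by
  have hn0 : (0 : ℝ) < n := mod_cast (NeZero.pos r).trans_le hn
  have hsigma : 0 ≤ sigmaL ℓ P := Real.sqrt_nonneg _
  have hconst := remConst_nonneg r
  have hrem : √(∫ y, (uRem ℓ P (incTuples r n) y - uRem ℓ P (incTuplesOff r l) y) ^ 2
      ∂(Measure.pi fun _ => P.snd)) ≤ remConst r * sigmaL ℓ P / n / √n := by
    rw [Real.sqrt_le_left (by positivity), div_pow _ √(n : ℝ), Real.sq_sqrt hn0.le, div_eq_inv_mul]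
    exact integral_uRem_sub_sq_le hℓ hsym hL hn l
  simp only [← mul_sub]
  refine (sqrt_integral_sq_responses_le
    ((measurable_uRem hℓ _).sub (measurable_uRem hℓ _)) (by positivity) hrem).trans_eq ?_
  nth_rewrite 2 [← Real.sq_sqrt hn0.le]
  field_simp

variable {f : 𝒳 → ℝ} (hf : Measurable f) (hh3 : MemLp (responseScore ℓ P) 3 P)
  (hg3 : MemLp (assistantScore P f) 3 P)
include hf hh3 hg3

lemma abs_measureReal_stdEstimator_sub_cdf_le_of_Lam_pos (hn : r ≤ n) (hLam : 0 < Lam n m ℓ P f)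
    (t : ℝ) :
    |(Measure.pi fun _ : Fin n ⊕ Fin m => P).real {e | stdEstimator ℓ P f
        (fun i => e (Sum.inl i)) (fun j => (e (Sum.inr j)).1) ≤ t} - Φ t|
      ≤ 415 * ((∫ p, |responseScore ℓ P p| ^ 3 ∂P + ∫ p, |assistantScore P f p| ^ 3 ∂P)
            / (√n * (√(Lam n m ℓ P f) / r) ^ 3))
        + 2 * (remConst r * sigmaL ℓ P / (√n * √(Lam n m ℓ P f)))
          * ((√(∫ p, responseScore ℓ P p ^ 2 ∂P) + √(∫ p, assistantScore P f p ^ 2 ∂P))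
              / (√(Lam n m ℓ P f) / r) + 1) := by
  have hr : (0 : ℝ) < r := mod_cast NeZero.pos r
  have hfL := memLp_of_memLp_assistantScore hf (hg3.mono_exponent (by norm_num : (2 : ℝ≥0∞) ≤ 3))
  have hsqrt : 0 < √(Lam n m ℓ P f) := Real.sqrt_pos.2 hLam
  have hvar : (√(Lam n m ℓ P f) / r) ^ 2
      = linearVariance P n m (responseScore ℓ P) (assistantScore P f) := by
    rw [div_pow, Real.sq_sqrt hLam.le, ← sq_mul_linearVariance_eq_Lam hL hf hfL]
    field_simp
  have hmeas (S : Finset (Fin r → Fin n)) := (measurable_uRem (P := P) hℓ S).comp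
    (measurePreserving_responses (P := P) (n := n) (m := m)).measurable
  have hmemLp {S : Finset (Fin r → Fin n)} (hS : S ⊆ incTuples r n) :=
    (memLp_uRem hL fun i hi => injective_of_mem_incTuples (hS hi)).comp_measurePreserving
      (measurePreserving_responses (n := n) (m := m))
  simp only [stdEstimator_eq_sum_summand_add hn]
  exact abs_measureReal_sum_summand_add_le_sub_cdf_le (measurable_responseScore hℓ)
    (measurable_assistantScore hf) ((NeZero.pos r).trans_le hn) (by positivity) hh3 hg3
    (integral_responseScore hL) (integral_assistantScore hfL) hvar
    (D := fun e => √n / √(Lam n m ℓ P f) * uRem ℓ P (incTuples r n) (responses n m e))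
    (D' := fun l e => √n / √(Lam n m ℓ P f) * uRem ℓ P (incTuplesOff r l) (responses n m e))
    ((hmeas _).const_mul _) (fun l => (hmeas _).const_mul _)
    ((hmemLp subset_rfl).const_mul _) (fun l => (hmemLp (Finset.filter_subset _ _)).const_mul _)
    (fun j e p => by rw [responses_update_inr])
    (fun l e p => by rw [uRem_incTuplesOff_responses_update_inl])
    (sqrt_integral_mul_uRem_responses_sq_le hℓ hsym hL hn hsqrt)
    (sqrt_integral_mul_uRem_sub_responses_sq_le hℓ hsym hL hn hsqrt) t

theorem abs_measureReal_stdEstimator_sub_cdf_le (hn : r < n) (hσ : 0 < sigma1Sq ℓ P) (t : ℝ) :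
    |(Measure.pi fun _ : Fin n ⊕ Fin m => P).real {e | stdEstimator ℓ P f
        (fun i => e (Sum.inl i)) (fun j => (e (Sum.inr j)).1) ≤ t} - Φ t|
      ≤ boundConst r *
        ((∫ p, |responseScore ℓ P p| ^ 3 ∂P + ∫ p, |assistantScore P f p| ^ 3 ∂P)
            / (√n * sigma1 ℓ P ^ 3)
          + (√(∫ p, responseScore ℓ P p ^ 2 ∂P) + √(∫ p, assistantScore P f p ^ 2 ∂P)
              + sigma1 ℓ P) * sigmaL ℓ P / (√((n : ℝ) - r) * sigma1 ℓ P ^ 2)) := by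
  have hr : (1 : ℝ) ≤ r := mod_cast NeZero.one_le
  have hnr : (0 : ℝ) < n - r := sub_pos.2 (mod_cast hn)
  have hconst := remConst_nonneg r
  have hsigma : 0 ≤ sigmaL ℓ P := Real.sqrt_nonneg _
  have hsigma1 : 0 < sigma1 ℓ P := Real.sqrt_pos.2 hσ
  have hfL := memLp_of_memLp_assistantScore hf (hg3.mono_exponent (by norm_num : (2 : ℝ≥0∞) ≤ 3))
  have hle := sq_mul_sigma1Sq_le_Lam (n := n) (m := m) hL hf hfL
  have hbound := abs_measureReal_stdEstimator_sub_cdf_le_of_Lam_pos hℓ hsym hL hf hh3 hg3 hn.le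
    (lt_of_lt_of_le (by positivity) hle) t
  have hroot : r * sigma1 ℓ P ≤ √(Lam n m ℓ P f) :=
    Real.le_sqrt_of_sq_le (by rwa [mul_pow, sigma1, Real.sq_sqrt hσ.le])
  have hscale : sigma1 ℓ P ≤ √(Lam n m ℓ P f) / r := by rwa [le_div_iff₀' (by positivity)]
  have hroot' : sigma1 ℓ P ≤ √(Lam n m ℓ P f) :=
    (le_mul_of_one_le_left hsigma1.le hr).trans hroot
  exact hbound.trans (linear_add_remainder_bound_le (by positivity) (by positivity) hconst hsigma
    hsigma1 hroot' hscale (Real.sqrt_pos.2 hnr) (Real.sqrt_le_sqrt (by linarith)))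

end FixedFunctionBound

/-! ### Moments in `[0, ∞]` -/

section ExtendedMoments

variable {E : Type*} [MeasurableSpace E] {ν : Measure E} {p : ℕ}

lemma lintegral_enorm_pow_eq_ofReal {g : E → ℝ} (hg : MemLp g p ν) (hp : p ≠ 0) :
    ∫⁻ x, ‖g x‖ₑ ^ p ∂ν = ENNReal.ofReal (∫ x, |g x| ^ p ∂ν) := by
  rw [ofReal_integral_eq_lintegral_ofReal (integrable_abs_pow hg hp)
    (ae_of_all _ fun x => by positivity)]
  refine lintegral_congr fun x => ?_
  rw [Real.enorm_eq_ofReal_abs, ENNReal.ofReal_pow (abs_nonneg _)]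

lemma memLp_of_lintegral_enorm_pow_ne_top {g : E → ℝ} (hg : AEStronglyMeasurable g ν)
    (hp : p ≠ 0) (h : ∫⁻ x, ‖g x‖ₑ ^ p ∂ν ≠ ∞) : MemLp g p ν := by
  refine ⟨hg, (eLpNorm_lt_top_iff_lintegral_rpow_enorm_lt_top (mod_cast hp)
    (ENNReal.natCast_ne_top p)).2 ?_⟩
  simpa using h.lt_top

lemma lintegral_rpow_half_le [IsProbabilityMeasure ν] {g : E → ℝ≥0∞} (hg : AEMeasurable g ν) :
    ∫⁻ x, g x ^ (1 / 2 : ℝ) ∂ν ≤ (∫⁻ x, g x ∂ν) ^ (1 / 2 : ℝ) := by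
  have h := ENNReal.lintegral_mul_le_Lp_mul_Lq ν Real.HolderConjugate.two_two
    (hg.pow_const (1 / 2 : ℝ)) (aemeasurable_const (b := (1 : ℝ≥0∞)))
  have hsq (x : E) : (g x ^ (1 / 2 : ℝ)) ^ (2 : ℝ) = g x := by
    rw [← ENNReal.rpow_mul]
    norm_num
  simpa only [Pi.mul_apply, mul_one, hsq, ENNReal.one_rpow, lintegral_const, measure_univ] using h

/-- The absolute central moment `E|g - E g|^p`, in `[0, ∞]`. -/
def absCentralMoment (p : ℕ) (ν : Measure E) (g : E → ℝ) : ℝ≥0∞ :=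
  ∫⁻ x, ‖g x - ∫ x', g x' ∂ν‖ₑ ^ p ∂ν

lemma measurable_absCentralMoment {𝒟 : Type*} [MeasurableSpace 𝒟] [SFinite ν] {g : 𝒟 → E → ℝ}
    (hg : Measurable (Function.uncurry g)) : Measurable fun d => absCentralMoment p ν (g d) := by
  have hmean : Measurable fun d => ∫ x, g d x ∂ν :=
    (hg.stronglyMeasurable.integral_prod_right (ν := ν)).measurable
  exact ((hg.sub (hmean.comp measurable_fst)).enorm.pow_const p).lintegral_prod_right'

variable {𝒳 : Type u} {𝒴 : Type v} [MeasurableSpace 𝒳] [MeasurableSpace 𝒴] {r n m : ℕ} [NeZero r]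
  {ℓ : (Fin r → 𝒴) → ℝ} {P : Measure (𝒳 × 𝒴)}

/-- The right-hand side of the Berry–Esseen bound without its constant, with `M₂` and `M₃` in the
place of the moments `M_{2,f̂}` and `M_{3,f̂}`. -/
def errorTerm (n : ℕ) (ℓ : (Fin r → 𝒴) → ℝ) (P : Measure (𝒳 × 𝒴)) (M₂ M₃ : ℝ≥0∞) : ℝ≥0∞ :=
  (momentEll1 3 ℓ P + M₃) / ENNReal.ofReal (√(n : ℝ) * sigma1 ℓ P ^ 3)
    + (momentEll1 2 ℓ P ^ (1 / 2 : ℝ) + M₂ ^ (1 / 2 : ℝ) + ENNReal.ofReal (sigma1 ℓ P))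
      * ENNReal.ofReal (sigmaL ℓ P) / ENNReal.ofReal (√((n : ℝ) - r) * sigma1 ℓ P ^ 2)

lemma lintegral_errorTerm_le [IsProbabilityMeasure ν] {M₂ M₃ : E → ℝ≥0∞} (hM₂ : Measurable M₂)
    (hM₃ : Measurable M₃) : ∫⁻ x, errorTerm n ℓ P (M₂ x) (M₃ x) ∂ν
      ≤ errorTerm n ℓ P (∫⁻ x, M₂ x ∂ν) (∫⁻ x, M₃ x ∂ν) := by
  simp only [errorTerm, div_eq_mul_inv]
  rw [lintegral_add_left (by fun_prop), lintegral_mul_const _ (by fun_prop),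
    lintegral_mul_const _ (by fun_prop), lintegral_mul_const _ (by fun_prop),
    lintegral_add_left measurable_const, lintegral_add_right _ measurable_const,
    lintegral_add_left measurable_const]
  simp only [lintegral_const, measure_univ, mul_one]
  have hJensen := lintegral_rpow_half_le (ν := ν) hM₂.aemeasurable
  simp only [one_div, one_mul] at hJensen ⊢
  gcongr

lemma errorTerm_eq_top {M₂ M₃ : ℝ≥0∞} (h : momentEll1 3 ℓ P + M₃ = ∞) :
    errorTerm n ℓ P M₂ M₃ = ∞ := by
  rw [errorTerm, h, ENNReal.top_div_of_ne_top ENNReal.ofReal_ne_top, top_add]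

lemma absCentralMoment_eq_lintegral_assistantScore {f : 𝒳 → ℝ} (hf : Measurable f) :
    absCentralMoment p P.fst f = ∫⁻ q, ‖assistantScore P f q‖ₑ ^ p ∂P :=
  (measurePreserving_fst_marginal.lintegral_comp
    ((hf.sub_const (∫ x, f x ∂P.fst)).enorm.pow_const p)).symm

variable [IsProbabilityMeasure P]

lemma momentEll1_eq_lintegral_responseScore (hℓ : Measurable ℓ) (hL : MemLp ℓ 2 (lawYs r P)) :
    momentEll1 p ℓ P = ∫⁻ q, ‖responseScore ℓ P q‖ₑ ^ p ∂P := by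
  rw [momentEll1, integral_ell1 hL]
  exact (measurePreserving_snd_marginal.lintegral_comp
    ((measurable_proj1 (P := P) hℓ).enorm.pow_const p)).symm

variable {f : 𝒳 → ℝ} (hℓ : Measurable ℓ) (hL : MemLp ℓ 2 (lawYs r P)) (hf : Measurable f)
include hℓ hL hf

lemma errorTerm_eq_ofReal (hn : r < n) (hσ : 0 < sigma1Sq ℓ P)
    (hh3 : MemLp (responseScore ℓ P) 3 P) (hg3 : MemLp (assistantScore P f) 3 P) :
    errorTerm n ℓ P (absCentralMoment 2 P.fst f) (absCentralMoment 3 P.fst f) = ENNReal.ofReal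
      ((∫ p, |responseScore ℓ P p| ^ 3 ∂P + ∫ p, |assistantScore P f p| ^ 3 ∂P)
          / (√n * sigma1 ℓ P ^ 3)
        + (√(∫ p, responseScore ℓ P p ^ 2 ∂P) + √(∫ p, assistantScore P f p ^ 2 ∂P)
            + sigma1 ℓ P) * sigmaL ℓ P / (√((n : ℝ) - r) * sigma1 ℓ P ^ 2)) := by
  have hh2 : MemLp (responseScore ℓ P) 2 P := hh3.mono_exponent (by norm_num)
  have hg2 : MemLp (assistantScore P f) 2 P := hg3.mono_exponent (by norm_num)
  have hsigma1 : 0 < sigma1 ℓ P := Real.sqrt_pos.2 hσ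
  have hn0 : (0 : ℝ) < n := mod_cast (Nat.zero_le r).trans_lt hn
  have hnr : (0 : ℝ) < n - r := sub_pos.2 (mod_cast hn)
  have hsigma : 0 ≤ sigmaL ℓ P := Real.sqrt_nonneg _
  simp only [errorTerm, momentEll1_eq_lintegral_responseScore hℓ hL,
    absCentralMoment_eq_lintegral_assistantScore hf]
  rw [lintegral_enorm_pow_eq_ofReal (p := 3) hh3 three_ne_zero,
    lintegral_enorm_pow_eq_ofReal (p := 3) hg3 three_ne_zero,
    lintegral_enorm_pow_eq_ofReal (p := 2) hh2 two_ne_zero,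
    lintegral_enorm_pow_eq_ofReal (p := 2) hg2 two_ne_zero]
  simp only [sq_abs]
  rw [ENNReal.ofReal_rpow_of_nonneg (by positivity) (by norm_num),
    ENNReal.ofReal_rpow_of_nonneg (by positivity) (by norm_num), ← Real.sqrt_eq_rpow,
    ← Real.sqrt_eq_rpow, ← ENNReal.ofReal_add (by positivity) (by positivity),
    ← ENNReal.ofReal_add (by positivity) (by positivity),
    ← ENNReal.ofReal_add (by positivity) hsigma1.le, ← ENNReal.ofReal_mul (by positivity),
    ← ENNReal.ofReal_div_of_pos (by positivity), ← ENNReal.ofReal_div_of_pos (by positivity),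
    ← ENNReal.ofReal_add (by positivity) (by positivity)]

theorem ofReal_abs_measureReal_stdEstimator_sub_cdf_le (hsym : SymmetricKernel ℓ) (hn : r < n)
    (hσ : 0 < sigma1Sq ℓ P) (t : ℝ) :
    ENNReal.ofReal |(Measure.pi fun _ : Fin n ⊕ Fin m => P).real {e | stdEstimator ℓ P f
        (fun i => e (Sum.inl i)) (fun j => (e (Sum.inr j)).1) ≤ t} - Φ t|
      ≤ ENNReal.ofReal (boundConst r) *
        errorTerm n ℓ P (absCentralMoment 2 P.fst f) (absCentralMoment 3 P.fst f) := by
  have hC := boundConst_pos r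
  obtain htop | htop := eq_or_ne (momentEll1 3 ℓ P + absCentralMoment 3 P.fst f) ∞
  · rw [errorTerm_eq_top htop, ENNReal.mul_top (ENNReal.ofReal_pos.2 hC).ne']
    exact le_top
  obtain ⟨hh, hg⟩ := not_or.1 (mt ENNReal.add_eq_top.2 htop)
  rw [momentEll1_eq_lintegral_responseScore hℓ hL] at hh
  rw [absCentralMoment_eq_lintegral_assistantScore hf] at hg
  have hh3 : MemLp (responseScore ℓ P) 3 P := memLp_of_lintegral_enorm_pow_ne_top
    (measurable_responseScore hℓ).aestronglyMeasurable three_ne_zero hh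
  have hg3 : MemLp (assistantScore P f) 3 P := memLp_of_lintegral_enorm_pow_ne_top
    (measurable_assistantScore hf).aestronglyMeasurable three_ne_zero hg
  rw [errorTerm_eq_ofReal hℓ hL hf hn hσ hh3 hg3, ← ENNReal.ofReal_mul hC.le]
  exact ENNReal.ofReal_le_ofReal
    (abs_measureReal_stdEstimator_sub_cdf_le hℓ hsym hL hf hh3 hg3 hn hσ t)

end ExtendedMoments

/-! ### Trained assistant function -/

section TrainedFunction

lemma ofReal_abs_measureReal_prod_sub_le {𝒟 E : Type*} [MeasurableSpace 𝒟] [MeasurableSpace E]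
    {κ : Measure 𝒟} {Q : Measure E} [IsProbabilityMeasure κ] [IsProbabilityMeasure Q]
    {S : Set (𝒟 × E)} (hS : MeasurableSet S) (c : ℝ) :
    ENNReal.ofReal |(κ.prod Q).real S - c|
      ≤ ∫⁻ d, ENNReal.ofReal |Q.real (Prod.mk d ⁻¹' S) - c| ∂κ := by
  have hmeas : Measurable fun d => Q (Prod.mk d ⁻¹' S) := measurable_measure_prodMk_left hS
  have hint : Integrable (fun d => Q.real (Prod.mk d ⁻¹' S)) κ :=
    Integrable.of_bound hmeas.ennreal_toReal.aestronglyMeasurable 1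
      (ae_of_all _ fun d => by
        rw [Real.norm_eq_abs, abs_of_nonneg measureReal_nonneg]
        exact measureReal_le_one)
  have hprod : (κ.prod Q).real S - c = ∫ d, (Q.real (Prod.mk d ⁻¹' S) - c) ∂κ := by
    rw [integral_sub hint (integrable_const _), measureReal_def, Measure.prod_apply hS,
      ← integral_toReal hmeas.aemeasurable (ae_of_all _ fun d => measure_lt_top _ _)]
    simp [measureReal_def]
  rw [hprod]
  simpa only [Real.enorm_eq_ofReal_abs] using
    enorm_integral_le_lintegral_enorm (μ := κ) fun d => Q.real (Prod.mk d ⁻¹' S) - c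

lemma map_prodMk_pi_eq_prod {ι ι' Ω 𝒟 A B : Type*} [Fintype ι] [Fintype ι'] [MeasurableSpace Ω]
    [MeasurableSpace 𝒟] [MeasurableSpace A] [MeasurableSpace B] {μ : Measure Ω}
    [IsProbabilityMeasure μ] {X : ι → Ω → A} {Y : ι' → Ω → B} {D : Ω → 𝒟} {P : Measure A}
    {Q : Measure B}
    (hX : ∀ i, Measurable (X i)) (hY : ∀ j, Measurable (Y j)) (hD : Measurable D)
    (hXP : ∀ i, μ.map (X i) = P) (hYQ : ∀ j, μ.map (Y j) = Q)
    (hiX : iIndepFun X μ) (hiY : iIndepFun Y μ)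
    (hXY : IndepFun (fun ω i => X i ω) (fun ω j => Y j ω) μ)
    (hDXY : IndepFun D (fun ω => (fun i => X i ω, fun j => Y j ω)) μ) :
    μ.map (fun ω => (D ω, (fun i => X i ω, fun j => Y j ω)))
      = (μ.map D).prod ((Measure.pi fun _ => P).prod (Measure.pi fun _ => Q)) := by
  have hX' : Measurable fun ω i => X i ω := measurable_pi_lambda _ hX
  have hY' : Measurable fun ω j => Y j ω := measurable_pi_lambda _ hY
  rw [(indepFun_iff_map_prod_eq_prod_map_map hD.aemeasurable (hX'.prodMk hY').aemeasurable).1 hDXY,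
    (indepFun_iff_map_prod_eq_prod_map_map hX'.aemeasurable hY'.aemeasurable).1 hXY,
    hiX.map_fun_eq_pi_map fun i => (hX i).aemeasurable,
    hiY.map_fun_eq_pi_map fun j => (hY j).aemeasurable]
  simp only [hXP, hYQ]

variable {𝒳 : Type u} {𝒴 : Type v} {𝒟 : Type w} [MeasurableSpace 𝒳] [MeasurableSpace 𝒴]
  [MeasurableSpace 𝒟] {r n m : ℕ} {ℓ : (Fin r → 𝒴) → ℝ} {P : Measure (𝒳 × 𝒴)}
  {fhat : 𝒟 → 𝒳 → ℝ}

lemma measurable_uStat (hℓ : Measurable ℓ) : Measurable (uStat ℓ : (Fin n → 𝒴) → ℝ) := by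
  classical
  exact (Finset.measurable_sum _ fun i _ => hℓ.comp
    (measurable_pi_lambda _ fun k => measurable_pi_apply (i k))).const_mul _

lemma measurable_uSemi (hℓ : Measurable ℓ) (hf : Measurable (Function.uncurry fhat)) :
    Measurable fun q : 𝒟 × ((Fin n → 𝒳 × 𝒴) × (Fin m → 𝒳)) =>
      uSemi ℓ (fhat q.1) q.2.1 q.2.2 := by
  have hU : Measurable fun q : 𝒟 × ((Fin n → 𝒳 × 𝒴) × (Fin m → 𝒳)) =>
      uStat ℓ fun i => (q.2.1 i).2 := (measurable_uStat hℓ).comp (by fun_prop)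
  have hlabeled : Measurable fun q : 𝒟 × ((Fin n → 𝒳 × 𝒴) × (Fin m → 𝒳)) =>
      ∑ i, fhat q.1 (q.2.1 i).1 :=
    Finset.measurable_sum _ fun i _ => hf.comp (measurable_fst.prodMk (by fun_prop))
  have hunlabeled : Measurable fun q : 𝒟 × ((Fin n → 𝒳 × 𝒴) × (Fin m → 𝒳)) =>
      ∑ j, fhat q.1 (q.2.2 j) :=
    Finset.measurable_sum _ fun j _ => hf.comp (measurable_fst.prodMk (by fun_prop))
  exact (hU.sub (hlabeled.const_mul _)).add ((hlabeled.add hunlabeled).const_mul _)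

variable [NeZero r] [IsProbabilityMeasure P]

lemma measurable_Lam (hf : Measurable (Function.uncurry fhat)) :
    Measurable fun d => Lam n m ℓ P (fhat d) := by
  have hfst : Measurable fun q : 𝒟 × (𝒳 × 𝒴) => fhat q.1 q.2.1 :=
    hf.comp (measurable_fst.prodMk measurable_snd.fst)
  have hmean : Measurable fun d => ∫ p : 𝒳 × 𝒴, fhat d p.1 ∂P :=
    (hfst.stronglyMeasurable.integral_prod_right (ν := P)).measurable
  have hcentered : Measurable fun q : 𝒟 × (𝒳 × 𝒴) => fhat q.1 q.2.1 - ∫ p, fhat q.1 p.1 ∂P :=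
    hfst.sub (hmean.comp measurable_fst)
  have hpsi : Measurable (psi1X ℓ P) :=
    (stronglyMeasurable_condExp.mono measurable_fst.comap_le).measurable
  have hvar : Measurable fun d => Var[fun p : 𝒳 × 𝒴 => fhat d p.1; P] :=
    (hcentered.enorm.pow_const 2).lintegral_prod_right'.ennreal_toReal
  have hcov : Measurable fun d => cov[fun p : 𝒳 × 𝒴 => fhat d p.1, psi1X ℓ P; P] :=
    ((hcentered.mul ((hpsi.comp measurable_snd).sub_const _)).stronglyMeasurable.integral_prod_right
      (ν := P)).measurable
  exact ((hvar.sub (hcov.const_mul 2)).const_mul _).const_add _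

lemma measurable_stdEstimator (hℓ : Measurable ℓ) (hf : Measurable (Function.uncurry fhat)) :
    Measurable fun q : 𝒟 × ((Fin n → 𝒳 × 𝒴) × (Fin m → 𝒳)) =>
      stdEstimator ℓ P (fhat q.1) q.2.1 q.2.2 :=
  (((measurable_uSemi hℓ hf).sub_const _).const_mul _).div
    ((measurable_Lam hf).comp measurable_fst).sqrt

lemma measurePreserving_labeled_unlabeled : MeasurePreserving
    (fun e : Fin n ⊕ Fin m → 𝒳 × 𝒴 => (fun i => e (Sum.inl i), fun j => (e (Sum.inr j)).1))
    (Measure.pi fun _ => P) ((Measure.pi fun _ => P).prod (Measure.pi fun _ => P.fst)) :=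
  ((MeasurePreserving.id (Measure.pi fun _ : Fin n => P)).prod
    (measurePreserving_pi (fun _ : Fin m => P) (fun _ => P.fst)
      fun _ => measurePreserving_fst_marginal)).comp
    (measurePreserving_sumPiEquivProdPi (X := fun _ : Fin n ⊕ Fin m => 𝒳 × 𝒴) fun _ => P)

theorem ofReal_abs_measureReal_prod_stdEstimator_sub_cdf_le {κ : Measure 𝒟}
    [IsProbabilityMeasure κ] (hℓ : Measurable ℓ) (hsym : SymmetricKernel ℓ)
    (hL : MemLp ℓ 2 (lawYs r P)) (hσ : 0 < sigma1Sq ℓ P) (hn : r < n)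
    (hf : Measurable (Function.uncurry fhat)) (t : ℝ) :
    ENNReal.ofReal |(κ.prod ((Measure.pi fun _ : Fin n => P).prod
        (Measure.pi fun _ : Fin m => P.fst))).real
          {q | stdEstimator ℓ P (fhat q.1) q.2.1 q.2.2 ≤ t} - Φ t|
      ≤ ENNReal.ofReal (boundConst r) * errorTerm n ℓ P
        (∫⁻ d, absCentralMoment 2 P.fst (fhat d) ∂κ)
        (∫⁻ d, absCentralMoment 3 P.fst (fhat d) ∂κ) := by
  have hS := measurableSet_le (measurable_stdEstimator (n := n) (m := m) (P := P) hℓ hf)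
    (measurable_const (a := t))
  have hM₂ := measurable_absCentralMoment (p := 2) (ν := P.fst) hf
  have hM₃ := measurable_absCentralMoment (p := 3) (ν := P.fst) hf
  refine (ofReal_abs_measureReal_prod_sub_le hS _).trans ?_
  calc _ ≤ ∫⁻ d, ENNReal.ofReal (boundConst r) * errorTerm n ℓ P
        (absCentralMoment 2 P.fst (fhat d)) (absCentralMoment 3 P.fst (fhat d)) ∂κ := by
        refine lintegral_mono fun d => ?_
        rw [← measurePreserving_labeled_unlabeled.measureReal_preimage
          (measurable_prodMk_left hS).nullMeasurableSet]
        exact ofReal_abs_measureReal_stdEstimator_sub_cdf_le hℓ hL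
          (hf.comp measurable_prodMk_left) hsym hn hσ t
    _ ≤ _ := by
        rw [lintegral_const_mul' _ _ ENNReal.ofReal_ne_top]
        gcongr
        exact lintegral_errorTerm_le hM₂ hM₃

end TrainedFunction

end

end SemiSup

theorem mainTheorem4 (r : ℕ) [NeZero r] :
    ∃ C : ℝ≥0, 0 < C ∧
      ∀ (𝒳 : Type u) (𝒴 : Type v) (𝒟 : Type w) (Ω : Type z)
        [MeasurableSpace 𝒳] [MeasurableSpace 𝒴] [MeasurableSpace 𝒟] [MeasurableSpace Ω]
        -- the law of the pair, and the kernel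
        (P : Measure (𝒳 × 𝒴)) [IsProbabilityMeasure P]
        (ℓ : (Fin r → 𝒴) → ℝ) (_ : Measurable ℓ) (_ : SemiSup.SymmetricKernel ℓ)
        (_ : MemLp ℓ 2 (SemiSup.lawYs r P))
        (_ : 0 < SemiSup.sigma1Sq ℓ P)
        -- sample sizes
        (n m : ℕ) (_ : r < n)
        -- labeled sample, unlabeled sample, auxiliary data
        (μ : Measure Ω) [IsProbabilityMeasure μ]
        (XY : Fin n → Ω → 𝒳 × 𝒴) (X' : Fin m → Ω → 𝒳) (D : Ω → 𝒟)
        (_ : ∀ i, Measurable (XY i)) (_ : ∀ j, Measurable (X' j)) (_ : Measurable D)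
        (_ : ∀ i, μ.map (XY i) = P) (_ : ∀ j, μ.map (X' j) = P.fst)
        (_ : iIndepFun XY μ) (_ : iIndepFun X' μ)
        (_ : IndepFun (fun ω i => XY i ω) (fun ω j => X' j ω) μ)
        (_ : IndepFun D (fun ω => ((fun i => XY i ω), (fun j => X' j ω))) μ)
        -- the training rule: `fhat (D ω)` is the trained function
        (fhat : 𝒟 → 𝒳 → ℝ) (_ : Measurable (Function.uncurry fhat)),
        ⨆ t : ℝ, ENNReal.ofReal
            |μ.real {ω | √(n : ℝ) *
                  (SemiSup.uSemi ℓ (fhat (D ω)) (fun i => XY i ω) (fun j => X' j ω)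
                    - SemiSup.psi ℓ P)
                  / √(SemiSup.Lam n m ℓ P (fhat (D ω))) ≤ t}
              - cdf (gaussianReal 0 1) t|
          ≤ C *
            ((SemiSup.momentEll1 3 ℓ P + SemiSup.momentF 3 μ (fun ω => fhat (D ω)) P)
                / ENNReal.ofReal (√(n : ℝ) * SemiSup.sigma1 ℓ P ^ 3)
              + (SemiSup.momentEll1 2 ℓ P ^ (1 / 2 : ℝ)
                  + SemiSup.momentF 2 μ (fun ω => fhat (D ω)) P ^ (1 / 2 : ℝ)
                  + ENNReal.ofReal (SemiSup.sigma1 ℓ P))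
                * ENNReal.ofReal (SemiSup.sigmaL ℓ P)
                / ENNReal.ofReal (√((n : ℝ) - r) * SemiSup.sigma1 ℓ P ^ 2)) := by
  refine ⟨(SemiSup.boundConst r).toNNReal, Real.toNNReal_pos.2 (SemiSup.boundConst_pos r), ?_⟩
  intro 𝒳 𝒴 𝒟 Ω _ _ _ _ P _ ℓ hℓ hsym hL hσ n m hn μ _ XY X' D hXY hX' hD hXYP hX'P hiXY hiX' hi
    hiD fhat hf
  refine iSup_le fun t => ?_
  have := Measure.isProbabilityMeasure_map (μ := μ) hD.aemeasurable
  have hS := measurableSet_le (SemiSup.measurable_stdEstimator (n := n) (m := m) (P := P) hℓ hf)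
    (measurable_const (a := t))
  have hevent := map_measureReal_apply (μ := μ)
    (hD.prodMk ((measurable_pi_lambda _ hXY).prodMk (measurable_pi_lambda _ hX'))) hS
  rw [SemiSup.map_prodMk_pi_eq_prod hXY hX' hD hXYP hX'P hiXY hiX' hi hiD] at hevent
  have hmoment (p : ℕ) : ∫⁻ d, SemiSup.absCentralMoment p P.fst (fhat d) ∂(μ.map D)
      = SemiSup.momentF p μ (fun ω => fhat (D ω)) P :=
    lintegral_map (SemiSup.measurable_absCentralMoment hf) hD
  have hbound := SemiSup.ofReal_abs_measureReal_prod_stdEstimator_sub_cdf_le (κ := μ.map D)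
    (m := m) hℓ hsym hL hσ hn hf t
  rw [hevent, hmoment, hmoment] at hbound
  exact hbound
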